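/- Let $\Sigma$ be a finite alphabet with $\{0,1\}\subseteq\Sigma$; tuples of strings are coded as strings in a standard way. For $k\ge 0$, a $k$-round rational interactive protocol $\Pi$ consists of polynomial-time computable functions $V:\Sigma^*\to\Sigma^*$, $R:\Sigma^*\to[0,1]$ (values written as finite binary fractions) and $\varphi:\Sigma^*\to\Sigma^*$, and of polynomials $p,\ell$. On input $x$, Arthur draws independent uniform private strings $r_1,\dots,r_k\in\{0,1\}^{\ell(|x|)}$; in round $t$ Merlin sends a string $m_t\in\Sigma^*$ with $|m_t|\le p(|x|)$ and Arthur answers $a_t=V(x;m_1,a_1,\dots,a_{t-1},m_t;r_1,\dots,r_t)$. The reward is $R(x;m_1,r_1,\dots,m_k,r_k)$ and the computed value is $\varphi(x;m_1,a_1,\dots,a_{k-1},m_k)$. Merlin is rational if, in every round, he sends a message that maximizes, conditional on $(m_1,a_1,\dots,m_{t-1},a_{t-1})$, the expected reward under optimal play in the later rounds. The protocol computes $f:\Sigma^*\to\Sigma^*$ if, for every $x$ and every rational behavior of Merlin, the computed value is always $f(x)$. $\mathrm{FRMA}[k]$ is the class of functions $\Sigma^*\to\Sigma^*$ computed by $k$-round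 protocols; $\mathrm{DRMA}[k]$ is the class of languages over $\Sigma$ whose characteristic function (with values $0,1$) is in $\mathrm{FRMA}[k]$. For a class $\mathcal F$ of functions, $\mathrm{DRMA}[k]^{\mathcal F[1]}$ is the class of languages whose characteristic function is computed by a $k$-round protocol in which $V,R,\varphi$ are computed in polynomial time with an oracle $O\in\mathcal F$, and in every run, whatever Merlin does, Arthur makes at most one oracle query in total. For a class $\mathcal C$ of languages, $\mathrm{DRMA}[k]^{\|\mathcal C}$ is defined in the same way with an oracle $A\in\mathcal C$, except that in every run Arthur may make any (polynomial) number of queries, all in parallel: he writes down one list of queries before he sees any of the answers. In both cases, writing down again a query (or list) already made in the same run does not count as a new one. Then for all integers $i,j\ge 0$, $$\mathrm{DRMA}[i+j]\subseteq \mathrm{DRMA}[i]^{(\mathrm{FRMA}[j])[1]}\subseteq \mathrm{DRMA}[i]^{\|\mathrm{DRMA}[j]}.$$ -/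

import Mathlib

open scoped BigOperators

namespace RationalProof

/-! ### Polynomial time

Strings are lists over a finite alphabet `α`, which contains the two bits `0 ≠ 1` through an
injection `bit : Bool ↪ α`. Tuples of strings are written down with an extra separator symbol. -/

/-- The tuple `(s₁, …, sₙ)` of strings as one string: `s₁ # s₂ # … sₙ #`, with `# = none`. -/
def tupleCode {α : Type} (l : List (List α)) : List (Option α) :=
  l.flatMap fun s => s.map some ++ [none]

/-- A pair of tuples as one string, with one more separator between them. -/
def pairCode {α : Type} (p : List (List α) × List (List α)) : List (Option (Option α)) :=
  (tupleCode p.1).map some ++ none :: (tupleCode p.2).map some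

/-- Some Turing machine computes `f` in time polynomial in the length of its (coded) input. -/
def PolyTime {X Y A B : Type} (codeX : X → List A) (codeY : Y → List B) (f : X → Y) : Prop :=
  Nonempty (Turing.TM2ComputableInPolyTime codeX codeY f)

/-- The finite binary fraction `b₀.b₁b₂b₃…`. -/
def binFrac : List Bool → ℚ
  | [] => 0
  | b :: w => (if b then 1 else 0) + binFrac w / 2

/-! ### Rational interactive protocols -/

/-- The functions of a rational interactive protocol: Arthur's messages `V`, the reward `R` (the
digits of a binary fraction), the value function `φ`, and the polynomials that bound the length of
Merlin's messages and give the length of each of Arthur's random strings. -/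
structure Protocol (α : Type) where
  msgLen : Polynomial ℕ
  coinLen : Polynomial ℕ
  V : List (List α) → List α
  R : List (List α) → List Bool
  φ : List (List α) → List α

/-- A history `(m₁, a₁), …, (mᵢ, aᵢ)`: what Merlin knows (besides the input) after `i` rounds. -/
abbrev History (α : Type) := List (List α × List α)

/-- `m₁, a₁, …, mᵢ, aᵢ` as a flat tuple. -/
def History.flat {α : Type} (h : History α) : List (List α) := h.flatMap fun p => [p.1, p.2]

namespace Protocol

section
variable {α : Type} (P : Protocol α) (bit : Bool ↪ α) (k : ℕ) (x : List α)

/-- Arthur's private random strings `r₁, …, r_k` in the `k`-round interaction on `x`. -/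
abbrev Coins : Type := Fin k → Fin (P.coinLen.eval x.length) → Bool

variable {k x} in
/-- The random strings `r₁, …, r_k` as strings over `α`. -/
def coinStrings (r : P.Coins k x) : List (List α) :=
  List.ofFn fun t => List.ofFn fun s => bit (r t s)

/-- Merlin's possible messages on input `x`. -/
noncomputable def messages [Finite α] : Finset (List α) :=
  (List.finite_length_le α (P.msgLen.eval x.length)).toFinset

theorem messages_nonempty [Finite α] : (P.messages x).Nonempty :=
  ⟨[], by simp [messages]⟩

/-- The input `(x; m₁, a₁, …, aᵢ, m; r₁, …, rᵢ₊₁)` of `V` after the history `h` of `i` rounds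
and the next message `m`. -/
def arthurInput (h : History α) (m : List α) (r : P.Coins k x) : List (List α) :=
  x :: (h.flat ++ m :: (P.coinStrings bit r).take (h.length + 1))

/-- Arthur's answer to the message `m` sent after the history `h`. -/
def reply (h : History α) (m : List α) (r : P.Coins k x) : List α :=
  P.V (P.arthurInput bit k x h m r)

/-- The input `(x; m₁, r₁, …, m_k, r_k)` of the reward function. -/
def rewardInput (h : History α) (r : P.Coins k x) : List (List α) :=
  x :: (List.zipWith (fun p s => [p.1, s]) h (P.coinStrings bit r)).flatten

/-- The input `(x; m₁, a₁, …, m_k)` of the value function, without Arthur's last message. -/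
def valueInput (h : History α) : List (List α) := x :: h.flat.dropLast

/-- The random strings that are compatible with the history `h`. Given `h`, Merlin knows that
Arthur's random strings are uniformly distributed on this set. -/
noncomputable def consistentCoins (h : History α) : Finset (P.Coins k x) :=
  open Classical in
  Finset.univ.filter fun r =>
    ∀ t (ht : t < h.length), P.reply bit k x (h.take t) h[t].1 r = h[t].2

/-- The maximal expected reward, conditional on the history `h`, when `n` rounds remain. -/
noncomputable def optReward [Finite α] : ℕ → History α → ℚ
  | 0, h => (P.consistentCoins bit k x h).expect fun r =>
      binFrac (P.R (P.rewardInput bit k x h r))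
  | n + 1, h => (P.messages x).sup' (P.messages_nonempty x) fun m =>
      (P.consistentCoins bit k x h).expect fun r =>
        optReward n (h ++ [(m, P.reply bit k x h m r)])

/-- The expected reward, conditional on `h`, if Merlin sends `m` next and then behaves optimally
in the `n` rounds after that. -/
noncomputable def msgReward [Finite α] (n : ℕ) (h : History α) (m : List α) : ℚ :=
  (P.consistentCoins bit k x h).expect fun r =>
    P.optReward bit k x n (h ++ [(m, P.reply bit k x h m r)])

/-- The history after `t` rounds in which Merlin sends `ms 0, ms 1, …` and Arthur has the random
strings `r`. -/
def run (ms : ℕ → List α) (r : P.Coins k x) : ℕ → History α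
  | 0 => []
  | t + 1 => run ms r t ++ [(ms t, P.reply bit k x (run ms r t) (ms t) r)]

/-- Merlin is rational in this run: each message is an admissible one that maximizes the
conditional expected reward. -/
def RationalRun [Finite α] (ms : ℕ → List α) (r : P.Coins k x) : Prop :=
  ∀ t < k, ms t ∈ P.messages x ∧ ∀ m ∈ P.messages x,
    P.msgReward bit k x (k - 1 - t) (P.run bit k x ms r t) m ≤
      P.msgReward bit k x (k - 1 - t) (P.run bit k x ms r t) (ms t)

end

/-- The `k`-round protocol computes `f`: rewards lie in `[0, 1]`, and whenever Merlin is rational,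
the value computed is `f x`. -/
def Computes {α : Type} [Finite α] (P : Protocol α) (bit : Bool ↪ α) (k : ℕ)
    (f : List α → List α) : Prop :=
  (∀ u, binFrac (P.R u) ≤ 1) ∧
    ∀ x (ms : ℕ → List α) (r : P.Coins k x), P.RationalRun bit k x ms r →
      f x = P.φ (valueInput x (P.run bit k x ms r k))

/-- All functions of the protocol are computable in polynomial time. -/
def IsPolyTime {α : Type} (P : Protocol α) : Prop :=
  PolyTime tupleCode id P.V ∧ PolyTime tupleCode id P.R ∧ PolyTime tupleCode id P.φ

end Protocol

/-- The class `FRMA[k]` of functions. -/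
def FRMA {α : Type} [Finite α] (bit : Bool ↪ α) (k : ℕ) : Set (List α → List α) :=
  {f | ∃ P : Protocol α, P.IsPolyTime ∧ P.Computes bit k f}

/-- The characteristic function of a language. -/
noncomputable def charFn {α : Type} (bit : Bool ↪ α) (L : Language α) (x : List α) : List α :=
  open Classical in [bit (decide (x ∈ L))]

/-- The class `DRMA[k]` of languages. -/
def DRMA {α : Type} [Finite α] (bit : Bool ↪ α) (k : ℕ) : Set (Language α) :=
  {L | charFn bit L ∈ FRMA bit k}

/-! ### Protocols in which Arthur has an oracle -/

/-- A computation that queries an oracle non-adaptively: from its input it prepares a list of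
queries (possibly empty), and from the input and the list of answers it computes its output. -/
structure OracleFn (α β : Type) where
  ask : List (List α) → List (List α)
  out : List (List α) × List (List α) → List β

/-- The function computed with the oracle `O`. -/
def OracleFn.eval {α β : Type} (F : OracleFn α β) (O : List α → List α) (u : List (List α)) :
    List β :=
  F.out (u, (F.ask u).map O)

/-- Both phases of the computation run in polynomial time. -/
def OracleFn.IsPolyTime {α β : Type} (F : OracleFn α β) : Prop :=
  PolyTime tupleCode tupleCode F.ask ∧ PolyTime pairCode id F.out

/-- A rational interactive protocol in which Arthur may query an oracle. -/
structure OracleProtocol (α : Type) where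
  msgLen : Polynomial ℕ
  coinLen : Polynomial ℕ
  V : OracleFn α α
  R : OracleFn α Bool
  φ : OracleFn α α

namespace OracleProtocol

/-- The protocol that results when the oracle is `O`. -/
def withOracle {α : Type} (P : OracleProtocol α) (O : List α → List α) : Protocol α where
  msgLen := P.msgLen
  coinLen := P.coinLen
  V := P.V.eval O
  R := P.R.eval O
  φ := P.φ.eval O

/-- All functions of the protocol are computable in polynomial time with the oracle. -/
def IsPolyTime {α : Type} (P : OracleProtocol α) : Prop :=
  P.V.IsPolyTime ∧ P.R.IsPolyTime ∧ P.φ.IsPolyTime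

/-- The nonempty lists of queries made in a run with oracle `O`: for Arthur's messages, for the
reward and for the value. -/
def queryLists {α : Type} (P : OracleProtocol α) (bit : Bool ↪ α) (k : ℕ) (O : List α → List α)
    (x : List α) (ms : ℕ → List α) (r : (P.withOracle O).Coins k x) : Set (List (List α)) :=
  let Q := P.withOracle O
  {l | l ≠ [] ∧
    ((∃ t < k, l = P.V.ask (Q.arthurInput bit k x (Q.run bit k x ms r t) (ms t) r)) ∨
      l = P.R.ask (Q.rewardInput bit k x (Q.run bit k x ms r k) r) ∨
      l = P.φ.ask (Protocol.valueInput x (Q.run bit k x ms r k)))}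

/-- In every run, whatever Merlin does, Arthur queries the oracle `O` in parallel: he prepares a
single list of queries. (Writing down the same list again, as an Arthur does who recomputes what
he already knows, is no new query.) -/
def ParallelQueries {α : Type} [Finite α] (P : OracleProtocol α) (bit : Bool ↪ α) (k : ℕ)
    (O : List α → List α) : Prop :=
  ∀ x ms (r : (P.withOracle O).Coins k x), (∀ t < k, ms t ∈ (P.withOracle O).messages x) →
    (P.queryLists bit k O x ms r).Subsingleton

/-- In every run Arthur makes at most one query to the oracle `O`. -/
def OneQuery {α : Type} [Finite α] (P : OracleProtocol α) (bit : Bool ↪ α) (k : ℕ)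
    (O : List α → List α) : Prop :=
  P.ParallelQueries bit k O ∧
    ∀ x ms (r : (P.withOracle O).Coins k x), (∀ t < k, ms t ∈ (P.withOracle O).messages x) →
      ∀ l ∈ P.queryLists bit k O x ms r, l.length ≤ 1

end OracleProtocol

/-- `DRMA[k]^{C[1]}` for a class `C` of functions: one oracle query is allowed. -/
def DRMAOneQuery {α : Type} [Finite α] (bit : Bool ↪ α) (k : ℕ) (C : Set (List α → List α)) :
    Set (Language α) :=
  {L | ∃ O ∈ C, ∃ P : OracleProtocol α, P.IsPolyTime ∧ P.OneQuery bit k O ∧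
    (P.withOracle O).Computes bit k (charFn bit L)}

/-- `DRMA[k]^{||C}` for a class `C` of languages: the oracle queries are made in parallel. -/
def DRMAParallel {α : Type} [Finite α] (bit : Bool ↪ α) (k : ℕ) (C : Set (Language α)) :
    Set (Language α) :=
  {L | ∃ A ∈ C, ∃ P : OracleProtocol α, P.IsPolyTime ∧ P.ParallelQueries bit k (charFn bit A) ∧
    (P.withOracle (charFn bit A)).Computes bit k (charFn bit L)}

end RationalProof

/-! Consider the first inclusion with i, j > 0. By `exists_claim_form` the given protocol P may be
assumed to read its value off a bit at the start of Merlin's first message. To get there, run the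
original protocol and pay 1/2 + R/4 if its value agrees with the claimed bit, and 0 otherwise. The
original value is right on every rational run, so the right claim loses nothing, while the wrong
claim is paid 0 on every rational run and is strictly worse.

Arthur now plays only the first i rounds of P. Merlin will behave as in P if he is paid, at the
history h reached, the optimal expected reward e of the remaining j rounds. Arthur cannot compute e,
but he can pay it on average: he spends g spare coins on a random dyadic threshold w, asks the
oracle whether w < e, and pays 1 or 0. The expected payment is e up to 2^-g
(`abs_sum_oddFrac_sub_le`). The rewards of P are binary fractions of polynomial length, so
unnormalized expected rewards are multiples of some 2^-K (`exists_int_tot_game`). For g large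
enough, distinct values of messages differ by more than the error (`two_mul_sub_le`). Hence rational
play in the short game is rational play in the first i rounds of P (`Game.Cover.rationalTo`). It
extends to a rational run of P (`Game.RationalTo.extend`), and so the claim is right.

The threshold questions form a language in DRMA[j] (`thresholdLanguage_mem`). Merlin first claims
whether e exceeds w. If he says yes, the last j rounds are played with fresh coins and he gets the
reward of P; if he says no, he gets w. In both cases he is paid 0 when the fresh coins do not fit h:
this conditions on h by rejection. The threshold has too many binary digits to equal e
(`oddFrac_ne`), so one claim is strictly better (`Game.Cover.claim_eq`).

For the second inclusion, the value of a protocol has polynomial length (`exists_valueLen`). The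
single query to the function is therefore replaced by parallel questions about all symbols of its
value (`digitLanguage_mem`, `digitValues_eq`).

Both arguments need all functions involved to be computable in polynomial time. This rests on
closure under composition, pairing and bounded iteration (`Machine.polyTime_comp`,
`Machine.polyTime_pair`, `Machine.polyTime_iterate`), proved by running Turing machines as
subroutines on disjoint stacks. -/

namespace RationalProof

namespace Machine

open Turing TM2 TM2.Stmt Function

/-! ### Running a stack machine inside a larger one -/

section Basic

variable {K : Type} [DecidableEq K] {Γ : K → Type} {Λ Λ₁ Λ₂ σ σ₁ σ₂ : Type}

/-- The machine with program `m` gets from `c` to `c'` in at most `t` steps. -/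
def Leads (m : Λ → Stmt Γ Λ σ) (t : ℕ) (c c' : Cfg Γ Λ σ) : Prop :=
  ∃ n ≤ t, (flip bind (step m))^[n] (some c) = some c'

theorem Leads.mono {m : Λ → Stmt Γ Λ σ} {t t' : ℕ} {c c' : Cfg Γ Λ σ} (h : Leads m t c c')
    (ht : t ≤ t') : Leads m t' c c' := by
  obtain ⟨n, hn, h⟩ := h
  exact ⟨n, hn.trans ht, h⟩

theorem Leads.refl (m : Λ → Stmt Γ Λ σ) (c : Cfg Γ Λ σ) : Leads m 0 c c := ⟨0, le_rfl, rfl⟩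

theorem Leads.congr_stk {m : Λ → Stmt Γ Λ σ} {t : ℕ} {c : Cfg Γ Λ σ} {l : Option Λ} {v : σ}
    {S S' : ∀ k, List (Γ k)} (h : Leads m t c ⟨l, v, S⟩) (hS : S' = S) :
    Leads m t c ⟨l, v, S'⟩ := hS ▸ h

theorem Leads.trans {m : Λ → Stmt Γ Λ σ} {t t' : ℕ} {c c' c'' : Cfg Γ Λ σ} (h : Leads m t c c')
    (h' : Leads m t' c' c'') : Leads m (t + t') c c'' := by
  obtain ⟨n, hn, h⟩ := h
  obtain ⟨n', hn', h'⟩ := h'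
  refine ⟨n' + n, by omega, ?_⟩
  rw [iterate_add_apply, h, h']

theorem Leads.single (m : Λ → Stmt Γ Λ σ) (l : Λ) (v : σ) (S : ∀ k, List (Γ k)) :
    Leads m 1 ⟨some l, v, S⟩ (stepAux (m l) v S) := ⟨1, le_rfl, rfl⟩

theorem iterate_none (m : Λ → Stmt Γ Λ σ) (n : ℕ) :
    (flip bind (step m))^[n] none = none := by
  induction n with
  | zero => rfl
  | succ n ih => rw [iterate_succ_apply]; exact ih

theorem iterate_halted (m : Λ → Stmt Γ Λ σ) {n : ℕ} {v : σ} {S : ∀ k, List (Γ k)}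
    {c : Cfg Γ Λ σ} (h : (flip bind (step m))^[n] (some ⟨none, v, S⟩) = some c) :
    c = ⟨none, v, S⟩ := by
  cases n with
  | zero => exact (Option.some.inj h).symm
  | succ n =>
    rw [iterate_succ_apply] at h
    change (flip bind (step m))^[n] none = some c at h
    rw [iterate_none] at h
    cases h

/-- A statement over the labels `Λ₁` and the states `σ₁` as one over `Λ₂` and `σ₂`; instead of
halting, it does `e`. -/
def lift (l : Λ₁ → Λ₂) (g : σ₂ → σ₁) (p : σ₁ → σ₂ → σ₂) (e : Stmt Γ Λ₂ σ₂) :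
    Stmt Γ Λ₁ σ₁ → Stmt Γ Λ₂ σ₂
  | push k f q => push k (fun v => f (g v)) (lift l g p e q)
  | peek k f q => peek k (fun v s => p (f (g v) s) v) (lift l g p e q)
  | pop k f q => pop k (fun v s => p (f (g v) s) v) (lift l g p e q)
  | load f q => load (fun v => p (f (g v)) v) (lift l g p e q)
  | branch f q₁ q₂ => branch (fun v => f (g v)) (lift l g p e q₁) (lift l g p e q₂)
  | goto f => goto fun v => l (f (g v))
  | halt => e

/-- The configuration of the lifted machine after a step. -/
def liftCfg (l : Λ₁ → Λ₂) (p : σ₁ → σ₂ → σ₂) (e : Stmt Γ Λ₂ σ₂) (v : σ₂) :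
    Cfg Γ Λ₁ σ₁ → Cfg Γ Λ₂ σ₂
  | ⟨some a, w, S⟩ => ⟨some (l a), p w v, S⟩
  | ⟨none, w, S⟩ => stepAux e (p w v) S

variable {l : Λ₁ → Λ₂} {g : σ₂ → σ₁} {p : σ₁ → σ₂ → σ₂} {e : Stmt Γ Λ₂ σ₂}

/-- The three laws say that `g` and `p` read and overwrite one component of the state. The lifted
statement uses the state only through `g` and changes it only through `p`, so earlier writes to the
component are hidden by the last one. -/
theorem stepAux_lift (hgp : ∀ a v, g (p a v) = a) (hpp : ∀ a b v, p a (p b v) = p a v)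
    (hpg : ∀ v, p (g v) v = v) (q : Stmt Γ Λ₁ σ₁) (v : σ₂) (S : ∀ k, List (Γ k)) :
    stepAux (lift l g p e q) v S = liftCfg l p e v (stepAux q (g v) S) := by
  have key : ∀ (a : σ₁) (v : σ₂) (c : Cfg Γ Λ₁ σ₁),
      liftCfg l p e (p a v) c = liftCfg l p e v c := by
    rintro a v ⟨_ | b, w, T⟩ <;> simp [liftCfg, hpp]
  induction q generalizing v S with
  | push k f q ih => simp [lift, ih]
  | peek k f q ih => simp [lift, ih, hgp, key]
  | pop k f q ih => simp [lift, ih, hgp, key]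
  | load f q ih => simp [lift, ih, hgp, key]
  | branch f q₁ q₂ ih₁ ih₂ => simp only [lift, stepAux, ih₁, ih₂]; cases f (g v) <;> rfl
  | goto f => simp [lift, liftCfg, hpg]
  | halt => simp [lift, liftCfg, hpg]

/-- Steps correspond one to one: `e` is executed within the halting step of `m₁`. Hence the time
bound is unchanged. -/
theorem Leads.lift {m₁ : Λ₁ → Stmt Γ Λ₁ σ₁} {m₂ : Λ₂ → Stmt Γ Λ₂ σ₂}
    (hgp : ∀ a v, g (p a v) = a) (hpp : ∀ a b v, p a (p b v) = p a v)
    (hpg : ∀ v, p (g v) v = v) (hm : ∀ a, m₂ (l a) = Machine.lift l g p e (m₁ a))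
    {t : ℕ} {a : Λ₁} {w' : σ₁} {v : σ₂} {S S' : ∀ k, List (Γ k)}
    (h : Leads m₁ t ⟨some a, g v, S⟩ ⟨none, w', S'⟩) :
    Leads m₂ t ⟨some (l a), v, S⟩ (stepAux e (p w' v) S') := by
  obtain ⟨n, hn, h⟩ := h
  refine Leads.mono ?_ hn
  clear hn
  induction n generalizing a v S with
  | zero => cases h
  | succ n ih =>
    rw [iterate_succ_apply] at h
    change (flip bind (step m₁))^[n] (some (stepAux (m₁ a) (g v) S)) = _ at h
    rw [add_comm]
    refine (Leads.single m₂ (l a) v S).trans ?_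
    rw [hm, stepAux_lift hgp hpp hpg]
    rcases hc : stepAux (m₁ a) (g v) S with ⟨_ | b, w, T⟩
    · rw [hc] at h
      have := iterate_halted m₁ h
      cases this
      exact (Leads.refl _ _).mono (Nat.zero_le _)
    · rw [hc] at h
      have := ih (a := b) (v := p w v) (S := T) (by rw [hgp]; exact h)
      rwa [hpp] at this

variable {K₁ : Type} [DecidableEq K₁]

/-- A statement about the stacks `K₁` as one about more stacks. -/
def embed (i : K₁ → K) : Stmt (fun k => Γ (i k)) Λ σ → Stmt Γ Λ σ
  | push k f q => push (i k) f (embed i q)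
  | peek k f q => peek (i k) f (embed i q)
  | pop k f q => pop (i k) f (embed i q)
  | load f q => load f (embed i q)
  | branch f q₁ q₂ => branch f (embed i q₁) (embed i q₂)
  | goto f => goto f
  | halt => halt

/-- `c` restricts to `c₁` on the stacks in the image of `i`, and to `S` elsewhere. -/
def Restricts (i : K₁ → K) (S : ∀ k, List (Γ k)) (c : Cfg Γ Λ σ)
    (c₁ : Cfg (fun k => Γ (i k)) Λ σ) : Prop :=
  c.l = c₁.l ∧ c.var = c₁.var ∧ (∀ k, c.stk (i k) = c₁.stk k) ∧
    ∀ k, k ∉ Set.range i → c.stk k = S k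

/-- Only stacks in the range of `i` are touched. Injectivity makes an update of one of them
invisible to the others. -/
theorem stepAux_embed {i : K₁ → K} (hi : Injective i) (q : Stmt (fun k => Γ (i k)) Λ σ) (v : σ)
    (S₀ S : ∀ k, List (Γ k)) (S₁ : ∀ k, List (Γ (i k))) (h₁ : ∀ k, S (i k) = S₁ k)
    (h₀ : ∀ k, k ∉ Set.range i → S k = S₀ k) :
    Restricts i S₀ (stepAux (embed i q) v S) (stepAux q v S₁) := by
  have upd : ∀ (S : ∀ k, List (Γ k)) (S₁ : ∀ k, List (Γ (i k))) (k : K₁) (w : List (Γ (i k))),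
      (∀ k, S (i k) = S₁ k) → (∀ k, k ∉ Set.range i → S k = S₀ k) →
      (∀ j, update S (i k) w (i j) = update S₁ k w j) ∧
        ∀ j, j ∉ Set.range i → update S (i k) w j = S₀ j := by
    intro S S₁ k w h₁ h₀
    constructor
    · intro j
      by_cases hj : j = k
      · subst hj; simp
      · rw [update_of_ne hj, update_of_ne (hi.ne hj), h₁]
    · intro j hj
      rw [update_of_ne, h₀ j hj]
      rintro rfl
      exact hj ⟨k, rfl⟩
  induction q generalizing v S S₁ with
  | push k f q ih =>
    obtain ⟨a, b⟩ := upd S S₁ k (f v :: S (i k)) h₁ h₀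
    simp only [embed, stepAux]
    rw [← h₁]
    exact ih _ _ _ a b
  | peek k f q ih =>
    simp only [embed, stepAux]
    rw [h₁]
    exact ih _ _ _ h₁ h₀
  | pop k f q ih =>
    obtain ⟨a, b⟩ := upd S S₁ k (S (i k)).tail h₁ h₀
    simp only [embed, stepAux]
    rw [← h₁]
    exact ih _ _ _ a b
  | load f q ih => exact ih _ _ _ h₁ h₀
  | branch f q₁ q₂ ih₁ ih₂ =>
    simp only [embed, stepAux]
    cases f v
    · exact ih₂ _ _ _ h₁ h₀
    · exact ih₁ _ _ _ h₁ h₀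
  | goto f => exact ⟨rfl, rfl, h₁, h₀⟩
  | halt => exact ⟨rfl, rfl, h₁, h₀⟩

theorem Leads.embed {i : K₁ → K} (hi : Injective i) {m : Λ → Stmt (fun k => Γ (i k)) Λ σ}
    {t : ℕ} {l : Λ} {v v' : σ} {S S' : ∀ k, List (Γ k)}
    (h : Leads m t ⟨some l, v, fun k => S (i k)⟩ ⟨none, v', fun k => S' (i k)⟩)
    (hS : ∀ k, k ∉ Set.range i → S' k = S k) :
    Leads (fun a => Machine.embed i (m a)) t ⟨some l, v, S⟩ ⟨none, v', S'⟩ := by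
  obtain ⟨n, hn, h⟩ := h
  refine ⟨n, hn, ?_⟩
  clear hn
  have key : ∀ (n : ℕ) (c : Cfg Γ Λ σ) (c₁ c' : Cfg (fun k => Γ (i k)) Λ σ),
      Restricts i S c c₁ → (flip bind (step m))^[n] (some c₁) = some c' →
      ∃ d, (flip bind (step fun a => Machine.embed i (m a)))^[n] (some c) = some d ∧
        Restricts i S d c' := by
    intro n
    induction n with
    | zero =>
      intro c c₁ c' hc h
      cases h
      exact ⟨c, rfl, hc⟩
    | succ n ih =>
      rintro ⟨l, v, S₂⟩ ⟨l₁, v₁, S₁⟩ c' ⟨hl, hv, h₁, h₀⟩ h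
      simp only at hl hv h₁ h₀
      subst hl hv
      rw [iterate_succ_apply] at h ⊢
      cases l with
      | none =>
        change (flip bind (step m))^[n] none = _ at h
        rw [iterate_none] at h
        cases h
      | some l => exact ih _ _ _ (stepAux_embed hi (m l) v S S₂ S₁ h₁ h₀) h
  obtain ⟨⟨l', w', T⟩, hd, hl, hw, h₁, h₀⟩ := key n ⟨some l, v, S⟩ _ _
    ⟨rfl, rfl, fun _ => rfl, fun _ _ => rfl⟩ h
  simp only at hl hw h₁ h₀
  subst hl hw
  rw [hd]
  congr 2
  funext k
  by_cases hk : k ∈ Set.range i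
  · obtain ⟨k, rfl⟩ := hk
    exact h₁ k
  · rw [h₀ k hk, hS k hk]

/-- Push a list, the last symbol first. -/
def pushList (k : K) : List (Γ k) → Stmt Γ Λ σ → Stmt Γ Λ σ
  | [], q => q
  | a :: w, q => pushList k w (push k (fun _ => a) q)

theorem stepAux_pushList (k : K) (w : List (Γ k)) (q : Stmt Γ Λ σ) (v : σ)
    (S : ∀ k, List (Γ k)) :
    stepAux (pushList k w q) v S = stepAux q v (update S k (w ++ S k)) := by
  induction w generalizing q with
  | nil => simp [pushList]
  | cons a w ih => simp [pushList, ih]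

/-- Branch on the current state, one of those in a list. -/
noncomputable def dispatchList (f : σ → Stmt Γ Λ σ) : List σ → Stmt Γ Λ σ
  | [] => halt
  | a :: w => open Classical in branch (fun v => decide (v = a)) (f a) (dispatchList f w)

theorem stepAux_dispatchList (f : σ → Stmt Γ Λ σ) (w : List σ) (v : σ) (hv : v ∈ w)
    (S : ∀ k, List (Γ k)) : stepAux (dispatchList f w) v S = stepAux (f v) v S := by
  induction w with
  | nil => cases hv
  | cons a w ih =>
    simp only [dispatchList, stepAux]
    by_cases h : v = a
    · subst h; simp
    · simp only [h, decide_false, cond_false]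
      exact ih (by simpa [h] using hv)

/-- Branch on the current state. -/
noncomputable def dispatch [Finite σ] (f : σ → Stmt Γ Λ σ) : Stmt Γ Λ σ :=
  dispatchList f (Set.finite_univ (α := σ)).toFinset.toList

/-- A statement pushes a fixed number of symbols. Branching over the finitely many states allows a
push whose length depends on the state. -/
theorem stepAux_dispatch [Finite σ] (f : σ → Stmt Γ Λ σ) (v : σ) (S : ∀ k, List (Γ k)) :
    stepAux (dispatch f) v S = stepAux (f v) v S :=
  stepAux_dispatchList f _ v (by simp) S

end Basic

/-! ### Finite transducers and program fragments -/

/-- A finite transducer. -/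
structure Transducer (A B : Type) where
  Q : Type
  [fin : Finite Q]
  start : Q
  next : Q → A → Q
  emit : Q → A → List B
  last : Q → List B

namespace Transducer

variable {A B : Type}

/-- The output of a transducer from a given state. -/
def outFrom (T : Transducer A B) : T.Q → List A → List B
  | q, [] => T.last q
  | q, a :: w => T.emit q a ++ T.outFrom (T.next q a) w

/-- The output of a transducer. -/
def out (T : Transducer A B) (w : List A) : List B := T.outFrom T.start w

/-- The transducer that maps every symbol. -/
def mapping (g : A → B) : Transducer A B where
  Q := Unit
  start := ()
  next _ _ := ()
  emit _ a := [g a]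
  last _ := []

@[simp]
theorem out_mapping (g : A → B) (w : List A) : (mapping g).out w = w.map g := by
  have : ∀ q, (mapping g).outFrom q w = w.map g := by
    induction w with
    | nil => intro q; rfl
    | cons a w ih => intro q; simp [outFrom, ih]; rfl
  exact this _

theorem length_out_le [Finite A] (T : Transducer A B) :
    ∃ c, ∀ w, (T.out w).length ≤ c * w.length + c := by
  have := T.fin
  obtain ⟨c₁, h₁⟩ := (Set.finite_range fun p : T.Q × A => (T.emit p.1 p.2).length).bddAbove
  obtain ⟨c₂, h₂⟩ := (Set.finite_range fun q : T.Q => (T.last q).length).bddAbove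
  refine ⟨c₁ + c₂, fun w => ?_⟩
  have key : ∀ q, (T.outFrom q w).length ≤ c₁ * w.length + c₂ := by
    induction w with
    | nil => intro q; simpa [outFrom] using h₂ ⟨q, rfl⟩
    | cons a w ih =>
      intro q
      have e₁ := h₁ ⟨(q, a), rfl⟩
      have e₂ := ih (T.next q a)
      simp only [outFrom, List.length_append, List.length_cons] at *
      linarith
  have := key T.start
  rw [out]
  nlinarith

end Transducer

section Frag

variable {K : Type} [DecidableEq K] {Γ : K → Type}

/-- A machine without designated input and output stacks. -/
structure Frag {K : Type} (Γ : K → Type) where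
  Λ : Type
  σ : Type
  [finΛ : Finite Λ]
  [finσ : Finite σ]
  main : Λ
  init : σ
  m : Λ → Stmt Γ Λ σ

attribute [instance] Frag.finΛ Frag.finσ Transducer.fin

/-- Started on the stacks `S`, the machine halts on the stacks `S'` within `t` steps. -/
def Frag.Runs (F : Frag Γ) (t : ℕ) (S S' : ∀ k, List (Γ k)) : Prop :=
  Leads F.m t ⟨some F.main, F.init, S⟩ ⟨none, F.init, S'⟩

/-- One machine after the other. -/
def Frag.seq (F G : Frag Γ) : Frag Γ where
  Λ := F.Λ ⊕ G.Λ
  σ := F.σ × G.σ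
  main := .inl F.main
  init := (F.init, G.init)
  m := Sum.elim
    (fun a => lift .inl Prod.fst (fun w v => (w, v.2)) (goto fun _ => .inr G.main) (F.m a))
    (fun a => lift .inr Prod.snd (fun w v => (v.1, w)) halt (G.m a))

/-- `Runs` ends in the initial internal state, so fragments can be chained and repeated without a
reset. -/
theorem Frag.Runs.seq {F G : Frag Γ} {t t' : ℕ} {S S' S'' : ∀ k, List (Γ k)}
    (h : F.Runs t S S') (h' : G.Runs t' S' S'') : (F.seq G).Runs (t + t') S S'' := by
  refine Leads.trans
    (Leads.lift (l := Sum.inl) (g := Prod.fst) (p := fun w v => (w, v.2))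
      (e := goto fun _ => .inr G.main) (m₂ := (F.seq G).m) (v := (F.init, G.init))
      (fun _ _ => rfl) (fun _ _ _ => rfl) (fun _ => rfl) (fun _ => rfl) h)
    (Leads.lift (l := Sum.inr) (g := Prod.snd) (p := fun w v => (v.1, w))
      (e := halt) (m₂ := (F.seq G).m) (v := (F.init, G.init))
      (fun _ _ => rfl) (fun _ _ _ => rfl) (fun _ => rfl) (fun _ => rfl) h')

/-- Run the machine as long as the stack `k` is nonempty. -/
def Frag.loop (k : K) (F : Frag Γ) : Frag Γ where
  Λ := Option F.Λ
  σ := F.σ × Bool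
  main := none
  init := (F.init, false)
  m a := match a with
    | none => peek k (fun v s => (v.1, s.isSome))
        (branch Prod.snd (goto fun _ => some F.main) halt)
    | some a => lift some Prod.fst (fun w v => (w, v.2)) (goto fun _ => none) (F.m a)

theorem Frag.loop_leads_test (k : K) (F : Frag Γ) (b : Bool) (S : ∀ k, List (Γ k)) :
    Leads (F.loop k).m 1 ⟨some none, (F.init, b), S⟩
      (if S k = [] then ⟨none, (F.init, false), S⟩ else ⟨some (some F.main), (F.init, true), S⟩)
    := by
  have := Leads.single (F.loop k).m none (F.init, b) S
  convert this using 1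
  simp only [Frag.loop, stepAux]
  cases S k <;> simp

theorem Frag.loop_leads_body {k : K} {F : Frag Γ} {t t' : ℕ} {S S' S'' : ∀ k, List (Γ k)}
    (hk : S k ≠ []) (h : F.Runs t S S')
    (h' : ∀ b, Leads (F.loop k).m t' ⟨some none, (F.init, b), S'⟩ ⟨none, (F.init, false), S''⟩)
    (b : Bool) :
    Leads (F.loop k).m (1 + t + t') ⟨some none, (F.init, b), S⟩ ⟨none, (F.init, false), S''⟩ := by
  have h₁ := F.loop_leads_test k b S
  rw [if_neg hk] at h₁
  have h₂ := Leads.lift (l := some) (g := Prod.fst) (p := fun w v => (w, v.2))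
      (e := goto fun _ => none) (m₂ := (F.loop k).m) (v := (F.init, true))
      (fun _ _ => rfl) (fun _ _ _ => rfl) (fun _ => rfl) (fun _ => rfl) h
  exact (h₁.trans h₂).trans (h' true)

/-- Pop a symbol and push the reverse of a transducer's output. -/
noncomputable def scanStmt (k k' : K) [Finite (Γ k)] (T : Transducer (Γ k) (Γ k')) :
    Stmt Γ Unit (T.Q × Option (Γ k)) :=
  pop k (fun v s => (v.1, s)) <| dispatch fun v => match v.2 with
    | some c => pushList k' (T.emit v.1 c).reverse
        (load (fun _ => (T.next v.1 c, none)) (goto fun _ => ()))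
    | none => pushList k' (T.last v.1).reverse (load (fun _ => (T.start, none)) halt)

theorem stepAux_scanStmt {k k' : K} [Finite (Γ k)] (hk : k ≠ k') (T : Transducer (Γ k) (Γ k'))
    (q : T.Q) (S : ∀ k, List (Γ k)) :
    stepAux (scanStmt k k' T) (q, none) S = match S k with
      | [] => ⟨none, (T.start, none), update (update S k []) k' ((T.last q).reverse ++ S k')⟩
      | c :: w => ⟨some (), (T.next q c, none),
          update (update S k w) k' ((T.emit q c).reverse ++ S k')⟩ := by
  simp only [scanStmt, stepAux, stepAux_dispatch]
  cases S k <;> simp only [List.head?_nil, List.head?_cons, stepAux_pushList, List.tail_nil,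
    List.tail_cons, stepAux, update_of_ne hk.symm]

/-- Empty the stack `k` and push the reverse of a transducer's output to the stack `k'`. -/
noncomputable def scan (k k' : K) [Finite (Γ k)] (T : Transducer (Γ k) (Γ k')) : Frag Γ where
  Λ := Unit
  σ := T.Q × Option (Γ k)
  main := ()
  init := (T.start, none)
  m _ := scanStmt k k' T

theorem scan_runs {k k' : K} [Finite (Γ k)] (hk : k ≠ k') (T : Transducer (Γ k) (Γ k'))
    (S : ∀ k, List (Γ k)) :
    (scan k k' T).Runs ((S k).length + 1) S
      (update (update S k []) k' ((T.out (S k)).reverse ++ S k')) := by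
  -- The induction needs an arbitrary state of the transducer, since the state changes with every
  -- symbol read.
  suffices h : ∀ (w : List (Γ k)) (q : T.Q) (S : ∀ k, List (Γ k)), S k = w →
      Leads (scan k k' T).m (w.length + 1) ⟨some (), (q, none), S⟩
        ⟨none, (T.start, none),
          update (update S k []) k' ((T.outFrom q w).reverse ++ S k')⟩ from h _ _ _ rfl
  intro w
  induction w with
  | nil =>
    intro q S hS
    have h₁ := Leads.single (scan k k' T).m () (q, none) S
    have h₂ := stepAux_scanStmt hk T q S
    rw [hS] at h₂
    change Leads _ _ _ (stepAux (scanStmt k k' T) (q, none) S) at h₁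
    rwa [h₂] at h₁
  | cons c w ih =>
    intro q S hS
    have h₁ := Leads.single (scan k k' T).m () (q, none) S
    have h₂ := stepAux_scanStmt hk T q S
    rw [hS] at h₂
    change Leads _ _ _ (stepAux (scanStmt k k' T) (q, none) S) at h₁
    rw [h₂] at h₁
    have h₃ := h₁.trans (ih (T.next q c)
      (update (update S k w) k' ((T.emit q c).reverse ++ S k')) (by simp [update_of_ne hk]))
    rw [List.length_cons, add_comm]
    refine h₃.congr_stk ?_
    funext j
    by_cases hj : j = k'
    · subst hj; simp [Transducer.outFrom]
    · by_cases hj' : j = k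
      · subst hj'; simp [update_of_ne hj]
      · simp [update_of_ne hj, update_of_ne hj']

/-- Pop a symbol and push its images to the stacks `k₁` and `k₂`. -/
noncomputable def forkStmt (k k₁ k₂ : K) [Finite (Γ k)] (g₁ : Γ k → Γ k₁) (g₂ : Γ k → Γ k₂) :
    Stmt Γ Unit (Option (Γ k)) :=
  pop k (fun _ s => s) <| dispatch fun v => match v with
    | some c => push k₁ (fun _ => g₁ c) (push k₂ (fun _ => g₂ c)
        (load (fun _ => none) (goto fun _ => ())))
    | none => halt

theorem stepAux_forkStmt {k k₁ k₂ : K} [Finite (Γ k)] (h₁ : k ≠ k₁) (h₂ : k ≠ k₂)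
    (h₁₂ : k₁ ≠ k₂) (g₁ : Γ k → Γ k₁) (g₂ : Γ k → Γ k₂) (S : ∀ k, List (Γ k)) :
    stepAux (forkStmt k k₁ k₂ g₁ g₂) none S = match S k with
      | [] => ⟨none, none, update S k []⟩
      | c :: w => ⟨some (), none,
          update (update (update S k w) k₁ (g₁ c :: S k₁)) k₂ (g₂ c :: S k₂)⟩ := by
  simp only [forkStmt, stepAux, stepAux_dispatch]
  cases S k <;> simp only [List.head?_nil, List.head?_cons, List.tail_nil,
    List.tail_cons, stepAux, update_of_ne h₁.symm, update_of_ne h₁₂.symm, update_of_ne h₂.symm]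

/-- Empty the stack `k` and push the reverse of its contents, mapped, to `k₁` and `k₂`. -/
noncomputable def fork (k k₁ k₂ : K) [Finite (Γ k)] (g₁ : Γ k → Γ k₁) (g₂ : Γ k → Γ k₂) :
    Frag Γ where
  Λ := Unit
  σ := Option (Γ k)
  main := ()
  init := none
  m _ := forkStmt k k₁ k₂ g₁ g₂

theorem fork_runs {k k₁ k₂ : K} [Finite (Γ k)] (h₁ : k ≠ k₁) (h₂ : k ≠ k₂) (h₁₂ : k₁ ≠ k₂)
    (g₁ : Γ k → Γ k₁) (g₂ : Γ k → Γ k₂) (S : ∀ k, List (Γ k)) :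
    (fork k k₁ k₂ g₁ g₂).Runs ((S k).length + 1) S
      (update (update (update S k []) k₁ (((S k).map g₁).reverse ++ S k₁)) k₂
        (((S k).map g₂).reverse ++ S k₂)) := by
  suffices h : ∀ (w : List (Γ k)) (S : ∀ k, List (Γ k)), S k = w →
      Leads (fork k k₁ k₂ g₁ g₂).m (w.length + 1) ⟨some (), none, S⟩
        ⟨none, none, update (update (update S k []) k₁ ((w.map g₁).reverse ++ S k₁)) k₂
          ((w.map g₂).reverse ++ S k₂)⟩ from h _ _ rfl
  intro w
  induction w with
  | nil =>
    intro S hS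
    have e₁ := Leads.single (fork k k₁ k₂ g₁ g₂).m () none S
    have e₂ := stepAux_forkStmt h₁ h₂ h₁₂ g₁ g₂ S
    rw [hS] at e₂
    change Leads _ _ _ (stepAux (forkStmt k k₁ k₂ g₁ g₂) none S) at e₁
    rw [e₂] at e₁
    refine e₁.congr_stk ?_
    funext j
    by_cases hj : j = k₂
    · subst hj; simp [update_of_ne h₂.symm]
    · by_cases hj' : j = k₁
      · subst hj'; simp [update_of_ne hj, update_of_ne h₁.symm]
      · simp [update_of_ne hj, update_of_ne hj']
  | cons c w ih =>
    intro S hS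
    have e₁ := Leads.single (fork k k₁ k₂ g₁ g₂).m () none S
    have e₂ := stepAux_forkStmt h₁ h₂ h₁₂ g₁ g₂ S
    rw [hS] at e₂
    change Leads _ _ _ (stepAux (forkStmt k k₁ k₂ g₁ g₂) none S) at e₁
    rw [e₂] at e₁
    have e₃ := e₁.trans
      (ih (update (update (update S k w) k₁ (g₁ c :: S k₁)) k₂ (g₂ c :: S k₂))
        (by simp [update_of_ne h₁, update_of_ne h₂]))
    rw [List.length_cons, add_comm]
    refine e₃.congr_stk ?_
    funext j
    by_cases hj : j = k₂
    · subst hj; simp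
    · by_cases hj' : j = k₁
      · subst hj'; simp [update_of_ne hj]
      · by_cases hj'' : j = k
        · subst hj''; simp [update_of_ne hj, update_of_ne hj']
        · simp [update_of_ne hj, update_of_ne hj', update_of_ne hj'']

/-- Pop one symbol. -/
def popFrag (k : K) : Frag Γ where
  Λ := Unit
  σ := Unit
  main := ()
  init := ()
  m _ := pop k (fun v _ => v) halt

theorem popFrag_runs (k : K) (S : ∀ k, List (Γ k)) :
    (popFrag k).Runs 1 S (update S k (S k).tail) :=
  Leads.single (popFrag k).m () () S

end Frag

end Machine

end RationalProof

namespace RationalProof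

namespace Machine

open Turing TM2 TM2.Stmt Function

theorem initList_stk (tm : FinTM2) (w : List (tm.Γ tm.k₀)) :
    (initList tm w).stk = update (fun _ => []) tm.k₀ w := by
  funext k
  by_cases h : k = tm.k₀
  · subst h; simp [initList]
  · simp [initList, h]

theorem haltList_stk (tm : FinTM2) (w : List (tm.Γ tm.k₁)) :
    (haltList tm w).stk = update (fun _ => []) tm.k₁ w := by
  funext k
  by_cases h : k = tm.k₁
  · subst h; simp [haltList]
  · simp [haltList, h]

theorem leads_of_outputs {tm : FinTM2} {w : List (tm.Γ tm.k₀)} {w' : List (tm.Γ tm.k₁)} {t : ℕ}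
    (h : TM2OutputsInTime tm w (some w') t) :
    Leads tm.m t ⟨some tm.main, tm.initialState, update (fun _ => []) tm.k₀ w⟩
      ⟨none, tm.initialState, update (fun _ => []) tm.k₁ w'⟩ := by
  refine ⟨h.steps, h.steps_le_m, ?_⟩
  rw [← initList_stk, ← haltList_stk]
  exact h.evals_in_steps

theorem outputs_of_leads {tm : FinTM2} {w : List (tm.Γ tm.k₀)} {w' : List (tm.Γ tm.k₁)} {t : ℕ}
    (h : Leads tm.m t ⟨some tm.main, tm.initialState, update (fun _ => []) tm.k₀ w⟩
      ⟨none, tm.initialState, update (fun _ => []) tm.k₁ w'⟩) :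
    Nonempty (TM2OutputsInTime tm w (some w') t) := by
  obtain ⟨n, hn, h⟩ := h
  rw [← initList_stk, ← haltList_stk] at h
  exact ⟨⟨⟨n, h⟩, hn⟩⟩

/-! ### Output length is bounded by running time -/

section OutputLength

variable {K : Type} [DecidableEq K] {Γ : K → Type} {Λ σ : Type}

theorem exists_length_stepAux_le (q : Stmt Γ Λ σ) :
    ∃ c, ∀ (v : σ) (S : ∀ k, List (Γ k)) (k : K),
      ((stepAux q v S).stk k).length ≤ (S k).length + c := by
  induction q with
  | push j f q ih =>
    obtain ⟨c, hc⟩ := ih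
    refine ⟨c + 1, fun v S k => (hc v _ k).trans ?_⟩
    by_cases h : k = j
    · subst h; simp; omega
    · simp [update_of_ne h]
  | peek j f q ih =>
    obtain ⟨c, hc⟩ := ih
    exact ⟨c, fun v S k => hc _ _ k⟩
  | pop j f q ih =>
    obtain ⟨c, hc⟩ := ih
    refine ⟨c, fun v S k => (hc _ _ k).trans ?_⟩
    by_cases h : k = j
    · subst h; simp
    · simp [update_of_ne h]
  | load f q ih =>
    obtain ⟨c, hc⟩ := ih
    exact ⟨c, fun v S k => hc _ _ k⟩
  | branch f q₁ q₂ ih₁ ih₂ =>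
    obtain ⟨c₁, h₁⟩ := ih₁
    obtain ⟨c₂, h₂⟩ := ih₂
    refine ⟨c₁ + c₂, fun v S k => ?_⟩
    simp only [stepAux]
    cases f v
    · exact (h₂ _ _ k).trans (by omega)
    · exact (h₁ _ _ k).trans (by omega)
  | goto f => exact ⟨0, fun v S k => le_rfl⟩
  | halt => exact ⟨0, fun v S k => le_rfl⟩

/-- Each of the finitely many labels has a statement that pushes a bounded number of symbols; the
maximum of these bounds serves for every step. -/
theorem exists_length_le_of_leads [Finite Λ] (m : Λ → Stmt Γ Λ σ) :
    ∃ c, ∀ (t : ℕ) (a b : Cfg Γ Λ σ), Leads m t a b →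
      ∀ k, (b.stk k).length ≤ (a.stk k).length + c * t := by
  choose c hc using fun l => exists_length_stepAux_le (m l)
  obtain ⟨C, hC⟩ := (Set.finite_range c).bddAbove
  refine ⟨C, ?_⟩
  rintro t a b ⟨n, hn, h⟩ k
  refine le_trans ?_ (Nat.add_le_add_left (Nat.mul_le_mul_left C hn) _)
  clear hn
  induction n generalizing a with
  | zero => cases h; simp
  | succ n ih =>
    rw [iterate_succ_apply] at h
    rcases a with ⟨_ | l, v, S⟩
    · change (flip bind (step m))^[n] none = _ at h
      rw [iterate_none] at h
      cases h
    · have h₁ := ih (stepAux (m l) v S) h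
      have h₂ := hc l v S k
      have h₃ : c l ≤ C := hC ⟨l, rfl⟩
      simp only at h₁ h₂ ⊢
      linarith

end OutputLength

/-! ### Register programs that call given machines -/

section Registers

variable {R ι : Type} [DecidableEq R] [DecidableEq ι] (G : R → Type) (M : ι → FinTM2)

/-- Every register has a main and an auxiliary stack; the other stacks are those of the machines
that may be called. -/
abbrev Idx (R : Type) {ι : Type} (M : ι → FinTM2) : Type := (R × Bool) ⊕ (Σ i, (M i).K)

/-- The alphabets of the stacks. -/
@[reducible]
def Alph : Idx R M → Type
  | .inl p => G p.1
  | .inr p => (M p.1).Γ p.2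

variable {G M}

/-- Stack contents. -/
def stk (ρ τ : ∀ r, List (G r)) (ω : ∀ i k, List ((M i).Γ k)) : ∀ k, List (Alph G M k)
  | .inl (r, true) => ρ r
  | .inl (r, false) => τ r
  | .inr ⟨i, k⟩ => ω i k

theorem update_stk_main (ρ τ : ∀ r, List (G r)) (ω : ∀ i k, List ((M i).Γ k)) (r : R)
    (w : List (G r)) :
    update (stk ρ τ ω) (.inl (r, true)) w = stk (update ρ r w) τ ω := by
  funext k
  rcases k with ⟨s, _ | _⟩ | ⟨i, k⟩
  · rw [update_of_ne (by simp)]; rfl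
  · by_cases h : s = r
    · subst h; simp [stk]
    · rw [update_of_ne (by simpa using h)]; simp [stk, update_of_ne h]
  · rw [update_of_ne (by simp)]; rfl

theorem update_stk_aux (ρ τ : ∀ r, List (G r)) (ω : ∀ i k, List ((M i).Γ k)) (r : R)
    (w : List (G r)) :
    update (stk ρ τ ω) (.inl (r, false)) w = stk ρ (update τ r w) ω := by
  funext k
  rcases k with ⟨s, _ | _⟩ | ⟨i, k⟩
  · by_cases h : s = r
    · subst h; simp [stk]
    · rw [update_of_ne (by simpa using h)]; simp [stk, update_of_ne h]
  · rw [update_of_ne (by simp)]; rfl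
  · rw [update_of_ne (by simp)]; rfl

theorem update_stk_machine (ρ τ : ∀ r, List (G r)) (ω : ∀ i k, List ((M i).Γ k)) (i : ι)
    (k : (M i).K) (w : List ((M i).Γ k)) :
    update (stk ρ τ ω) (.inr ⟨i, k⟩) w = stk ρ τ (update ω i (update (ω i) k w)) := by
  funext j
  rcases j with ⟨s, _ | _⟩ | ⟨i', k'⟩
  · rw [update_of_ne (by simp)]; rfl
  · rw [update_of_ne (by simp)]; rfl
  · by_cases hi : i' = i
    · subst hi
      by_cases hk : k' = k
      · subst hk; simp [stk]
      · rw [update_of_ne (by simpa using hk)]; simp [stk, update_of_ne hk]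
    · rw [update_of_ne (by intro h; cases h; exact hi rfl)]; simp [stk, update_of_ne hi]

theorem update_empty {I : Type} [DecidableEq I] {E : I → Type} (i : I) :
    update (fun j => ([] : List (E j))) i [] = fun _ => [] := by
  simp

/-- The program leads from the register contents `ρ` to `ρ'`; all other stacks are empty. -/
def RegRuns (F : Frag (Alph G M)) (t : ℕ) (ρ ρ' : ∀ r, List (G r)) : Prop :=
  F.Runs t (stk ρ (fun _ => []) (fun _ _ => [])) (stk ρ' (fun _ => []) (fun _ _ => []))

theorem RegRuns.seq {F F' : Frag (Alph G M)} {t t' : ℕ} {ρ ρ' ρ'' : ∀ r, List (G r)}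
    (h : RegRuns F t ρ ρ') (h' : RegRuns F' t' ρ' ρ'') : RegRuns (F.seq F') (t + t') ρ ρ'' :=
  Frag.Runs.seq h h'

theorem RegRuns.mono {F : Frag (Alph G M)} {t t' : ℕ} {ρ ρ' : ∀ r, List (G r)}
    (h : RegRuns F t ρ ρ') (ht : t ≤ t') : RegRuns F t' ρ ρ' := Leads.mono h ht

theorem RegRuns.congr {F : Frag (Alph G M)} {t : ℕ} {ρ ρ' ρ'' : ∀ r, List (G r)}
    (h : RegRuns F t ρ ρ') (hr : ρ'' = ρ') : RegRuns F t ρ ρ'' := hr ▸ h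

/-- As long as register `a` is nonempty, pop a symbol from it and do `F`. -/
noncomputable def loopReg (a : R) (F : Frag (Alph G M)) : Frag (Alph G M) :=
  ((popFrag (Γ := Alph G M) (.inl (a, true))).seq F).loop (.inl (a, true))

/-- The contents `P n` are indexed by the number of passes still to come, which is the current
length of register `a`. The body must restore the lengths only of `a` after its pop; the `+ 2` pays
for the test and the pop. -/
theorem loopReg_runs {a : R} {F : Frag (Alph G M)} {t : ℕ} (P : ℕ → (∀ r, List (G r)))
    (n : ℕ) (hP : ∀ i ≤ n, (P i a).length = i)
    (hF : ∀ i < n, RegRuns F t (update (P (i + 1)) a (P (i + 1) a).tail) (P i)) :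
    RegRuns (loopReg a F) ((t + 2) * n + 1) (P n) (P 0) := by
  suffices h : ∀ b, Leads (loopReg a F).m ((t + 2) * n + 1)
      ⟨some none, (((), F.init), b), stk (P n) (fun _ => []) (fun _ _ => [])⟩
      ⟨none, (((), F.init), false), stk (P 0) (fun _ => []) (fun _ _ => [])⟩ from h false
  induction n with
  | zero =>
    intro b
    have h := Frag.loop_leads_test (.inl (a, true))
      ((popFrag (Γ := Alph G M) (.inl (a, true))).seq F) b (stk (P 0) (fun _ => []) (fun _ _ => []))
    rw [if_pos (show stk (P 0) _ _ (.inl (a, true)) = [] from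
      List.eq_nil_of_length_eq_zero (hP 0 le_rfl))] at h
    exact Leads.mono h (by omega)
  | succ n ih =>
    intro b
    replace ih := ih (fun i hi => hP i (by omega)) (fun i hi => hF i (by omega))
    have h := popFrag_runs (Γ := Alph G M) (.inl (a, true))
      (stk (P (n + 1)) (fun _ => []) (fun _ _ => []))
    rw [update_stk_main] at h
    have hne : stk (M := M) (P (n + 1)) (fun _ => []) (fun _ _ => []) (.inl (a, true)) ≠ [] := by
      intro h
      have h₁ := hP (n + 1) le_rfl
      have h₂ : P (n + 1) a = [] := h
      rw [h₂] at h₁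
      simp at h₁
    have h₃ := Frag.loop_leads_body (k := .inl (a, true))
      (F := (popFrag (Γ := Alph G M) (.inl (a, true))).seq F) (t' := (t + 2) * n + 1) hne
      (Frag.Runs.seq h (hF n (by omega))) (S'' := stk (P 0) (fun _ => []) (fun _ _ => [])) (fun b => ih b) b
    exact Leads.mono h₃ (by ring_nf; omega)

variable [∀ r, Finite (G r)]

/-- Apply a transducer to the register `a` and prepend the result to the register `b`. -/
noncomputable def transduce (M : ι → FinTM2) (a b : R) (T : Transducer (G a) (G b)) :
    Frag (Alph G M) :=
  (scan (Γ := Alph G M) (.inl (a, true)) (.inl (b, false)) T).seq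
    (scan (Γ := Alph G M) (.inl (b, false)) (.inl (b, true)) (Transducer.mapping id))

/-- A scan reverses what it moves, so a second scan through the auxiliary stack restores the order.
-/
theorem transduce_runs (a b : R) (T : Transducer (G a) (G b)) (ρ : ∀ r, List (G r)) :
    RegRuns (transduce M a b T) ((ρ a).length + (T.out (ρ a)).length + 2) ρ
      (update (update ρ a []) b (T.out (ρ a) ++ update ρ a [] b)) := by
  have h₁ := scan_runs (Γ := Alph G M) (k := .inl (a, true)) (k' := .inl (b, false)) (by simp) T
    (stk ρ (fun _ => []) (fun _ _ => []))
  rw [update_stk_main, update_stk_aux] at h₁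
  have h₂ := scan_runs (Γ := Alph G M) (k := .inl (b, false)) (k' := .inl (b, true)) (by simp)
    (Transducer.mapping id)
    (stk (update ρ a []) (update (fun _ => []) b ((T.out (ρ a)).reverse ++ [])) (fun _ _ => []))
  rw [update_stk_aux, update_idem, update_empty, update_stk_main] at h₂
  have h₃ := Frag.Runs.seq h₁ h₂
  refine (Leads.mono h₃ ?_).congr_stk ?_
  · simp [stk]; omega
  · congr 2
    simp [stk]

/-- Copy the register `a`, mapped, to the front of the register `b`. -/
noncomputable def copy (M : ι → FinTM2) (a b : R) (g : G a → G b) : Frag (Alph G M) :=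
  (scan (Γ := Alph G M) (.inl (a, true)) (.inl (a, false)) (Transducer.mapping id)).seq
    (fork (Γ := Alph G M) (.inl (a, false)) (.inl (a, true)) (.inl (b, true)) id g)

theorem copy_runs {a b : R} (hab : a ≠ b) (g : G a → G b) (ρ : ∀ r, List (G r)) :
    RegRuns (copy M a b g) (2 * (ρ a).length + 2) ρ (update ρ b ((ρ a).map g ++ ρ b)) := by
  have h₁ := scan_runs (Γ := Alph G M) (k := .inl (a, true)) (k' := .inl (a, false)) (by simp)
    (Transducer.mapping id) (stk ρ (fun _ => []) (fun _ _ => []))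
  rw [update_stk_main, update_stk_aux] at h₁
  have h₂ := fork_runs (Γ := Alph G M) (k := .inl (a, false)) (k₁ := .inl (a, true))
    (k₂ := .inl (b, true)) (by simp) (by simp) (by simpa using hab) id g
    (stk (update ρ a []) (update (fun _ => []) a (((Transducer.mapping id).out (ρ a)).reverse ++ []))
      (fun _ _ => []))
  rw [update_stk_aux, update_idem, update_empty, update_stk_main, update_stk_main,
    update_idem] at h₂
  have h₃ := Frag.Runs.seq h₁ h₂
  refine (Leads.mono h₃ ?_).congr_stk ?_
  · simp [stk]; omega
  · congr 1
    simp only [stk, update_self, Transducer.out_mapping, List.map_id, List.append_nil,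
      List.map_reverse, List.reverse_reverse, update_of_ne hab.symm]
    congr 1
    simp

/-- Apply the machine `M i` to the register `a` and prepend its output to the register `b`. -/
noncomputable def call (i : ι) [Finite ((M i).Γ (M i).k₁)] (a b : R)
    (g : G a → (M i).Γ (M i).k₀) (g' : (M i).Γ (M i).k₁ → G b) : Frag (Alph G M) :=
  have : Finite (Alph G M (.inr ⟨i, (M i).k₁⟩)) := inferInstanceAs (Finite ((M i).Γ (M i).k₁))
  have := (M i).ΛFin
  have := (M i).σFin
  (((scan (Γ := Alph G M) (.inl (a, true)) (.inl (a, false)) (Transducer.mapping id)).seq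
    (scan (Γ := Alph G M) (.inl (a, false)) (.inr ⟨i, (M i).k₀⟩) (Transducer.mapping g))).seq
    ⟨(M i).Λ, (M i).σ, (M i).main, (M i).initialState, fun l =>
      embed (Γ := Alph G M) (fun k => .inr ⟨i, k⟩) ((M i).m l)⟩).seq
    ((scan (Γ := Alph G M) (.inr ⟨i, (M i).k₁⟩) (.inl (b, false)) (Transducer.mapping g')).seq
    (scan (Γ := Alph G M) (.inl (b, false)) (.inl (b, true)) (Transducer.mapping id)))

/-- Input and output each pass through an auxiliary stack and are reversed twice. A machine that has
halted has everything but its output stack empty, so once the output is fetched its stacks are ready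
for the next call. -/
theorem call_runs {i : ι} [Finite ((M i).Γ (M i).k₁)] {a b : R}
    {g : G a → (M i).Γ (M i).k₀} {g' : (M i).Γ (M i).k₁ → G b} {ρ : ∀ r, List (G r)} {t : ℕ}
    {w : List ((M i).Γ (M i).k₁)}
    (h : TM2OutputsInTime (M i) ((ρ a).map g) (some w) t) :
    RegRuns (call i a b g g') (2 * (ρ a).length + 2 * w.length + t + 4) ρ
      (update (update ρ a []) b (w.map g' ++ update ρ a [] b)) := by
  have : Finite (Alph G M (.inr ⟨i, (M i).k₁⟩)) := inferInstanceAs (Finite ((M i).Γ (M i).k₁))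
  have := (M i).ΛFin
  have := (M i).σFin
  have h₁ := scan_runs (Γ := Alph G M) (k := .inl (a, true)) (k' := .inl (a, false)) (by simp)
    (Transducer.mapping id) (stk ρ (fun _ => []) (fun _ _ => []))
  rw [update_stk_main, update_stk_aux] at h₁
  have h₂ := scan_runs (Γ := Alph G M) (k := .inl (a, false)) (k' := .inr ⟨i, (M i).k₀⟩) (by simp)
    (Transducer.mapping g) (stk (update ρ a [])
      (update (fun _ => []) a (((Transducer.mapping id).out (ρ a)).reverse ++ []))
      (fun _ _ => []))
  rw [update_stk_aux, update_idem, update_empty, update_stk_machine] at h₂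
  have h₃ : Leads (fun l => embed (Γ := Alph G M) (fun k => .inr ⟨i, k⟩) ((M i).m l)) t
      ⟨some (M i).main, (M i).initialState, stk (update ρ a []) (fun _ => [])
        (update (fun _ _ => []) i (update (fun _ => []) (M i).k₀ ((ρ a).map g)))⟩
      ⟨none, (M i).initialState, stk (update ρ a []) (fun _ => [])
        (update (fun _ _ => []) i (update (fun _ => []) (M i).k₁ w))⟩ := by
    refine Leads.embed (Γ := Alph G M) (i := fun k => .inr ⟨i, k⟩)
      (fun k k' hk => by simpa using hk) ?_ ?_
    · simp only [stk, update_self]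
      exact leads_of_outputs h
    · rintro (⟨s, _ | _⟩ | ⟨i', k⟩) hk
      · rfl
      · rfl
      · simp only [stk]
        have : i' ≠ i := by
          rintro rfl
          exact hk ⟨k, rfl⟩
        rw [update_of_ne this, update_of_ne this]
  have h₄ := scan_runs (Γ := Alph G M) (k := .inr ⟨i, (M i).k₁⟩) (k' := .inl (b, false)) (by simp)
    (Transducer.mapping g') (stk (update ρ a []) (fun _ => [])
        (update (fun _ _ => []) i (update (fun _ => []) (M i).k₁ w)))
  rw [update_stk_machine, update_stk_aux, update_idem, update_self, update_idem, update_empty,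
    update_eq_self_iff.2 rfl] at h₄
  have h₅ := scan_runs (Γ := Alph G M) (k := .inl (b, false)) (k' := .inl (b, true)) (by simp)
    (Transducer.mapping id) (stk (update ρ a [])
      (update (fun _ => []) b ((w.map g').reverse ++ [])) (fun _ _ => []))
  rw [update_stk_aux, update_idem, update_empty, update_stk_main] at h₅
  have e₂ : ((Transducer.mapping g).out (stk (M := M) (update ρ a [])
      (update (fun _ => []) a (((Transducer.mapping id).out (ρ a)).reverse ++ []))
      (fun _ _ => []) (.inl (a, false)))).reverse ++ [] = (ρ a).map g := by
    simp [stk]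
  have e₄ : ((Transducer.mapping g').out (stk (update ρ a []) (fun _ => [])
        (update (fun _ _ => []) i (update (fun _ => []) (M i).k₁ w))
        (.inr ⟨i, (M i).k₁⟩))).reverse = (w.map g').reverse := by
    simp [stk]
  have h₂' := h₂.congr_stk (S' := stk (update ρ a []) (fun _ => [])
        (update (fun _ _ => []) i (update (fun _ => []) (M i).k₀ ((ρ a).map g)))) (by
    rw [← e₂]; rfl)
  have h₄' := h₄.congr_stk (S' := stk (update ρ a [])
      (update (fun _ => []) b ((w.map g').reverse ++ [])) (fun _ _ => [])) (by
    rw [← e₄]; rfl)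
  have h₆ := Frag.Runs.seq (Frag.Runs.seq (Frag.Runs.seq h₁ h₂')
    (G := ⟨(M i).Λ, (M i).σ, (M i).main, (M i).initialState, fun l =>
      embed (Γ := Alph G M) (fun k => .inr ⟨i, k⟩) ((M i).m l)⟩) h₃) (Frag.Runs.seq h₄' h₅)
  refine (Leads.mono h₆ ?_).congr_stk ?_
  · simp [stk]; omega
  · congr 2
    simp [stk]

/-- This is the way back from register programs to Turing machines: the main stacks of `a` and `b`
become the input and output stacks. -/
theorem polyTime_of_regRuns [Finite R] [Finite ι] {X Y : Type} {a b : R} {cX : X → List (G a)}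
    {cY : Y → List (G b)} {f : X → Y} (F : Frag (Alph G M)) (p : Polynomial ℕ)
    (h : ∀ x, RegRuns F (p.eval (cX x).length) (update (fun _ => []) a (cX x))
      (update (fun _ => []) b (cY (f x)))) : PolyTime cX cY f := by
  have := Fintype.ofFinite R
  have := Fintype.ofFinite ι
  have := fun i => (M i).kFin
  have := Fintype.ofFinite F.Λ
  have := Fintype.ofFinite F.σ
  have : Fintype (Alph G M (.inl (a, true))) := Fintype.ofFinite _
  let tm : FinTM2 :=
    { K := Idx R M
      k₀ := .inl (a, true)
      k₁ := .inl (b, true)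
      Γ := Alph G M
      Λ := F.Λ
      main := F.main
      σ := F.σ
      initialState := F.init
      m := F.m }
  have key : ∀ x, Nonempty (TM2OutputsInTime tm (cX x) (some (cY (f x)))
      (p.eval (cX x).length)) := by
    intro x
    apply outputs_of_leads
    have h₁ := h x
    have e : ∀ r (w : List (G r)), update (fun k => ([] : List (Alph G M k))) (.inl (r, true)) w =
        stk (update (fun _ => []) r w) (fun _ => []) (fun _ _ => []) := by
      intro r w
      rw [← update_stk_main]
      congr 1
      funext k
      rcases k with ⟨s, _ | _⟩ | ⟨i', k⟩ <;> rfl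
    change Leads F.m _ ⟨some F.main, F.init, update (fun k => ([] : List (Alph G M k))) _ _⟩
      ⟨none, F.init, update (fun k => ([] : List (Alph G M k))) _ _⟩
    rw [e, e]
    exact h₁
  refine ⟨⟨⟨tm, Equiv.refl _, Equiv.refl _⟩, p, fun x => ?_⟩⟩
  have := (key x).some
  convert this using 1
  · exact List.map_id _
  · exact congrArg some (List.map_id _)

end Registers

end Machine

end RationalProof

namespace RationalProof

theorem eval_mono (p : Polynomial ℕ) : Monotone fun n => p.eval n := by
  intro a b h
  induction p using Polynomial.induction_on' with
  | add p q hp hq => simpa using add_le_add hp hq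
  | monomial n c =>
    simp only [Polynomial.eval_monomial]
    gcongr

namespace Machine

open Turing TM2 TM2.Stmt Function

/-- The machine computes `f` in time `t`, up to the letters' names. -/
def Performs (tm : FinTM2) {X Y A B : Type} (g : A → tm.Γ tm.k₀) (g' : tm.Γ tm.k₁ → B)
    (t : Polynomial ℕ) (cX : X → List A) (cY : Y → List B) (f : X → Y) : Prop :=
  ∀ x, ∃ w, w.map g' = cY (f x) ∧
    Nonempty (TM2OutputsInTime tm ((cX x).map g) (some w) (t.eval (cX x).length))

/-- Finiteness of the output alphabet is recorded because `call` has to scan the output stack of the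
machine. -/
theorem exists_performs {X Y A B : Type} [Finite B] {cX : X → List A} {cY : Y → List B}
    {f : X → Y} (h : PolyTime cX cY f) : ∃ (tm : FinTM2) (g : A → tm.Γ tm.k₀)
      (g' : tm.Γ tm.k₁ → B) (t : Polynomial ℕ), Finite (tm.Γ tm.k₁) ∧ Performs tm g g' t cX cY f := by
  obtain ⟨⟨⟨tm, e, e'⟩, t, h⟩⟩ := h
  exact ⟨tm, e.symm, e', t, Finite.of_equiv _ e'.symm,
    fun x => ⟨_, by simp [Function.comp_def], ⟨h x⟩⟩⟩

theorem exists_length_le {X Y A B : Type} {cX : X → List A} {cY : Y → List B}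
    {f : X → Y} (h : PolyTime cX cY f) :
    ∃ p : Polynomial ℕ, ∀ x, (cY (f x)).length ≤ p.eval (cX x).length := by
  obtain ⟨⟨⟨tm, e, e'⟩, t, h⟩⟩ := h
  have := tm.ΛFin
  obtain ⟨c, hc⟩ := exists_length_le_of_leads tm.m
  refine ⟨.X + .C c * t, fun x => ?_⟩
  have h₁ := hc _ _ _ (leads_of_outputs (h x)) tm.k₁
  simp only [update_self, List.length_map] at h₁
  refine h₁.trans ?_
  simp only [Polynomial.eval_add, Polynomial.eval_X, Polynomial.eval_mul, Polynomial.eval_C]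
  gcongr
  -- The output stack may be the input stack and then starts nonempty; this is what the summand `.X`
  -- pays for.
  by_cases hk : tm.k₁ = tm.k₀
  · have : ∀ k (w : List (tm.Γ tm.k₀)),
        (update (fun k => ([] : List (tm.Γ k))) tm.k₀ w k).length ≤ w.length := by
      intro k w
      by_cases hk : k = tm.k₀
      · subst hk; simp
      · simp [update_of_ne hk]
    exact (this _ _).trans (by simp)
  · simp [update_of_ne hk]

/-! ### Composition, pairing and bounded iteration -/

section Comp

inductive Three | a | b | c
  deriving DecidableEq

instance : Finite Three := Finite.of_surjective (fun i : Fin 3 => match i with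
  | 0 => Three.a | 1 => .b | 2 => .c) (by rintro (_ | _ | _); exacts [⟨0, rfl⟩, ⟨1, rfl⟩, ⟨2, rfl⟩])

/-- The alphabets of three registers. -/
@[reducible]
def Three.alph (A B C : Type) : Three → Type
  | .a => A
  | .b => B
  | .c => C

instance {A B C : Type} [Finite A] [Finite B] [Finite C] : ∀ r, Finite (Three.alph A B C r)
  | .a => ‹Finite A›
  | .b => ‹Finite B›
  | .c => ‹Finite C›

variable {X Y Z A B C : Type} [Finite A] [Finite B] [Finite C] {cX : X → List A} {cY : Y → List B}
  {cZ : Z → List C}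

theorem polyTime_comp_aux {f : X → Y} {h : Y → Z} (M : Bool → FinTM2)
    [Finite ((M true).Γ (M true).k₁)] [Finite ((M false).Γ (M false).k₁)]
    {g : A → (M true).Γ (M true).k₀} {g' : (M true).Γ (M true).k₁ → B}
    {u : B → (M false).Γ (M false).k₀} {u' : (M false).Γ (M false).k₁ → C}
    {t t' p p' : Polynomial ℕ} (hf : Performs (M true) g g' t cX cY f)
    (hh : Performs (M false) u u' t' cY cZ h)
    (hp : ∀ x, (cY (f x)).length ≤ p.eval (cX x).length)
    (hp' : ∀ y, (cZ (h y)).length ≤ p'.eval (cY y).length) : PolyTime cX cZ (h ∘ f) := by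
  refine polyTime_of_regRuns (G := Three.alph A B C) (M := M) (a := .a) (b := .c)
    ((call true .a .b g g').seq (call false .b .c u u'))
    -- The second call runs on an input of length at most `p`, hence the composition with `p`;
    -- monotonicity of polynomials with natural coefficients does the rest.
    ((2 * .X + 2 * p + t + 4) + (2 * .X + 2 * p' + t' + 4).comp p) fun x => ?_
  obtain ⟨w, hw, ⟨h₁⟩⟩ := hf x
  obtain ⟨w', hw', ⟨h₂⟩⟩ := hh (f x)
  have e₁ := call_runs (G := Three.alph A B C) (M := M) (i := true) (a := .a) (b := .b) (g := g)
    (g' := g') (ρ := update (fun _ => []) Three.a (cX x)) h₁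
  have e₂ := call_runs (G := Three.alph A B C) (M := M) (i := false) (a := .b) (b := .c) (g := u)
    (g' := u') (ρ := update (fun _ => []) Three.b (cY (f x))) h₂
  have l₁ : w.length = (cY (f x)).length := by rw [← hw, List.length_map]
  have l₂ : w'.length = (cZ (h (f x))).length := by rw [← hw', List.length_map]
  refine ((RegRuns.seq (e₁.congr (ρ'' := update (fun _ => []) Three.b (cY (f x))) ?_) e₂).mono
    ?_).congr ?_
  · funext r
    cases r <;> simp [update, hw]
  · rw [l₁, l₂]
    have h₃ := hp x
    have h₄ := (hp' (f x)).trans (eval_mono p' (hp x))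
    have h₅ := eval_mono t' (hp x)
    simp only [Polynomial.eval_add, Polynomial.eval_mul, Polynomial.eval_X, Polynomial.eval_ofNat,
      Polynomial.eval_comp, update_self] at *
    omega
  · funext r
    cases r <;> simp [update, hw']

/-- The two machines form a family over `Bool`, which gives them disjoint stacks within one program.
-/
theorem polyTime_comp {f : X → Y} {h : Y → Z} (hf : PolyTime cX cY f) (hh : PolyTime cY cZ h) :
    PolyTime cX cZ (h ∘ f) := by
  obtain ⟨p, hp⟩ := exists_length_le hf
  obtain ⟨p', hp'⟩ := exists_length_le hh
  obtain ⟨tm, g, g', t, h₁, hf⟩ := exists_performs hf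
  obtain ⟨tm', u, u', t', h₂, hh⟩ := exists_performs hh
  let M : Bool → FinTM2 := fun b => match b with
    | true => tm
    | false => tm'
  have : Finite ((M true).Γ (M true).k₁) := h₁
  have : Finite ((M false).Γ (M false).k₁) := h₂
  exact polyTime_comp_aux M (g := g) (g' := g') (u := u) (u' := u') hf hh hp hp'

theorem polyTime_transduce {f : X → Y} (T : Transducer A B) (h : ∀ x, cY (f x) = T.out (cX x)) :
    PolyTime cX cY f := by
  obtain ⟨c, hc⟩ := T.length_out_le
  refine polyTime_of_regRuns (G := Three.alph A B A) (M := fun i : Empty => i.elim) (a := .a)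
    (b := .b) (transduce _ .a .b T) (.X + (.C c * .X + .C c) + 2) fun x => ?_
  refine ((transduce_runs (G := Three.alph A B A) (M := fun i : Empty => i.elim) .a .b T
    (update (fun _ => []) Three.a (cX x))).mono ?_).congr ?_
  · have := hc (cX x)
    simp only [Polynomial.eval_add, Polynomial.eval_mul, Polynomial.eval_X, Polynomial.eval_ofNat,
      Polynomial.eval_C, update_self] at *
    omega
  · funext r
    cases r <;> simp [update, h]

end Comp

section Pair

inductive Five | a | a' | b | c | d
  deriving DecidableEq

instance : Finite Five := Finite.of_surjective (fun i : Fin 5 => match i with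
  | 0 => Five.a | 1 => .a' | 2 => .b | 3 => .c | 4 => .d)
  (by rintro (_ | _ | _); exacts [⟨0, rfl⟩, ⟨1, rfl⟩, ⟨2, rfl⟩, ⟨3, rfl⟩, ⟨4, rfl⟩])

/-- The alphabets of five registers. -/
@[reducible]
def Five.alph (A B C : Type) : Five → Type
  | .a => A
  | .a' => A
  | .b => B
  | .c => C
  | .d => B ⊕ C

instance {A B C : Type} [Finite A] [Finite B] [Finite C] : ∀ r, Finite (Five.alph A B C r)
  | .a => ‹Finite A›
  | .a' => ‹Finite A›
  | .b => ‹Finite B›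
  | .c => ‹Finite C›
  | .d => inferInstanceAs (Finite (B ⊕ C))

variable {X Y Z A B C : Type} [Finite A] [Finite B] [Finite C] {cX : X → List A} {cY : Y → List B}
  {cZ : Z → List C}

/-- The code of a pair. -/
def prodCode (cY : Y → List B) (cZ : Z → List C) (p : Y × Z) : List (B ⊕ C) :=
  (cY p.1).map .inl ++ (cZ p.2).map .inr

theorem polyTime_pair_aux {f : X → Y} {h : X → Z} (M : Bool → FinTM2)
    [Finite ((M true).Γ (M true).k₁)] [Finite ((M false).Γ (M false).k₁)]
    {g : A → (M true).Γ (M true).k₀} {g' : (M true).Γ (M true).k₁ → B}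
    {u : A → (M false).Γ (M false).k₀} {u' : (M false).Γ (M false).k₁ → C}
    {t t' p p' : Polynomial ℕ} (hf : Performs (M true) g g' t cX cY f)
    (hh : Performs (M false) u u' t' cX cZ h)
    (hp : ∀ x, (cY (f x)).length ≤ p.eval (cX x).length)
    (hp' : ∀ y, (cZ (h y)).length ≤ p'.eval (cX y).length) :
    PolyTime cX (prodCode cY cZ) (fun x => (f x, h x)) := by
  refine polyTime_of_regRuns (G := Five.alph A B C) (M := M) (a := .a) (b := .d)
    -- The input is copied because a call consumes it. The second component is written first, since
    -- results are prepended to the output register.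
    (((copy M .a .a' id).seq (call true .a .b g g')).seq ((call false .a' .c u u').seq
      ((transduce M .c .d (Transducer.mapping .inr)).seq
        (transduce M .b .d (Transducer.mapping .inl)))))
    (6 * .X + 4 * p + 4 * p' + t + t' + 20) fun x => ?_
  obtain ⟨w, hw, ⟨h₁⟩⟩ := hf x
  obtain ⟨w', hw', ⟨h₂⟩⟩ := hh x
  let ρ₀ : ∀ r, List (Five.alph A B C r) := update (fun _ => []) Five.a (cX x)
  let ρ₁ : ∀ r, List (Five.alph A B C r) := update ρ₀ Five.a' (cX x)
  let ρ₂ : ∀ r, List (Five.alph A B C r) := update (update ρ₁ Five.a []) Five.b (cY (f x))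
  let ρ₃ : ∀ r, List (Five.alph A B C r) := update (update ρ₂ Five.a' []) Five.c (cZ (h x))
  let ρ₄ : ∀ r, List (Five.alph A B C r) :=
    update (update ρ₃ Five.c []) Five.d ((cZ (h x)).map .inr)
  have e₀ := copy_runs (G := Five.alph A B C) (M := M) (a := .a) (b := .a') (by simp) id ρ₀
  have e₁ := call_runs (G := Five.alph A B C) (M := M) (i := true) (a := .a) (b := .b) (g := g)
    (g' := g') (ρ := ρ₁) h₁
  have e₂ := call_runs (G := Five.alph A B C) (M := M) (i := false) (a := .a') (b := .c) (g := u)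
    (g' := u') (ρ := ρ₂) h₂
  have e₃ := transduce_runs (G := Five.alph A B C) (M := M) .c .d (Transducer.mapping .inr) ρ₃
  have e₄ := transduce_runs (G := Five.alph A B C) (M := M) .b .d (Transducer.mapping .inl) ρ₄
  have l₁ : w.length = (cY (f x)).length := by rw [← hw, List.length_map]
  have l₂ : w'.length = (cZ (h x)).length := by rw [← hw', List.length_map]
  refine ((((e₀.congr (ρ'' := ρ₁) ?_).seq (e₁.congr (ρ'' := ρ₂) ?_)).seq
    ((e₂.congr (ρ'' := ρ₃) ?_).seq ((e₃.congr (ρ'' := ρ₄) ?_).seq e₄))).mono ?_).congr ?_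
  · funext r
    cases r <;> simp [update, ρ₁, ρ₀]
  · funext r
    cases r <;> simp [update, ρ₂, ρ₁, ρ₀, hw]
  · funext r
    cases r <;> simp [update, ρ₃, ρ₂, ρ₁, ρ₀, hw']
  · funext r
    cases r <;> simp [update, ρ₄, ρ₃, ρ₂, ρ₁, ρ₀]
  · rw [l₁, l₂]
    have h₃ := hp x
    have h₄ := hp' x
    have r₀ : (ρ₀ .a).length = (cX x).length := by simp [ρ₀]
    have r₁ : (ρ₁ .a).length = (cX x).length := by simp [ρ₁, ρ₀, update]
    have r₂ : (ρ₂ .a').length = (cX x).length := by simp [ρ₂, ρ₁, ρ₀, update]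
    have r₃ : (ρ₃ .c).length = (cZ (h x)).length := by simp [ρ₃]
    have r₄ : (ρ₄ .b).length = (cY (f x)).length := by simp [ρ₄, ρ₃, ρ₂, update]
    simp only [Polynomial.eval_add, Polynomial.eval_mul, Polynomial.eval_X, Polynomial.eval_ofNat,
      Transducer.out_mapping, List.length_map, r₀, r₁, r₂, r₃, r₄] at *
    omega
  · funext r
    cases r <;> simp [update, ρ₄, ρ₃, ρ₂, ρ₁, ρ₀, prodCode]

theorem polyTime_pair {f : X → Y} {h : X → Z} (hf : PolyTime cX cY f) (hh : PolyTime cX cZ h) :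
    PolyTime cX (prodCode cY cZ) (fun x => (f x, h x)) := by
  obtain ⟨p, hp⟩ := exists_length_le hf
  obtain ⟨p', hp'⟩ := exists_length_le hh
  obtain ⟨tm, g, g', t, h₁, hf⟩ := exists_performs hf
  obtain ⟨tm', u, u', t', h₂, hh⟩ := exists_performs hh
  let M : Bool → FinTM2 := fun b => match b with
    | true => tm
    | false => tm'
  have : Finite ((M true).Γ (M true).k₁) := h₁
  have : Finite ((M false).Γ (M false).k₁) := h₂
  exact polyTime_pair_aux M (g := g) (g' := g') (u := u) (u' := u') hf hh hp hp'

end Pair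

section Iterate

variable {X A : Type} [Finite A] {cX : X → List A}

/-- A copy of the input serves as the loop counter: each pass removes one of its symbols and applies
`f` once. The bound `hp` on all intermediate results keeps every pass polynomial. -/
theorem polyTime_iterate_aux {f : X → X} (M : Unit → FinTM2)
    [Finite ((M ()).Γ (M ()).k₁)] {g : A → (M ()).Γ (M ()).k₀} {g' : (M ()).Γ (M ()).k₁ → A}
    {t p : Polynomial ℕ} (hf : Performs (M ()) g g' t cX cX f)
    (hp : ∀ x n, n ≤ (cX x).length → (cX (f^[n] x)).length ≤ p.eval (cX x).length) :
    PolyTime cX cX (fun x => f^[(cX x).length] x) := by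
  refine polyTime_of_regRuns (G := fun _ : Bool => A) (M := M) (a := true) (b := true)
    ((copy M true false id).seq (loopReg false (call () true true g g')))
    ((2 * .X + 2) + ((4 * p + t.comp p + 4 + 2) * .X + 1)) fun x => ?_
  set N := (cX x).length with hN
  -- With `n` passes left, register `true` holds the result of `N - n` passes, and register `false`
  -- the `n` remaining counter symbols.
  let P : ℕ → ∀ _ : Bool, List A := fun n b =>
    if b then cX (f^[N - n] x) else (cX x).drop (N - n)
  have e₀ := copy_runs (G := fun _ : Bool => A) (M := M) (a := true) (b := false) (by simp) id
    (update (fun _ => []) true (cX x))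
  have e₁ := loopReg_runs (G := fun _ : Bool => A) (M := M) (a := false)
    (F := call () true true g g') (t := 4 * p.eval N + t.eval (p.eval N) + 4) P N
    (fun i hi => by simp only [P, Bool.false_eq_true, if_false, List.length_drop]; omega)
    (fun i hi => by
      obtain ⟨w, hw, ⟨h₁⟩⟩ := hf (f^[N - (i + 1)] x)
      have e := call_runs (G := fun _ : Bool => A) (M := M) (i := ()) (a := true) (b := true)
        (g := g) (g' := g') (ρ := update (P (i + 1)) false (P (i + 1) false).tail) h₁
      have hs : N - i = N - (i + 1) + 1 := by omega
      refine (e.mono ?_).congr ?_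
      · have l₁ : w.length = (cX (f^[N - i] x)).length := by
          rw [← List.length_map (f := g'), hw, hs, iterate_succ_apply']
        have l₂ := hp x (N - i) (by omega)
        have l₃ := hp x (N - (i + 1)) (by omega)
        have l₄ := eval_mono t l₃
        have l₅ : (update (P (i + 1)) false (P (i + 1) false).tail true).length =
            (cX (f^[N - (i + 1)] x)).length := by simp [P]
        rw [l₁, l₅]
        rw [← hN] at l₂ l₃ l₄
        simp only at l₄
        omega
      · funext b
        cases b
        · simp [P, update, hs]
        · simp [P, hw, hs, iterate_succ_apply'])
  refine ((e₀.congr (ρ'' := P N) ?_).seq e₁).mono ?_ |>.congr ?_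
  · funext b
    cases b <;> simp [P, update]
  · simp only [Polynomial.eval_add, Polynomial.eval_mul, Polynomial.eval_X, Polynomial.eval_ofNat,
      Polynomial.eval_comp, update_self, Polynomial.eval_one]
    omega
  · funext b
    cases b <;> simp [P, update, hN]

theorem polyTime_iterate {f : X → X} (hf : PolyTime cX cX f) (p : Polynomial ℕ)
    (hp : ∀ x n, n ≤ (cX x).length → (cX (f^[n] x)).length ≤ p.eval (cX x).length) :
    PolyTime cX cX (fun x => f^[(cX x).length] x) := by
  obtain ⟨tm, g, g', t, h₁, hf⟩ := exists_performs hf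
  have : Finite (((fun _ => tm : Unit → FinTM2) ()).Γ ((fun _ => tm : Unit → FinTM2) ()).k₁) := h₁
  exact polyTime_iterate_aux (fun _ => tm) (g := g) (g' := g') hf hp

end Iterate

end Machine

end RationalProof

/-! ### Codings and a calculus of polynomial-time functions -/

namespace RationalProof

open Machine

/-- A way to write the elements of `X` as strings over a finite alphabet. -/
structure Cod (X : Type) where
  A : Type
  [fin : Finite A]
  code : X → List A

attribute [instance] Cod.fin

namespace Cod

variable {X Y : Type}

/-- Strings code themselves. -/
@[reducible]
def str (A : Type) [Finite A] : Cod (List A) := ⟨A, fun s => s⟩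

/-- Elements of a finite type are coded by one symbol. -/
@[reducible]
def letter (A : Type) [Finite A] : Cod A := ⟨A, fun a => [a]⟩

/-- The coding of pairs. -/
@[reducible]
def prod (c : Cod X) (d : Cod Y) : Cod (X × Y) := ⟨c.A ⊕ d.A, prodCode c.code d.code⟩

/-- The code of a list. -/
def listCode {A : Type} (code : X → List A) (l : List X) : List (Option A) :=
  l.flatMap fun s => (code s).map some ++ [none]

/-- The coding of lists. -/
@[reducible]
def list (c : Cod X) : Cod (List X) := ⟨Option c.A, listCode c.code⟩

theorem prod_code (c : Cod X) (d : Cod Y) : (c.prod d).code = prodCode c.code d.code := rfl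

theorem list_code (c : Cod X) : c.list.code = listCode c.code := rfl

section
variable {A B : Type} (c : X → List A) (d : Y → List B)

theorem length_prod (p : X × Y) : (prodCode c d p).length = (c p.1).length + (d p.2).length := by
  simp [prodCode]

theorem list_nil : listCode c [] = [] := rfl

theorem list_cons (x : X) (l : List X) :
    listCode c (x :: l) = (c x).map some ++ none :: listCode c l := by
  simp [listCode, List.flatMap_cons]

theorem list_append (l l' : List X) : listCode c (l ++ l') = listCode c l ++ listCode c l' := by
  simp [listCode, List.flatMap_append]

theorem length_list_cons (x : X) (l : List X) :
    (listCode c (x :: l)).length = (c x).length + 1 + (listCode c l).length := by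
  rw [list_cons]; simp; omega

theorem length_le_list (l : List X) : l.length ≤ (listCode c l).length := by
  induction l with
  | nil => simp
  | cons x l ih => rw [length_list_cons]; simp; omega

theorem length_str_list (l : List (List A)) :
    (listCode (fun s => s) l).length = (l.map List.length).sum + l.length := by
  induction l with
  | nil => rfl
  | cons a l ih => rw [length_list_cons, ih]; simp; omega

end

end Cod

open Cod

/-- `f` is computable in polynomial time with respect to the given codings. -/
def PT {X Y : Type} (c : Cod X) (d : Cod Y) (f : X → Y) : Prop := PolyTime c.code d.code f

namespace PT

variable {X Y Z W E A B : Type} [Finite A] [Finite B] {c : Cod X} {d : Cod Y} {e : Cod Z}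
  {w : Cod W}

theorem comp {g : Y → Z} {f : X → Y} (hg : PT d e g) (hf : PT c d f) :
    PT c e (fun x => g (f x)) := polyTime_comp hf hg

theorem pair {f : X → Y} {g : X → Z} (hf : PT c d f) (hg : PT c e g) :
    PT c (d.prod e) (fun x => (f x, g x)) := polyTime_pair hf hg

theorem of_transducer {f : X → Y} (T : Transducer c.A d.A)
    (h : ∀ x, d.code (f x) = T.out (c.code x)) : PT c d f := polyTime_transduce T h

theorem length_le {f : X → Y} (h : PT c d f) :
    ∃ p : Polynomial ℕ, ∀ x, (d.code (f x)).length ≤ p.eval (c.code x).length :=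
  exists_length_le h

/-- A transducer with one state suffices. Most basic operations on codes are such symbolwise
substitutions. -/
theorem of_flatMap {f : X → Y} (g : c.A → List d.A) (v : List d.A)
    (h : ∀ x, d.code (f x) = (c.code x).flatMap g ++ v) : PT c d f := by
  refine of_transducer ⟨Unit, (), fun _ _ => (), fun _ a => g a, fun _ => v⟩ fun x => ?_
  rw [h]
  rw [Transducer.out]
  generalize c.code x = s
  induction s with
  | nil => rfl
  | cons a s ih =>
    rw [List.flatMap_cons, List.append_assoc, ih]
    rfl

protected theorem id : PT c c (fun x => x) := of_flatMap (fun a => [a]) [] (by simp)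

theorem const (y : Y) : PT c d (fun _ => y) := of_flatMap (fun _ => []) (d.code y) (by simp)

theorem code : PT c (str c.A) c.code := of_flatMap (fun a => [a]) [] (by simp)

theorem fst : PT (c.prod d) c Prod.fst :=
  of_flatMap (Sum.elim (fun a => [a]) fun _ => []) [] fun x => by
    simp [prodCode, List.flatMap_append, List.flatMap_map]

theorem snd : PT (c.prod d) d Prod.snd :=
  of_flatMap (Sum.elim (fun _ => []) fun a => [a]) [] fun x => by
    simp [prodCode, List.flatMap_append, List.flatMap_map]

theorem letter (f : A → Y) : PT (letter A) d f :=
  of_flatMap (fun a => d.code (f a)) [] (by simp)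

theorem letter₂ (f : A × B → Y) : PT ((Cod.letter A).prod (Cod.letter B)) d f :=
  of_transducer (c := (Cod.letter A).prod (Cod.letter B))
    ⟨Option A, none, fun q s => Sum.elim some (fun _ => q) s,
      fun q s => Sum.elim (fun _ => []) (fun b => q.elim [] fun a => d.code (f (a, b))) s,
      fun _ => []⟩ fun x => by
    simp [prodCode, Transducer.out, Transducer.outFrom]

/-- Both branches are computed. The condition stands first in the code of the triple, so a two-state
transducer can remember it and keep only the right branch. -/
theorem ite {b : X → Bool} {f g : X → Y} (hb : PT c (Cod.letter Bool) b) (hf : PT c d f)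
    (hg : PT c d g) : PT c d (fun x => if b x then f x else g x) := by
  refine PT.comp (d := (Cod.letter Bool).prod (d.prod d)) (e := d)
    (g := fun p => if p.1 then p.2.1 else p.2.2) ?_ (hb.pair (hf.pair hg))
  refine of_transducer (c := (Cod.letter Bool).prod (d.prod d))
    ⟨Bool, false, fun q s => Sum.elim (fun b => b) (fun _ => q) s,
      fun q s => Sum.elim (fun _ => []) (Sum.elim (fun a => if q then [a] else [])
        (fun a => if q then [] else [a])) s,
      fun _ => []⟩ ?_
  rintro ⟨b, y, z⟩
  simp only [prodCode, Transducer.out, List.map_cons, List.map_nil, List.singleton_append,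
    Transducer.outFrom, Sum.elim_inl, List.nil_append, List.map_append, List.map_map]
  have key : ∀ (T : Transducer (Bool ⊕ (d.A ⊕ d.A)) d.A) (q : T.Q) (v : List (Bool ⊕ (d.A ⊕ d.A)))
      (u : List d.A) (i : d.A → Bool ⊕ (d.A ⊕ d.A)), (∀ a, T.next q (i a) = q) →
      ((∀ a, T.emit q (i a) = [a]) → T.outFrom q (u.map i ++ v) = u ++ T.outFrom q v) ∧
      ((∀ a, T.emit q (i a) = []) → T.outFrom q (u.map i ++ v) = T.outFrom q v) := by
    intro T q v u i hq
    induction u with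
    | nil => simp
    | cons a u ih =>
      simp only [List.map_cons, List.cons_append, Transducer.outFrom, hq]
      exact ⟨fun h => by rw [h, ih.1 h]; rfl, fun h => by rw [h, ih.2 h]; rfl⟩
  rw [← List.append_nil (List.map _ (d.code z))]
  cases b
  · rw [(key _ _ _ _ _ ?_).2, (key _ _ _ _ _ ?_).1] <;> simp [Transducer.outFrom]
  · rw [(key _ _ _ _ _ ?_).1, (key _ _ _ _ _ ?_).2] <;> simp [Transducer.outFrom]

section Lists

theorem nil : PT w c.list (fun _ => []) := const []

theorem singleton : PT c c.list (fun x => [x]) :=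
  of_flatMap (fun a => [some a]) [none] fun x => by
    rw [list_code, list_cons, ← List.map_eq_flatMap]; rfl

theorem append' : PT (c.list.prod c.list) c.list (fun p => p.1 ++ p.2) :=
  of_flatMap (Sum.elim (fun a => [a]) fun a => [a]) [] fun x => by
    simp only [List.append_nil, list_append, prodCode, List.flatMap_append, List.flatMap_map,
      Sum.elim_inl, Sum.elim_inr, List.flatMap_singleton']

theorem append {f g : W → List X} (hf : PT w c.list f) (hg : PT w c.list g) :
    PT w c.list (fun x => f x ++ g x) := append'.comp (hf.pair hg)

theorem cons {f : W → X} {g : W → List X} (hf : PT w c f) (hg : PT w c.list g) :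
    PT w c.list (fun x => f x :: g x) := (singleton.comp hf).append hg

theorem flatten : PT c.list.list c.list List.flatten :=
  of_flatMap (fun o => o.toList) [] fun l => by
    induction l with
    | nil => rfl
    | cons x l ih =>
      simp only at ih ⊢
      rw [list_cons, List.flatten_cons, list_append, ih]
      simp [List.flatMap_append, List.flatMap_map, List.flatMap_singleton']

theorem flattenStr : PT (str A).list (str A) List.flatten :=
  of_flatMap (fun o => o.toList) [] fun l => by
    induction l with
    | nil => rfl
    | cons x l ih =>
      simp only at ih ⊢
      rw [list_cons, List.flatten_cons]
      rw [ih]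
      simp [List.flatMap_append, List.flatMap_map, List.flatMap_singleton']

theorem appendStr {f g : W → List A} (hf : PT w (str A) f) (hg : PT w (str A) g) :
    PT w (str A) (fun x => f x ++ g x) :=
  PT.comp (d := (str A).prod (str A)) (g := fun p => p.1 ++ p.2)
    (of_flatMap (Sum.elim (fun a => [a]) fun a => [a]) [] fun x => by
      simp [prodCode, List.flatMap_append, List.flatMap_map]) (hf.pair hg)

theorem mapStr (g : A → B) : PT (str A) (str B) (List.map g) :=
  of_flatMap (fun a => [g a]) [] fun x => by
    rw [List.append_nil, ← List.map_eq_flatMap]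

theorem ofStr : PT (str A) (Cod.letter A).list (fun s => s) :=
  of_flatMap (fun a => [some a, none]) [] fun x => by simp [listCode]

theorem toStr : PT (Cod.letter A).list (str A) (fun s => s) :=
  of_flatMap (fun o => o.toList) [] fun l => by
    induction l with
    | nil => rfl
    | cons x l ih =>
      rw [List.append_nil, list_code] at *
      rw [list_cons, List.flatMap_append, List.flatMap_cons, ← ih]
      rfl

theorem outFrom_block {A B : Type} (T : Transducer A B) (q : T.Q) (i : E → A) (f : E → List B)
    (u : List E) (v : List A) (hq : ∀ a, T.next q (i a) = q) (hf : ∀ a, T.emit q (i a) = f a) :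
    T.outFrom q (u.map i ++ v) = u.flatMap f ++ T.outFrom q v := by
  induction u with
  | nil => rfl
  | cons a u ih =>
    simp only [List.map_cons, List.cons_append, Transducer.outFrom, hq, hf, ih,
      List.flatMap_cons, List.append_assoc]

theorem outFrom_copy {A B : Type} (T : Transducer A B) (q : T.Q) (f : A → List B)
    (u : List A) (hq : ∀ a, T.next q a = q) (hf : ∀ a, T.emit q a = f a) :
    T.outFrom q u = u.flatMap f ++ T.last q := by
  have := outFrom_block T q id f u [] hq hf
  simpa [Transducer.outFrom] using this

theorem tail : PT c.list c.list List.tail := by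
  let T : Transducer (Option c.A) (Option c.A) :=
    ⟨Bool, false, fun q s => q || s.isNone, fun q s => if q then [s] else [], fun _ => []⟩
  refine of_transducer T fun l => ?_
  cases l with
  | nil => rfl
  | cons x l =>
    rw [list_code, list_cons, Transducer.out, outFrom_block T _ _ (fun _ => []) _ _ (fun _ => rfl)
      (fun _ => rfl)]
    simp only [Transducer.outFrom, List.tail_cons]
    rw [outFrom_copy T (T.next T.start none) (fun s => [s]) _ (fun _ => rfl) (fun _ => rfl)]
    simp [T]

theorem headD (x₀ : X) : PT c.list c (fun l => l.headD x₀) := by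
  let T : Transducer (Option c.A) c.A :=
    ⟨Bool, false, fun q s => q || s.isNone, fun q s => if q then [] else s.toList,
      fun q => if q then [] else c.code x₀⟩
  refine of_transducer T fun l => ?_
  cases l with
  | nil => rfl
  | cons x l =>
    rw [list_code, list_cons, Transducer.out, outFrom_block T _ _ (fun a => [a]) _ _ (fun _ => rfl)
      (fun _ => rfl)]
    simp only [Transducer.outFrom, List.headD_cons]
    rw [outFrom_copy T (T.next T.start none) (fun s => []) _ (fun _ => rfl) (fun _ => rfl)]
    simp [T]

/-- Every element contributes a separator, so only the empty list has an empty code, whatever the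
coding of the elements. -/
theorem isEmpty : PT c.list (Cod.letter Bool) List.isEmpty := by
  let T : Transducer (Option c.A) Bool :=
    ⟨Bool, true, fun _ _ => false, fun _ _ => [], fun q => [q]⟩
  have h : ∀ s : List (Option c.A), T.outFrom false s = [false] := fun s => by
    rw [outFrom_copy T false (fun s => []) _ (fun _ => rfl) (fun _ => rfl)]
    simp [T]
  refine of_transducer T fun l => ?_
  cases l with
  | nil => rfl
  | cons x l =>
    rw [list_code, list_cons]
    cases c.code x with
    | nil => exact (h _).symm
    | cons a s => exact (h _).symm

theorem tailStr : PT (str A) (str A) List.tail := toStr.comp (tail.comp ofStr)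

theorem headStr : PT (str A) (Cod.letter (Option A)) List.head? := by
  let T : Transducer A (Option A) :=
    ⟨Bool, true, fun _ _ => false, fun q a => if q then [some a] else [],
      fun q => if q then [none] else []⟩
  refine of_transducer (c := str A) T fun l => ?_
  cases l with
  | nil => rfl
  | cons x l =>
    change _ = some x :: T.outFrom false l
    rw [outFrom_copy T false (fun s => []) _ (fun _ => rfl) (fun _ => rfl)]
    simp [T]

theorem drop (n : ℕ) : PT c.list c.list (List.drop n) := by
  induction n with
  | zero => exact PT.id
  | succ n ih => simpa using tail.comp ih

theorem getD (n : ℕ) (x₀ : X) : PT c.list c (fun l => l.getD n x₀) := by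
  have := (headD (c := c) x₀).comp (drop n)
  convert this using 2 with l
  simp [List.head?_drop, List.headD_eq_head?_getD]

/-- The fold becomes the iteration of one step on parameter, accumulator and remaining list. The
hypothesis `hp`, applied to prefixes of the list, bounds every intermediate accumulator. -/
theorem foldl {v : Cod E} {s : (E × Y) × X → Y} (hs : PT ((v.prod d).prod c) d s)
    (p : Polynomial ℕ)
    (hp : ∀ z y l, (d.code (l.foldl (fun y x => s ((z, y), x)) y)).length ≤
      p.eval ((v.code z).length + (d.code y).length + (c.list.code l).length))
    {fz : W → E} {fy : W → Y} {fl : W → List X} (hz : PT w v fz) (hy : PT w d fy)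
    (hl : PT w c.list fl) :
    PT w d (fun x => (fl x).foldl (fun y a => s ((fz x, y), a)) (fy x)) := by
  rcases isEmpty_or_nonempty X with hX | ⟨⟨x₀⟩⟩
  · convert hy using 2 with x
    rw [Subsingleton.elim (fl x) [], List.foldl_nil]
  -- On the empty list the step does nothing, because there will be more iterations than elements.
  let F : (E × Y) × List X → (E × Y) × List X := fun q =>
    if q.2.isEmpty then q else ((q.1.1, s (q.1, q.2.headD x₀)), q.2.tail)
  have hF : PT ((v.prod d).prod c.list) ((v.prod d).prod c.list) F := by
    refine PT.ite (isEmpty.comp snd) PT.id (pair (pair (fst.comp fst) ?_) (tail.comp snd))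
    exact hs.comp (fst.pair ((headD x₀).comp snd))
  have iter : ∀ n z y l, F^[n] ((z, y), l) =
      ((z, (l.take n).foldl (fun y x => s ((z, y), x)) y), l.drop n) := by
    intro n
    induction n with
    | zero => intro z y l; simp
    | succ n ih =>
      intro z y l
      rw [Function.iterate_succ_apply]
      cases l with
      | nil =>
        have : F ((z, y), []) = ((z, y), []) := by simp [F]
        rw [this, ih]; simp
      | cons x l =>
        have : F ((z, y), x :: l) = ((z, s ((z, y), x)), l) := by simp [F]
        rw [this, ih]; simp
  have h := polyTime_iterate hF (.X + p) (by
    rintro ⟨⟨z, y⟩, l⟩ n -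
    rw [iter]
    have h₁ := hp z y (l.take n)
    have h₂ : (c.list.code l).length =
        (c.list.code (l.take n)).length + (c.list.code (l.drop n)).length := by
      rw [← List.length_append, ← list_append, List.take_append_drop]
    have h₃ := eval_mono p (show (v.code z).length + (d.code y).length +
      (c.list.code (l.take n)).length ≤ (v.code z).length + (d.code y).length +
      (c.list.code l).length by omega)
    simp only [length_prod, Polynomial.eval_add, Polynomial.eval_X] at *
    omega)
  have h' : PT ((v.prod d).prod c.list) d
      (fun q => q.2.foldl (fun y x => s ((q.1.1, y), x)) q.1.2) := by
    have := (snd.comp fst).comp (show PT _ _ _ from h)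
    refine Eq.mp ?_ this
    congr 1
    funext ⟨⟨z, y⟩, l⟩
    rw [iter]
    simp only
    -- The number of iterations is the length of the whole code, which is at least the number of
    -- elements.
    rw [List.take_of_length_le]
    rw [length_prod]
    exact (length_le_list c.code l).trans (by simp)
  exact h'.comp ((hz.pair hy).pair hl)

theorem map {v : Cod E} {f : E × X → Y} (hf : PT (v.prod c) d f) {fz : W → E} {fl : W → List X}
    (hz : PT w v fz) (hl : PT w c.list fl) :
    PT w d.list (fun x => (fl x).map fun a => f (fz x, a)) := by
  obtain ⟨p, hp⟩ := hf.length_le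
  have hfold : ∀ (z : E) (l : List X) (y : List Y),
      l.foldl (fun y x => y ++ [f (z, x)]) y = y ++ l.map fun a => f (z, a) := by
    intro z l
    induction l with
    | nil => simp
    | cons a l ih => intro y; simp [ih]
  have := foldl (v := v) (d := d.list) (c := c) (s := fun q => q.1.2 ++ [f (q.1.1, q.2)])
    ((snd.comp fst).append (singleton.comp (hf.comp ((fst.comp fst).pair snd))))
    -- The old accumulator, plus at most as many new entries as the code has symbols, each of length
    -- at most `p` and followed by a separator.
    (.X + .X * (p + 1)) (by
      intro z y l
      rw [hfold, list_code, list_append, List.length_append]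
      have key : ∀ N, (v.code z).length + (c.list.code l).length ≤ N →
          (d.list.code (l.map fun a => f (z, a))).length ≤ l.length * (p.eval N + 1) := by
        intro N hN
        induction l with
        | nil => simp [list_nil]
        | cons a l ih =>
          simp only [length_list_cons] at hN
          have h₁ := ih (by simp only; omega)
          have h₂ := (hp (z, a)).trans (eval_mono p (show _ ≤ N by
            rw [prod_code, length_prod]; simp only; omega))
          rw [List.map_cons, length_list_cons, List.length_cons]
          simp only at h₂
          linarith
      have h₁ := key _ (show _ ≤ (v.code z).length + (d.list.code y).length +
        (c.list.code l).length by omega)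
      have h₂ := length_le_list c.code l
      simp only [Polynomial.eval_add, Polynomial.eval_mul, Polynomial.eval_X,
        Polynomial.eval_one]
      refine add_le_add (by omega) (h₁.trans ?_)
      exact Nat.mul_le_mul_right _ (by omega))
    hz nil hl
  simpa only [hfold, List.nil_append] using this

end Lists

section Unary

/-- The unary notation of a number. -/
abbrev unary (n : ℕ) : List Unit := List.replicate n ()

theorem codeLength : PT c (str Unit) (fun x => unary (c.code x).length) :=
  of_flatMap (fun _ => [()]) [] fun x => by
    simp only [List.append_nil]
    induction c.code x with
    | nil => rfl
    | cons a s ih => rw [List.flatMap_cons, ← ih]; rfl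

/-- Each symbol of `f x` is replaced by a copy of the word `g x`, and the copies are joined. -/
theorem unaryMul {f g : W → ℕ} (hf : PT w (str Unit) fun x => unary (f x))
    (hg : PT w (str Unit) fun x => unary (g x)) :
    PT w (str Unit) fun x => unary (f x * g x) := by
  have := flattenStr.comp (map (v := str Unit) (c := Cod.letter Unit) (d := str Unit)
    (f := fun q => q.1) fst hg (ofStr.comp hf))
  convert this using 2 with x
  simp [unary]

theorem unaryPoly (p : Polynomial ℕ) {f : W → ℕ} (hf : PT w (str Unit) fun x => unary (f x)) :
    PT w (str Unit) fun x => unary (p.eval (f x)) := by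
  induction p using Polynomial.induction_on with
  | C a => simpa using const _
  | add p q hp hq =>
    simpa only [Polynomial.eval_add, unary, List.replicate_add] using hp.appendStr hq
  | monomial n a ih =>
    have := unaryMul ih hf
    simpa [pow_succ, mul_assoc] using this

/-- A fold along the unary number moves one element per symbol to the front part. -/
theorem splitAt {f : W → ℕ} {g : W → List X} (hf : PT w (str Unit) fun x => unary (f x))
    (hg : PT w c.list g) :
    PT w (c.list.prod c.list) (fun x => ((g x).take (f x), (g x).drop (f x))) := by
  rcases isEmpty_or_nonempty X with hX | ⟨⟨x₀⟩⟩
  · convert const (c := w) (d := c.list.prod c.list) ([], []) using 2 with x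
    rw [Subsingleton.elim (g x) []]; simp
  let s : (List Unit × (List X × List X)) × Unit → List X × List X := fun q =>
    if q.1.2.2.isEmpty then q.1.2 else (q.1.2.1 ++ [q.1.2.2.headD x₀], q.1.2.2.tail)
  have hs : PT (((str Unit).prod (c.list.prod c.list)).prod (Cod.letter Unit))
      (c.list.prod c.list) s := by
    have h := (snd (c := c.list) (d := c.list)).comp ((snd (c := str Unit)).comp
      (fst (d := Cod.letter Unit)))
    refine PT.ite (isEmpty.comp h) (snd.comp fst) (pair (append (fst.comp (snd.comp fst))
      (singleton.comp ((headD x₀).comp h))) (tail.comp h))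
  have hfold : ∀ z (u : List Unit) (a b : List X),
      u.foldl (fun y x => s ((z, y), x)) (a, b) = (a ++ b.take u.length, b.drop u.length) := by
    intro z u
    induction u with
    | nil => simp
    | cons t u ih =>
      intro a b
      cases b with
      | nil => simpa [s] using ih a []
      | cons x b => simpa [s] using ih (a ++ [x]) b
  have := foldl hs .X (fun z y l => by
    obtain ⟨a, b⟩ := y
    rw [hfold, prod_code, length_prod, length_prod]
    have : (listCode c.code b).length =
        (listCode c.code (b.take l.length)).length + (listCode c.code (b.drop l.length)).length := by
      rw [← List.length_append, ← list_append, List.take_append_drop]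
    simp only [list_append, List.length_append, Polynomial.eval_X] at *
    omega) (fz := fun _ => []) (const _) (nil.pair hg) (ofStr.comp hf)
  simpa only [hfold, List.nil_append, List.length_replicate] using this

theorem takeStr {f : W → ℕ} {g : W → List A} (hf : PT w (str Unit) fun x => unary (f x))
    (hg : PT w (str A) g) : PT w (str A) (fun x => (g x).take (f x)) :=
  toStr.comp (fst.comp (splitAt hf (ofStr.comp hg)))

theorem dropStr {f : W → ℕ} {g : W → List A} (hf : PT w (str Unit) fun x => unary (f x))
    (hg : PT w (str A) g) : PT w (str A) (fun x => (g x).drop (f x)) :=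
  toStr.comp (snd.comp (splitAt hf (ofStr.comp hg)))

end Unary

section Eq

theorem letterOp {f : W → A} {g : W → B} (op : A → B → E) [Finite E]
    (hf : PT w (Cod.letter A) f) (hg : PT w (Cod.letter B) g) :
    PT w (Cod.letter E) (fun x => op (f x) (g x)) :=
  (letter₂ (d := Cod.letter E) (fun p => op p.1 p.2)).comp (hf.pair hg)

/-- A fold along the first string pops symbols of the second and compares. The strings agree if and
only if the first is a prefix of the second and nothing is left over. -/
theorem eqStr {f g : W → List A} (hf : PT w (str A) f) (hg : PT w (str A) g) :
    PT w (Cod.letter Bool) (fun x => open Classical in decide (f x = g x)) := by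
  classical
  let s : (List Unit × (List A × Bool)) × A → List A × Bool := fun q =>
    (q.1.2.1.tail, q.1.2.2 && decide (q.1.2.1.head? = some q.2))
  have hs : PT (((str Unit).prod ((str A).prod (Cod.letter Bool))).prod (Cod.letter A))
      ((str A).prod (Cod.letter Bool)) s := by
    have h := (fst (c := str A) (d := Cod.letter Bool)).comp ((snd (c := str Unit)).comp
      (fst (d := Cod.letter A)))
    have h' := (snd (c := str A) (d := Cod.letter Bool)).comp ((snd (c := str Unit)).comp
      (fst (d := Cod.letter A)))
    exact pair (tailStr.comp h) (letterOp (fun a b => a && b) h'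
      (letterOp (fun a b => decide (a = some b)) (headStr.comp h) snd))
  have hfold : ∀ z (u v : List A) (b : Bool), u.foldl (fun y x => s ((z, y), x)) (v, b) =
      (v.drop u.length, b && decide (u <+: v)) := by
    intro z u
    induction u with
    | nil => intro v b; simp
    | cons t u ih =>
      intro v b
      have : s ((z, (v, b)), t) = (v.tail, b && decide (v.head? = some t)) := rfl
      rw [List.foldl_cons, this, ih]
      cases v with
      | nil => simp
      | cons x v =>
        simp only [List.tail_cons, List.head?_cons, Option.some.injEq, List.length_cons,
          List.drop_succ_cons, List.cons_prefix_cons, Bool.and_assoc, eq_comm (a := x)]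
        congr 2
        rw [Bool.eq_iff_iff]
        simp only [Bool.and_eq_true, decide_eq_true_eq]
        exact and_congr_right fun _ => decide_eq_true_iff
  have := foldl hs (.X + 1) (fun z y l => by
    obtain ⟨a, b⟩ := y
    rw [hfold, prod_code, length_prod, length_prod]
    simp only [List.length_drop, List.length_cons, List.length_nil, Polynomial.eval_add,
      Polynomial.eval_X, Polynomial.eval_one]
    omega) (fz := fun _ => []) (const _) (hg.pair (const true)) (ofStr.comp hf)
  simp only [hfold, Bool.true_and] at this
  have h₂ := letterOp (fun a b => a && b) (isEmpty.comp (ofStr.comp (fst.comp this)))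
    (snd.comp this)
  convert h₂ using 2 with x
  by_cases h : f x = g x
  · simp [h]
  · have : ¬ ((g x).drop (f x).length = [] ∧ f x <+: g x) := by
      rintro ⟨h₁, v, h₂⟩
      rw [← h₂] at h₁
      simp only [List.drop_left] at h₁
      exact h (by rw [← h₂, h₁, List.append_nil])
    simp only [h, decide_false]
    symm
    by_contra h'
    simp only [Bool.not_eq_false, Bool.and_eq_true, List.isEmpty_iff, decide_eq_true_eq] at h'
    exact this h'

theorem eq (hc : Function.Injective c.code) {f g : W → X} (hf : PT w c f) (hg : PT w c g) :
    PT w (Cod.letter Bool) (fun x => open Classical in decide (f x = g x)) := by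
  have := eqStr (code.comp hf) (code.comp hg)
  convert this using 4 with x
  exact hc.eq_iff.symm

end Eq

end PT

end RationalProof

/-! ### Merlin's game on a fixed input -/

namespace RationalProof

/-- The game that Merlin plays on a fixed input: Arthur draws an element of `C` uniformly, and
after the moves `h` the reward is `rew h r`. -/
structure Game (S : Type) where
  C : Type
  [fin : Fintype C]
  reply : List (S × S) → S → C → S
  M : Finset S
  nonempty : M.Nonempty
  rew : List (S × S) → C → ℚ

namespace Game

attribute [instance] Game.fin

variable {S : Type} (G : Game S)

/-- The coins that are compatible with a history. -/
noncomputable def cons (h : List (S × S)) : Finset G.C :=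
  open Classical in
  Finset.univ.filter fun r => ∀ t (ht : t < h.length), G.reply (h.take t) h[t].1 r = h[t].2

/-- The optimal expected reward when `n` rounds remain. -/
noncomputable def opt : ℕ → List (S × S) → ℚ
  | 0, h => (G.cons h).expect (G.rew h)
  | n + 1, h => G.M.sup' G.nonempty fun m =>
      (G.cons h).expect fun r => opt n (h ++ [(m, G.reply h m r)])

/-- The expected reward of a message with optimal play afterwards. -/
noncomputable def msg (n : ℕ) (h : List (S × S)) (m : S) : ℚ :=
  (G.cons h).expect fun r => G.opt n (h ++ [(m, G.reply h m r)])

/-- The message is a rational choice. -/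
def Best (n : ℕ) (h : List (S × S)) (m : S) : Prop :=
  m ∈ G.M ∧ ∀ m' ∈ G.M, G.msg n h m' ≤ G.msg n h m

/-- The history after `t` rounds. -/
def run (ms : ℕ → S) (r : G.C) : ℕ → List (S × S)
  | 0 => []
  | t + 1 => run ms r t ++ [(ms t, G.reply (run ms r t) (ms t) r)]

/-- In a game of `k` rounds, Merlin is rational in the first `i` rounds. -/
def RationalTo (k i : ℕ) (ms : ℕ → S) (r : G.C) : Prop :=
  ∀ t < i, G.Best (k - 1 - t) (G.run ms r t) (ms t)

/-- The unnormalized optimal reward. -/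
noncomputable def tot (n : ℕ) (h : List (S × S)) : ℚ := (G.cons h).card * G.opt n h

/-- The unnormalized reward of a message. -/
noncomputable def totMsg (n : ℕ) (h : List (S × S)) (m : S) : ℚ := (G.cons h).card * G.msg n h m

variable {G}

theorem mem_cons {h : List (S × S)} {r : G.C} : r ∈ G.cons h ↔
    ∀ t (ht : t < h.length), G.reply (h.take t) h[t].1 r = h[t].2 := by
  classical
  simp [cons]

theorem mem_cons_append {h : List (S × S)} {m a : S} {r : G.C} :
    r ∈ G.cons (h ++ [(m, a)]) ↔ r ∈ G.cons h ∧ G.reply h m r = a := by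
  rw [mem_cons, mem_cons]
  constructor
  · intro H
    constructor
    · intro t ht
      have := H t (by simp; omega)
      rw [List.take_append_of_le_length ht.le, List.getElem_append_left ht] at this
      exact this
    · have := H h.length (by simp)
      simpa using this
  · rintro ⟨H, H'⟩ t ht
    rw [List.length_append, List.length_singleton] at ht
    rcases Nat.lt_succ_iff_lt_or_eq.1 ht with ht | rfl
    · rw [List.take_append_of_le_length ht.le, List.getElem_append_left ht]
      exact H t ht
    · simpa using H'

theorem cons_append (h : List (S × S)) (m a : S) : open Classical in
    G.cons (h ++ [(m, a)]) = (G.cons h).filter fun r => G.reply h m r = a := by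
  classical
  ext r
  rw [mem_cons_append, Finset.mem_filter]

theorem opt_succ (n : ℕ) (h : List (S × S)) :
    G.opt (n + 1) h = G.M.sup' G.nonempty (G.msg n h) := rfl

theorem msg_le_opt {n : ℕ} {h : List (S × S)} {m : S} (hm : m ∈ G.M) :
    G.msg n h m ≤ G.opt (n + 1) h := by
  rw [opt_succ]
  exact Finset.le_sup' (G.msg n h) hm

theorem exists_best (n : ℕ) (h : List (S × S)) :
    ∃ m, G.Best n h m ∧ G.msg n h m = G.opt (n + 1) h := by
  obtain ⟨m, hm, e⟩ := Finset.exists_mem_eq_sup' G.nonempty (G.msg n h)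
  exact ⟨m, ⟨hm, fun m' hm' => (msg_le_opt hm').trans e.le⟩, e.symm⟩

theorem best_of_msg_eq {n : ℕ} {h : List (S × S)} {m : S} (hm : m ∈ G.M)
    (e : G.opt (n + 1) h ≤ G.msg n h m) : G.Best n h m :=
  ⟨hm, fun _ hm' => (msg_le_opt hm').trans e⟩

theorem length_run (ms : ℕ → S) (r : G.C) (t : ℕ) : (G.run ms r t).length = t := by
  induction t with
  | zero => rfl
  | succ t ih => simp [run, ih]

theorem mem_cons_run (ms : ℕ → S) (r : G.C) (t : ℕ) : r ∈ G.cons (G.run ms r t) := by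
  induction t with
  | zero => simp [run, mem_cons]
  | succ t ih => exact mem_cons_append.2 ⟨ih, rfl⟩

theorem run_congr {ms ms' : ℕ → S} (r : G.C) {t : ℕ} (h : ∀ s < t, ms s = ms' s) :
    G.run ms r t = G.run ms' r t := by
  induction t with
  | zero => rfl
  | succ t ih => rw [run, run, ih fun s hs => h s (by omega), h t (by omega)]

/-- Coins compatible with a history produce that same history, so rationality up to that point
cannot depend on which of them Arthur holds. -/
theorem run_eq_of_mem_cons {ms : ℕ → S} {r r' : G.C} {t : ℕ} (h : r' ∈ G.cons (G.run ms r t)) :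
    ∀ s ≤ t, G.run ms r' s = G.run ms r s := by
  induction t with
  | zero =>
    intro s hs
    obtain rfl : s = 0 := by omega
    rfl
  | succ t ih =>
    obtain ⟨h₁, h₂⟩ := mem_cons_append.1 h
    intro s hs
    rcases Nat.le_succ_iff.1 hs with hs | rfl
    · exact ih h₁ s hs
    · rw [run, run, ih h₁ t le_rfl, h₂]

theorem RationalTo.congr {k i : ℕ} {ms ms' : ℕ → S} {r r' : G.C} (h : G.RationalTo k i ms r)
    (hms : ∀ s < i, ms' s = ms s) (hr : ∀ s ≤ i, G.run ms r' s = G.run ms r s) :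
    G.RationalTo k i ms' r' := by
  intro t ht
  rw [run_congr r' fun s hs => hms s (by omega), hr t ht.le, hms t ht]
  exact h t ht

theorem RationalTo.update {k i : ℕ} {ms : ℕ → S} {r : G.C} (h : G.RationalTo k i ms r) {m : S}
    (hm : G.Best (k - 1 - i) (G.run ms r i) m) :
    G.RationalTo k (i + 1) (Function.update ms i m) r := by
  intro t ht
  have e : ∀ s ≤ i, G.run (Function.update ms i m) r s = G.run ms r s := fun s hs =>
    run_congr r fun u hu => Function.update_of_ne (by omega) _ _
  rcases Nat.lt_succ_iff_lt_or_eq.1 ht with ht | rfl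
  · rw [e t ht.le, Function.update_of_ne (by omega)]
    exact h t ht
  · rw [e t le_rfl, Function.update_self]
    exact hm

/-- Best messages always exist in a finite game, and a rational choice looks only forward, so later
choices do not spoil earlier ones. -/
theorem RationalTo.extend {k i n : ℕ} {ms : ℕ → S} {r : G.C} (h : G.RationalTo k i ms r) :
    ∃ ms', (∀ s < i, ms' s = ms s) ∧ G.RationalTo k (i + n) ms' r := by
  induction n with
  | zero => exact ⟨ms, fun _ _ => rfl, h⟩
  | succ n ih =>
    obtain ⟨ms', h₁, h₂⟩ := ih
    obtain ⟨m, hm, -⟩ := G.exists_best (k - 1 - (i + n)) (G.run ms' r (i + n))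
    refine ⟨_, fun s hs => ?_, h₂.update hm⟩
    rw [Function.update_of_ne (by omega), h₁ s hs]

theorem exists_rational (k : ℕ) (r : G.C) : ∃ ms, G.RationalTo k k ms r := by
  obtain ⟨m, -⟩ := G.nonempty
  obtain ⟨ms, -, h⟩ := RationalTo.extend (G := G) (k := k) (i := 0) (n := k) (ms := fun _ => m)
    (r := r) (fun t ht => by omega)
  exact ⟨ms, by simpa using h⟩

/-! ### Unnormalized rewards: approximation and integrality -/

section Totals

theorem tot_zero (h : List (S × S)) : G.tot 0 h = ∑ r ∈ G.cons h, G.rew h r :=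
  Finset.card_mul_expect _ _

/-- Arthur's replies partition the compatible coins. Multiplying by their number turns averages into
sums, so the value of a message is the sum of the values of its continuations. Replies in `A` that
never occur contribute 0. -/
theorem totMsg_eq {n : ℕ} {h : List (S × S)} {m : S} {A : Finset S}
    (hA : ∀ r, G.reply h m r ∈ A) : G.totMsg n h m = ∑ a ∈ A, G.tot n (h ++ [(m, a)]) := by
  classical
  rw [totMsg, msg, Finset.card_mul_expect, ← Finset.sum_fiberwise_of_maps_to (fun r _ => hA r)]
  refine Finset.sum_congr rfl fun a _ => ?_
  rw [tot, cons_append, ← nsmul_eq_mul, ← Finset.sum_const]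
  refine Finset.sum_congr (by congr) fun r hr => ?_
  rw [(Finset.mem_filter.1 hr).2]

theorem card_eq_sum {h : List (S × S)} {m : S} {A : Finset S} (hA : ∀ r, G.reply h m r ∈ A) :
    ((G.cons h).card : ℚ) = ∑ a ∈ A, ((G.cons (h ++ [(m, a)])).card : ℚ) := by
  classical
  rw [Finset.card_eq_sum_card_fiberwise (f := G.reply h m) (t := A) (fun r _ => hA r)]
  push_cast
  refine Finset.sum_congr rfl fun a _ => ?_
  rw [cons_append]

theorem tot_succ (n : ℕ) (h : List (S × S)) :
    G.tot (n + 1) h = G.M.sup' G.nonempty (G.totMsg n h) := by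
  rw [tot, opt_succ]
  exact Finset.apply_sup'_eq_sup'_comp G.nonempty (fun x => ((G.cons h).card : ℚ) * x)
    fun x y => mul_max_of_nonneg _ _ (Nat.cast_nonneg _)

theorem card_cons_pos {h : List (S × S)} {r : G.C} (hr : r ∈ G.cons h) :
    (0 : ℚ) < (G.cons h).card := by
  exact_mod_cast Finset.card_pos.2 ⟨r, hr⟩

/-- A common finite set of candidate replies allows the sums for two games to be compared term by
term. -/
theorem exists_replies (G G' : Game S) (h h' : List (S × S)) (m m' : S) :
    ∃ A : Finset S, (∀ r, G.reply h m r ∈ A) ∧ ∀ r, G'.reply h' m' r ∈ A := by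
  classical
  exact ⟨Finset.univ.image (G.reply h m) ∪ Finset.univ.image (G'.reply h' m'),
    fun r => Finset.mem_union_left _ (by simp), fun r => Finset.mem_union_right _ (by simp)⟩

/-- The error is measured in units of the number of compatible coins, which is itself additive over
replies. Hence it does not grow with the number of rounds. -/
theorem abs_totMsg_sub_le {G' : Game S} {n n' : ℕ} {h h' : List (S × S)} {m m' : S} {c ε : ℚ}
    (H : ∀ a, |G'.tot n' (h' ++ [(m', a)]) - c * G.tot n (h ++ [(m, a)])| ≤
      ε * (G.cons (h ++ [(m, a)])).card) :
    |G'.totMsg n' h' m' - c * G.totMsg n h m| ≤ ε * (G.cons h).card := by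
  obtain ⟨A, hA, hA'⟩ := exists_replies G G' h h' m m'
  rw [totMsg_eq hA, totMsg_eq hA', card_eq_sum hA, Finset.mul_sum, Finset.mul_sum,
    ← Finset.sum_sub_distrib]
  exact (Finset.abs_sum_le_sum_abs _ _).trans (Finset.sum_le_sum fun a _ => H a)

/-- A game whose final positions have approximately the values of the corresponding positions of
another game is approximately the same game. -/
theorem abs_tot_sub_le {G' : Game S} {η : List (S × S) → List (S × S)} {μ : S → S}
    {Good : ℕ → List (S × S) → Prop} {c ε : ℚ} (hc : 0 ≤ c) {j : ℕ}
    (hη : ∀ h m a, η (h ++ [(m, a)]) = η h ++ [(μ m, a)])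
    (hμ : ∀ m ∈ G'.M, μ m ∈ G.M) (hμ' : ∀ m ∈ G.M, ∃ m' ∈ G'.M, μ m' = m)
    (good : ∀ n h m a, Good (n + 1) h → m ∈ G'.M → Good n (h ++ [(m, a)]))
    (base : ∀ h, Good 0 h → |G'.tot 0 h - c * G.tot j (η h)| ≤ ε * (G.cons (η h)).card) (n : ℕ) :
    ∀ h, Good n h → |G'.tot n h - c * G.tot (n + j) (η h)| ≤ ε * (G.cons (η h)).card := by
  induction n with
  | zero => simpa using base
  | succ n ih =>
    intro h hh
    have key : ∀ m ∈ G'.M, |G'.totMsg n h m - c * G.totMsg (n + j) (η h) (μ m)| ≤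
        ε * (G.cons (η h)).card := fun m hm => abs_totMsg_sub_le fun a => by
      rw [← hη]
      exact ih _ (good n h m a hh hm)
    rw [show n + 1 + j = n + j + 1 by omega, tot_succ, tot_succ, abs_sub_le_iff]
    constructor
    · rw [sub_le_iff_le_add]
      refine Finset.sup'_le _ _ fun m hm => ?_
      have h₁ := (abs_sub_le_iff.1 (key m hm)).1
      have h₂ := mul_le_mul_of_nonneg_left
        (Finset.le_sup' (G.totMsg (n + j) (η h)) (hμ m hm)) hc
      linarith
    · obtain ⟨m, hm, e⟩ := Finset.exists_mem_eq_sup' G.nonempty (G.totMsg (n + j) (η h))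
      obtain ⟨m', hm', rfl⟩ := hμ' m hm
      rw [e]
      have h₁ := (abs_sub_le_iff.1 (key m' hm')).2
      have h₂ := Finset.le_sup' (G'.totMsg n h) hm'
      linarith

/-- If the rewards are multiples of `1 / D`, then so are the unnormalized optimal rewards. -/
theorem exists_int_tot {Good : ℕ → List (S × S) → Prop} {D : ℚ}
    (good : ∀ n h m a, Good (n + 1) h → m ∈ G.M → Good n (h ++ [(m, a)]))
    (base : ∀ h r, Good 0 h → ∃ z : ℤ, D * G.rew h r = z) (n : ℕ) :
    ∀ h, Good n h → ∃ z : ℤ, D * G.tot n h = z := by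
  have sum : ∀ {ι : Type} (s : Finset ι) (f : ι → ℚ), (∀ i ∈ s, ∃ z : ℤ, D * f i = z) →
      ∃ z : ℤ, D * ∑ i ∈ s, f i = z := by
    intro ι s f hf
    choose! g hg using hf
    exact ⟨∑ i ∈ s, g i, by rw [Finset.mul_sum, Finset.sum_congr rfl hg]; push_cast; rfl⟩
  induction n with
  | zero =>
    intro h hh
    rw [tot_zero]
    exact sum _ _ fun r _ => base h r hh
  | succ n ih =>
    intro h hh
    rw [tot_succ]
    obtain ⟨m, hm, e⟩ := Finset.exists_mem_eq_sup' G.nonempty (G.totMsg n h)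
    obtain ⟨A, hA, -⟩ := exists_replies G G h h m m
    rw [e, totMsg_eq hA]
    exact sum _ _ fun a _ => ih _ (good n h m a hh hm)

theorem exists_int_totMsg {Good : ℕ → List (S × S) → Prop} {D : ℚ}
    (good : ∀ n h m a, Good (n + 1) h → m ∈ G.M → Good n (h ++ [(m, a)]))
    (base : ∀ h r, Good 0 h → ∃ z : ℤ, D * G.rew h r = z) (n : ℕ) (h : List (S × S)) (m : S)
    (hh : Good (n + 1) h) (hm : m ∈ G.M) : ∃ z : ℤ, D * G.totMsg n h m = z := by
  obtain ⟨A, hA, -⟩ := exists_replies G G h h m m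
  rw [totMsg_eq hA, Finset.mul_sum]
  have : ∀ a, ∃ z : ℤ, D * G.tot n (h ++ [(m, a)]) = z := fun a =>
    exists_int_tot good base n _ (good n h m a hh hm)
  choose g hg using this
  exact ⟨∑ a ∈ A, g a, by rw [Finset.sum_congr rfl fun a _ => hg a]; push_cast; rfl⟩

end Totals

/-! ### Changing the reward of a game -/

section Rewards

/-- The same game with another reward. -/
@[reducible]
def withRew (G : Game S) (f : List (S × S) → G.C → ℚ) : Game S := { G with rew := f }

theorem expect_affine {ι : Type} {s : Finset ι} (hs : s.Nonempty) (a b : ℚ) (f : ι → ℚ) :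
    (s.expect fun r => a + b * f r) = a + b * s.expect f := by
  rw [Finset.expect_add_distrib, Finset.expect_const hs, Finset.mul_expect]

/-- Averages over the empty set are 0, so an additive constant passes only through positions with
compatible coins. Every reply that enters the average is given by a compatible coin, so the
induction stays at such positions. -/
theorem opt_affine (a b : ℚ) (hb : 0 ≤ b) (n : ℕ) : ∀ h, (G.cons h).Nonempty →
    (G.withRew fun h r => a + b * G.rew h r).opt n h = a + b * G.opt n h := by
  induction n with
  | zero => exact fun h hh => expect_affine hh a b _
  | succ n ih =>
    intro h hh
    have : ∀ m, (G.withRew fun h r => a + b * G.rew h r).msg n h m = a + b * G.msg n h m := by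
      intro m
      rw [msg, msg, ← expect_affine hh]
      exact Finset.expect_congr rfl fun r hr => ih _ ⟨r, mem_cons_append.2 ⟨hr, rfl⟩⟩
    rw [opt_succ, opt_succ]
    simp only [this]
    exact (Finset.apply_sup'_eq_sup'_comp G.nonempty (fun x => a + b * x) fun x y => by
      rw [mul_max_of_nonneg _ _ hb, max_add_add_left]).symm

theorem msg_affine {a b : ℚ} (hb : 0 ≤ b) {n : ℕ} {h : List (S × S)} {m : S}
    (hh : (G.cons h).Nonempty) :
    (G.withRew fun h r => a + b * G.rew h r).msg n h m = a + b * G.msg n h m := by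
  have : ∀ r ∈ G.cons h, (G.withRew fun h r => a + b * G.rew h r).opt n (h ++ [(m, G.reply h m r)]) =
      a + b * G.opt n (h ++ [(m, G.reply h m r)]) := fun r hr =>
    opt_affine a b hb n _ ⟨r, mem_cons_append.2 ⟨hr, rfl⟩⟩
  exact (Finset.expect_congr rfl this).trans (expect_affine hh a b _)

theorem best_affine {a b : ℚ} (hb : 0 < b) {n : ℕ} {h : List (S × S)} {m : S}
    (hh : (G.cons h).Nonempty) :
    (G.withRew fun h r => a + b * G.rew h r).Best n h m ↔ G.Best n h m := by
  simp only [Best, msg_affine hb.le hh, add_le_add_iff_left, mul_le_mul_iff_right₀ hb]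

variable {f : List (S × S) → G.C → ℚ}

theorem opt_withRew_le (hf : ∀ h r, f h r ≤ G.rew h r) (n : ℕ) :
    ∀ h, (G.withRew f).opt n h ≤ G.opt n h := by
  induction n with
  | zero => exact fun h => Finset.expect_le_expect fun r _ => hf h r
  | succ n ih =>
    intro h
    rw [opt_succ, opt_succ]
    refine Finset.sup'_le _ _ fun m hm => ?_
    refine le_trans ?_ (Finset.le_sup' (G.msg n h) hm)
    exact Finset.expect_le_expect fun r _ => ih _

theorem eq_of_expect_eq {ι : Type} {s : Finset ι} {f g : ι → ℚ} (h : ∀ i ∈ s, f i ≤ g i)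
    (e : s.expect g ≤ s.expect f) : ∀ i ∈ s, f i = g i := by
  have : ∑ i ∈ s, f i = ∑ i ∈ s, g i := by
    refine le_antisymm (Finset.sum_le_sum h) ?_
    rw [← Finset.card_mul_expect, ← Finset.card_mul_expect]
    exact mul_le_mul_of_nonneg_left e (Nat.cast_nonneg _)
  exact (Finset.sum_eq_sum_iff_of_le h).1 this

/-- If lowering the reward does not lower the optimal expected reward, then the reward has not
been lowered on some rational run. -/
theorem exists_rational_of_opt_le (hf : ∀ h r, f h r ≤ G.rew h r) {k : ℕ} {r : G.C} (n : ℕ) :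
    ∀ ms t, t + n = k → G.RationalTo k t ms r →
      G.opt n (G.run ms r t) ≤ (G.withRew f).opt n (G.run ms r t) →
      ∃ ms', G.RationalTo k k ms' r ∧ f (G.run ms' r k) r = G.rew (G.run ms' r k) r := by
  induction n with
  | zero =>
    rintro ms t rfl hms h
    exact ⟨ms, hms, eq_of_expect_eq (fun r _ => hf _ r) h r (mem_cons_run ms r t)⟩
  | succ n ih =>
    intro ms t ht hms h
    obtain ⟨m, hm, e⟩ := (G.withRew f).exists_best n (G.run ms r t)
    have hle : ∀ r' ∈ G.cons (G.run ms r t),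
        (G.withRew f).opt n (G.run ms r t ++ [(m, G.reply (G.run ms r t) m r')]) ≤
        G.opt n (G.run ms r t ++ [(m, G.reply (G.run ms r t) m r')]) := fun r' _ =>
      opt_withRew_le hf n _
    have h₁ : (G.withRew f).msg n (G.run ms r t) m ≤ G.msg n (G.run ms r t) m :=
      Finset.expect_le_expect hle
    -- A best message for the lowered reward has a value squeezed between the two optima, which
    -- agree here; it is therefore best for the original reward too.
    have hbest : G.Best n (G.run ms r t) m := best_of_msg_eq hm.1 ((h.trans e.ge).trans h₁)
    have h₂ : G.msg n (G.run ms r t) m ≤ (G.withRew f).msg n (G.run ms r t) m :=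
      ((msg_le_opt (G := G) hm.1).trans h).trans e.ge
    -- Equal averages of ordered functions force equality at each compatible coin, in particular at
    -- `r`.
    have h₃ := eq_of_expect_eq hle h₂ r (mem_cons_run ms r t)
    have hrun : G.run (Function.update ms t m) r (t + 1) =
        G.run ms r t ++ [(m, G.reply (G.run ms r t) m r)] := by
      rw [run, run_congr r (ms := Function.update ms t m) (ms' := ms) fun s hs =>
        Function.update_of_ne (by omega) _ _, Function.update_self]
    refine ih (Function.update ms t m) (t + 1) (by omega) (hms.update ?_) ?_
    · rwa [show k - 1 - t = n by omega]
    · rw [hrun]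
      exact h₃.ge

/-- If the reward is not lowered on rational runs, then the optimal expected reward is not
lowered. -/
theorem opt_le_of_rational {k : ℕ}
    (H : ∀ ms r, G.RationalTo k k ms r → f (G.run ms r k) r = G.rew (G.run ms r k) r) (n : ℕ) :
    ∀ ms r t, t + n = k → G.RationalTo k t ms r →
      G.opt n (G.run ms r t) ≤ (G.withRew f).opt n (G.run ms r t) := by
  induction n with
  | zero =>
    rintro ms r t rfl hms
    refine Finset.expect_le_expect fun r' hr' => ?_
    have hrun := run_eq_of_mem_cons hr'
    -- All coins compatible with this history lie on the same rational run, so `H` applies to each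
    -- of them.
    have := H ms r' (hms.congr (fun _ _ => rfl) hrun)
    rw [Nat.add_zero, hrun t le_rfl] at this
    exact this.ge
  | succ n ih =>
    intro ms r t ht hms
    obtain ⟨m, hm, e⟩ := G.exists_best n (G.run ms r t)
    rw [← e]
    refine le_trans ?_ (msg_le_opt (G := G.withRew f) (m := m) hm.1)
    refine Finset.expect_le_expect fun r' hr' => ?_
    have hrun := run_eq_of_mem_cons hr'
    have hrun' : G.run (Function.update ms t m) r' (t + 1) =
        G.run ms r t ++ [(m, G.reply (G.run ms r t) m r')] := by
      rw [run, run_congr r' (ms := Function.update ms t m) (ms' := ms) fun s hs =>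
        Function.update_of_ne (by omega) _ _, Function.update_self, hrun t le_rfl]
    have h₁ := ih (Function.update ms t m) r' (t + 1) (by omega)
      ((hms.congr (fun _ _ => rfl) hrun).update (by
        rw [hrun t le_rfl]
        rwa [show k - 1 - t = n by omega]))
    rw [hrun'] at h₁
    exact h₁

end Rewards

end Game

end RationalProof

namespace RationalProof

open Machine Cod

namespace PT

variable {X Y Z W E A B : Type} [Finite A] [Finite B] {c : Cod X} {d : Cod Y} {e : Cod Z}
  {w : Cod W}

theorem unaryConst (n : ℕ) : PT w (str Unit) (fun _ => unary n) := const _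

theorem take (n : ℕ) : PT c.list c.list (List.take n) :=
  fst.comp (splitAt (unaryConst n) PT.id)

theorem mapList {S : Type} {f : S → W → X} (l : List S) (hf : ∀ s, PT w c (f s)) :
    PT w c.list (fun x => l.map fun s => f s x) := by
  induction l with
  | nil => exact nil
  | cons s l ih => exact cons (hf s) ih

theorem mapRange {f : ℕ → W → X} (n : ℕ) (hf : ∀ i, PT w c (f i)) :
    PT w c.list (fun x => (List.range n).map fun i => f i x) := mapList _ hf

theorem flatMap {f : X → List Y} (hf : PT c d.list f) : PT c.list d.list (fun l => l.flatMap f) :=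
  flatten.comp (map (v := str Unit) (f := fun p => f p.2) (fz := fun _ => []) (hf.comp snd)
    (const _) PT.id)

/-- Adding one to each entry and then prepending 0 turns the list 0, …, n − 1 into 0, …, n. -/
theorem inits {f : W → ℕ} (hf : PT w (str Unit) fun x => unary (f x)) :
    PT w (str Unit).list (fun x => (List.range (f x + 1)).map unary) := by
  let s : (List Unit × List (List Unit)) × Unit → List (List Unit) := fun q =>
    [] :: q.1.2.map fun u => () :: u
  have hs : PT (((str Unit).prod (str Unit).list).prod (Cod.letter Unit)) (str Unit).list s :=
    cons (const []) (map (v := str Unit) (c := str Unit) (f := fun p => () :: p.2)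
      (fz := fun _ => []) (appendStr (const [()]) snd) (const _) (snd.comp fst))
  have hlen : ∀ (z : List Unit) (y : List (List Unit)),
      ((str Unit).list.code (s ((z, y), ()))).length =
        ((str Unit).list.code y).length + y.length + 1 := by
    intro z y
    change (listCode (fun s => s) _).length = (listCode (fun s => s) _).length + y.length + 1
    rw [length_str_list, length_str_list]
    have : ∀ y : List (List Unit), ((y.map fun u => () :: u).map List.length).sum =
        (y.map List.length).sum + y.length := by
      intro y
      induction y with
      | nil => rfl
      | cons a y ih => simp only [List.map_cons, List.sum_cons, List.length_cons, ih]; omega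
    simp only [s, List.map_cons, List.sum_cons, List.length_cons, this, List.length_map,
      List.length_nil]
    omega
  have hsize : ∀ (z : List Unit) (l : List Unit) (y : List (List Unit)),
      ((str Unit).list.code (l.foldl (fun y x => s ((z, y), x)) y)).length ≤
        ((str Unit).list.code y).length + l.length * (y.length + l.length + 1) := by
    intro z l
    induction l with
    | nil => intro y; simp
    | cons t l ih =>
      intro y
      rw [List.foldl_cons]
      refine (ih _).trans ?_
      rw [hlen, show (s ((z, y), t)).length = y.length + 1 by simp [s], List.length_cons]
      nlinarith
  have hfold : ∀ (z : List Unit) (l : List Unit) (n : ℕ),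
      l.foldl (fun y x => s ((z, y), x)) ((List.range n).map unary) =
        (List.range (n + l.length)).map unary := by
    intro z l
    induction l with
    | nil => intro n; rfl
    | cons t l ih =>
      intro n
      rw [List.foldl_cons, List.length_cons, show n + (l.length + 1) = n + 1 + l.length by omega,
        ← ih, List.range_succ_eq_map]
      simp [s, List.map_map, Function.comp_def, unary, List.replicate_succ]
  have := foldl hs (.X + .X * (.X + .X + 1)) (fun z y l => by
    refine (hsize z l y).trans ?_
    have h₁ := length_le_list (fun s : List Unit => s) y
    have h₂ := length_le_list (fun a : Unit => [a]) l
    simp only [Polynomial.eval_add, Polynomial.eval_mul, Polynomial.eval_X, Polynomial.eval_one]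
    gcongr <;> omega) (fz := fun _ => []) (fy := fun _ => (List.range 1).map unary) (const _) (const _)
    (ofStr.comp hf)
  simp only [hfold, List.length_replicate] at this
  convert this using 4
  omega

end PT

/-! ### Tuples and coins inside single strings -/

section Encoding

/-- Cuts a string at the separators. -/
def splitNone {A : Type} : List (Option A) → List (List A)
  | [] => []
  | none :: l => [] :: splitNone l
  | some a :: l => match splitNone l with
    | [] => [[a]]
    | s :: ls => (a :: s) :: ls

theorem splitNone_append {A : Type} (s : List A) (l : List (Option A)) :
    splitNone (s.map some ++ none :: l) = s :: splitNone l := by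
  induction s with
  | nil => rfl
  | cons a s ih => rw [List.map_cons, List.cons_append, splitNone, ih]

theorem splitNone_tupleCode {A : Type} (u : List (List A)) : splitNone (tupleCode u) = u := by
  induction u with
  | nil => rfl
  | cons s u ih =>
    have : tupleCode (s :: u) = s.map some ++ none :: tupleCode u := list_cons (fun s => s) s u
    rw [this, splitNone_append, ih]

theorem PT.splitNone {A : Type} [Finite A] : PT (str (Option A)) (str A).list splitNone := by
  -- The state records an unfinished block, which receives the missing separator at the end of the
  -- input.
  let T : Transducer (Option A) (Option A) :=
    ⟨Bool, false, fun _ o => o.isSome, fun _ o => [o], fun q => if q then [none] else []⟩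
  refine PT.of_transducer (c := str (Option A)) T fun l => ?_
  have key : ∀ l : List (Option A), T.outFrom false l = listCode (fun s => s) (RationalProof.splitNone l) ∧
      T.outFrom true l = if l.isEmpty then [none] else
        listCode (fun s => s) (RationalProof.splitNone l) := by
    intro l
    induction l with
    | nil => exact ⟨rfl, rfl⟩
    | cons o l ih =>
      have : ∀ q, T.outFrom q (o :: l) = listCode (fun s => s) (RationalProof.splitNone (o :: l)) := by
        intro q
        cases o with
        | none => exact congrArg (none :: ·) ih.1
        | some a =>
          refine (congrArg (some a :: ·) ih.2).trans ?_
          cases l with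
          | nil => rfl
          | cons o' l =>
            obtain ⟨s, ls, e⟩ : ∃ s ls, RationalProof.splitNone (o' :: l) = s :: ls := by
              cases o' with
              | none => exact ⟨_, _, rfl⟩
              | some b =>
                simp only [RationalProof.splitNone]
                split
                · exact ⟨_, _, rfl⟩
                · exact ⟨_, _, rfl⟩
            rw [RationalProof.splitNone, e]
            rfl
      exact ⟨this _, this _⟩
  exact (key l).1.symm

variable {α : Type} (bit : Bool ↪ α)

/-- A tuple of strings as a string over the same alphabet. -/
def enc (u : List (List α)) : List α :=
  (tupleCode u).flatMap fun o => match o with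
    | some a => [bit true, a]
    | none => [bit false, bit false]

/-- Reads pairs of symbols as symbols of a tuple code. -/
noncomputable def decSymbols : List α → List (Option α)
  | a :: b :: l => (open Classical in if a = bit true then some b else none) :: decSymbols l
  | _ => []

/-- The inverse of `enc`. -/
noncomputable def dec (s : List α) : List (List α) := splitNone (decSymbols bit s)

theorem dec_enc (u : List (List α)) : dec bit (enc bit u) = u := by
  have : ∀ s : List (Option α), decSymbols bit (s.flatMap fun o => match o with
    | some a => [bit true, a]
    | none => [bit false, bit false]) = s := by
    intro s
    induction s with
    | nil => rfl
    | cons o s ih => cases o <;> simp [decSymbols, ih]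
  rw [dec, enc, this, splitNone_tupleCode]

variable [Finite α]

theorem PT.enc : PT (str α).list (str α) (enc bit) :=
  PT.of_flatMap (c := (str α).list) (d := str α) _ [] fun _ => (List.append_nil _).symm

theorem PT.dec : PT (str α) (str α).list (dec bit) := by
  classical
  refine PT.splitNone.comp ?_
  let T : Transducer α (Option α) :=
    ⟨Option α, none, fun q a => if q.isSome then none else some a,
      fun q a => q.elim [] fun b => [if b = bit true then some a else none], fun _ => []⟩
  refine PT.of_transducer (c := str α) T fun l => ?_
  induction l using decSymbols.induct with
  | case1 a b l ih =>
    refine Eq.trans ?_ (congrArg ((if a = bit true then some b else none) :: ·) ih)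
    simp [decSymbols]
  | case2 l h =>
    rcases l with _ | ⟨a, _ | ⟨b, l⟩⟩
    · rfl
    · rfl
    · exact absurd rfl (h a b l)

/-- Together with `to_pairCode` this translates between the separator coding in the definition of
oracle computations and the sum coding of the calculus. -/
theorem PT.of_pairCode {X : Type} {d : Cod X} {f : List (List α) × List (List α) → X}
    (h : PolyTime pairCode d.code f) : PT ((str α).list.prod (str α).list) d f := by
  refine polyTime_comp (f := fun p => p) (cY := pairCode) ?_ h
  let T : Transducer (Option α ⊕ Option α) (Option (Option α)) :=
    ⟨Bool, false, fun q s => q || s.isRight,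
      fun q s => Sum.elim (fun a => [some a]) (fun a => if q then [some a] else [none, some a]) s,
      fun q => if q then [] else [none]⟩
  refine polyTime_transduce T fun p => ?_
  rw [prod_code, prodCode, Transducer.out, PT.outFrom_block T _ _ (fun a => [some a]) _ _
    (fun _ => rfl) (fun _ => rfl), pairCode, ← List.map_eq_flatMap]
  congr 1
  change none :: List.map some (tupleCode p.2) = T.outFrom false (List.map Sum.inr (tupleCode p.2))
  cases tupleCode p.2 with
  | nil => rfl
  | cons a l =>
    change _ = none :: some a :: T.outFrom true (List.map Sum.inr l)
    rw [← List.append_nil (List.map Sum.inr l), PT.outFrom_block T _ _ (fun a => [some a]) _ _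
      (fun _ => rfl) (fun _ => rfl), ← List.map_eq_flatMap]
    simp [T, Transducer.outFrom]

theorem PT.to_pairCode {X : Type} {d : Cod X} {f : List (List α) × List (List α) → X}
    (h : PT ((str α).list.prod (str α).list) d f) : PolyTime pairCode d.code f := by
  refine polyTime_comp (f := fun p => p) (cY := ((str α).list.prod (str α).list).code) ?_ h
  let T : Transducer (Option (Option α)) (Option α ⊕ Option α) :=
    ⟨Bool, false, fun q s => q || s.isNone,
      fun q s => s.elim [] fun a => if q then [Sum.inr a] else [Sum.inl a], fun q => []⟩
  refine polyTime_transduce T fun p => ?_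
  rw [prod_code, prodCode, Transducer.out, pairCode, PT.outFrom_block T _ _ (fun a => [Sum.inl a])
    _ _ (fun _ => rfl) (fun _ => rfl), ← List.map_eq_flatMap]
  congr 1
  change _ = T.outFrom true (List.map some (tupleCode p.2))
  rw [← List.append_nil (List.map some _), PT.outFrom_block T _ _ (fun a => [Sum.inr a]) _ _
    (fun _ => rfl) (fun _ => rfl), ← List.map_eq_flatMap]
  simp [T, Transducer.outFrom]
  rfl

end Encoding

section Bits

variable {A : Type}

/-- The `s`-th block of length `l`. -/
def slice (l s : ℕ) (w : List A) : List A := (w.drop (s * l)).take l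

theorem slice_ofFn {n l s : ℕ} (f : Fin n → A) (h : s * l + l ≤ n) :
    slice l s (List.ofFn f) = List.ofFn fun q : Fin l => f ⟨s * l + q, by omega⟩ := by
  refine List.ext_getElem ?_ fun i h₁ h₂ => ?_
  · simp [slice]
    omega
  · simp [slice]

theorem PT.slice {W : Type} [Finite A] {w : Cod W} {f : W → ℕ} {g : W → List A} (s : ℕ)
    (hf : PT w (str Unit) fun x => unary (f x)) (hg : PT w (str A) g) :
    PT w (str A) (fun x => slice (f x) s (g x)) :=
  takeStr hf (dropStr (unaryMul (unaryConst s) hf) hg)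

variable {α : Type} (bit : Bool ↪ α)

/-- Turns every string into a string of `l` bits. -/
noncomputable def toBits (l : ℕ) (s : List α) : List α :=
  ((s.map fun a => bit (open Classical in decide (a = bit true))) ++
    List.replicate l (bit false)).take l

theorem toBits_ofFn {l : ℕ} (f : Fin l → Bool) :
    toBits bit l (List.ofFn fun s => bit (f s)) = List.ofFn fun s => bit (f s) := by
  rw [toBits, List.take_append_of_le_length (by simp), List.take_of_length_le (by simp)]
  rw [List.map_ofFn]
  congr 1
  funext s
  simp

/-- Even a malformed string is read as legitimate coins; so every query describes a history that
really occurs. -/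
theorem exists_toBits (l : ℕ) (s : List α) :
    ∃ f : Fin l → Bool, toBits bit l s = List.ofFn fun s => bit (f s) := by
  classical
  refine ⟨fun i => decide ((toBits bit l s)[i]'(by simp [toBits]) = bit true), ?_⟩
  refine List.ext_getElem (by simp [toBits]) fun i h₁ h₂ => ?_
  rw [List.getElem_ofFn]
  simp only [toBits, List.getElem_take, List.getElem_append, Fin.getElem_fin, List.getElem_map]
  split <;> simp

theorem PT.toBits {W : Type} [Finite α] {w : Cod W} {f : W → ℕ} {g : W → List α}
    (hf : PT w (str Unit) fun x => unary (f x)) (hg : PT w (str α) g) :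
    PT w (str α) (fun x => toBits bit (f x) (g x)) := by
  refine takeStr hf (appendStr ((mapStr _).comp hg) ?_)
  have := (mapStr (fun _ : Unit => bit false)).comp hf
  simpa using this

end Bits

end RationalProof

/-! ### Games that copy rounds of other games -/

namespace RationalProof

namespace Game

variable {S : Type}

theorem mem_cons_iff_run {G : Game S} {h : List (S × S)} {r : G.C} {ms : ℕ → S}
    (hms : ∀ s (hs : s < h.length), ms s = h[s].1) : r ∈ G.cons h ↔ G.run ms r h.length = h := by
  constructor
  · intro H
    induction h using List.reverseRecOn with
    | nil => rfl
    | append_singleton h p ih =>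
      obtain ⟨m, a⟩ := p
      obtain ⟨h₁, h₂⟩ := mem_cons_append.1 H
      have e := ih (fun s hs => by
        rw [hms s (by simp; omega), List.getElem_append_left hs]) h₁
      have e' : ms h.length = m := by simpa using hms h.length (by simp)
      rw [List.length_append, List.length_singleton, run, e, e', h₂]
  · intro H
    rw [← H]
    exact mem_cons_run ms r h.length

theorem cons_nil (G : Game S) : G.cons [] = Finset.univ := by
  ext r
  simp [mem_cons]

/-- The first `j` rounds of the game `G'` copy the rounds of the game `G` that follow the
history `H`. The coins of `G'` determine those of `G` and an independent element of `Θ`. -/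
structure Cover (G' G : Game S) (j : ℕ) (Θ : Type) [Fintype Θ] where
  H : List (S × S)
  μ : S → S
  π : G'.C → G.C
  θ : G'.C → Θ
  c : ℚ
  c_pos : 0 < c
  sum_eq : ∀ F : G.C → Θ → ℚ, ∑ r, F (π r) (θ r) = c * ∑ r, ∑ t, F r t
  mem : ∀ m, μ m ∈ G.M
  reply_eq : ∀ h m r, h.length < j →
    G'.reply h m r = G.reply (H ++ h.map fun p => (μ p.1, p.2)) (μ m) (π r)

namespace Cover

variable {G' G : Game S} {j : ℕ} {Θ : Type} [Fintype Θ] (K : Cover G' G j Θ)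

/-- The history in `G`. -/
def η (h : List (S × S)) : List (S × S) := K.H ++ h.map fun p => (K.μ p.1, p.2)

theorem η_append (h : List (S × S)) (m a : S) : K.η (h ++ [(m, a)]) = K.η h ++ [(K.μ m, a)] := by
  simp [η]

theorem length_η (h : List (S × S)) : (K.η h).length = K.H.length + h.length := by simp [η]

/-- Compatibility with the prolonged history splits into compatibility with the prefix `H` and with
the rounds actually played. -/
theorem mem_cons {h : List (S × S)} (hh : h.length ≤ j) {r : G'.C} :
    K.π r ∈ G.cons (K.η h) ↔ r ∈ G'.cons h ∧ K.π r ∈ G.cons K.H := by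
  induction h using List.reverseRecOn with
  | nil => simp [η, cons_nil]
  | append_singleton h p ih =>
    obtain ⟨m, a⟩ := p
    rw [List.length_append, List.length_singleton] at hh
    rw [η_append, mem_cons_append, mem_cons_append, ih (by omega), K.reply_eq h m r (by omega)]
    exact and_right_comm

/-- Paying 0 on coins that do not fit `H` restricts the sum to coins fitting the whole history `η
h`: this is conditioning by rejection. By `sum_eq`, passing between the two coin spaces costs only
the factor `c`. -/
theorem tot_zero {h : List (S × S)} (hh : h.length ≤ j) {F : G.C → Θ → ℚ}
    (h₁ : ∀ r ∈ G'.cons h, K.π r ∈ G.cons K.H → G'.rew h r = F (K.π r) (K.θ r))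
    (h₀ : ∀ r ∈ G'.cons h, K.π r ∉ G.cons K.H → G'.rew h r = 0) :
    G'.tot 0 h = K.c * ∑ r ∈ G.cons (K.η h), ∑ t, F r t := by
  classical
  rw [Game.tot_zero, ← Finset.sum_filter_add_sum_filter_not _ fun r => K.π r ∈ G.cons K.H]
  rw [Finset.sum_eq_zero (s := Finset.filter (fun r => ¬ _) _), add_zero]
  · have := K.sum_eq fun r t => if r ∈ G.cons (K.η h) then F r t else 0
    simp only [Finset.sum_ite_irrel, Finset.sum_const_zero, K.mem_cons hh,
      Finset.sum_ite_mem, Finset.univ_inter] at this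
    rw [← this, ← Finset.sum_filter]
    refine Finset.sum_congr ?_ fun r hr => ?_
    · ext r
      simp
    · obtain ⟨-, hr, hr'⟩ := Finset.mem_filter.1 hr
      exact h₁ r hr hr'
  · intro r hr
    obtain ⟨hr, hr'⟩ := Finset.mem_filter.1 hr
    exact h₀ r hr hr'

theorem run_eq (hH : K.H = []) (ms : ℕ → S) (r : G'.C) {t : ℕ} (ht : t ≤ j) :
    G.run (fun s => K.μ (ms s)) (K.π r) t = K.η (G'.run ms r t) := by
  induction t with
  | zero => rw [η, hH]; rfl
  | succ t ih =>
    rw [run, run, η_append, ih (by omega), K.reply_eq _ _ _ (by rw [length_run]; omega)]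
    rfl

theorem abs_totMsg_sub_le {c ε : ℚ} (hc : 0 ≤ c) {i : ℕ} {Good : List (S × S) → Prop}
    (hμ : ∀ m ∈ G.M, ∃ m' ∈ G'.M, K.μ m' = m) (good : ∀ h m a, Good h → Good (h ++ [(m, a)]))
    (base : ∀ h, h.length = j → Good h →
      |G'.tot 0 h - c * G.tot i (K.η h)| ≤ ε * (G.cons (K.η h)).card)
    {n : ℕ} {h : List (S × S)} {m : S} (hn : h.length + 1 + n = j)
    (hh : ∀ a, Good (h ++ [(m, a)])) :
    |G'.totMsg n h m - c * G.totMsg (n + i) (K.η h) (K.μ m)| ≤ ε * (G.cons (K.η h)).card := by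
  refine Game.abs_totMsg_sub_le fun a => ?_
  rw [← η_append]
  refine abs_tot_sub_le (η := K.η) (μ := K.μ) (Good := fun n h => h.length + n = j ∧ Good h) hc
    K.η_append (fun m _ => K.mem m) hμ ?_ (fun h hh => base h hh.1 hh.2) n _ ⟨?_, hh a⟩
  · rintro n h m a ⟨h₁, h₂⟩ -
    exact ⟨by rw [List.length_append, List.length_singleton]; omega, good _ _ _ h₂⟩
  · rw [List.length_append, List.length_singleton]
    omega

/-- If the final positions of `G'` have approximately the values of the corresponding positions of
`G`, then rational play in `G'` is rational play in `G`. -/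
theorem rationalTo (hH : K.H = []) {c ε : ℚ} (hc : 0 < c) {i : ℕ}
    (hμ : ∀ m ∈ G.M, ∃ m' ∈ G'.M, K.μ m' = m)
    (base : ∀ h, h.length = j →
      |G'.tot 0 h - c * G.tot i (K.η h)| ≤ ε * (G.cons (K.η h)).card)
    (gap : ∀ n h m m', (K.η h).length + 1 + n = j + i → m' ∈ G.M →
      c * (G.totMsg n (K.η h) m' - G.totMsg n (K.η h) (K.μ m)) ≤
        2 * (ε * (G.cons (K.η h)).card) →
      G.totMsg n (K.η h) m' ≤ G.totMsg n (K.η h) (K.μ m))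
    {ms : ℕ → S} {r : G'.C} (hr : G'.RationalTo j j ms r) :
    G.RationalTo (j + i) j (fun s => K.μ (ms s)) (K.π r) := by
  intro t ht
  have hbest := hr t ht
  have hcons : K.π r ∈ G.cons (K.η (G'.run ms r t)) := by
    rw [← K.run_eq hH ms r ht.le]
    exact mem_cons_run _ _ t
  have hlen := length_run (G := G') ms r t
  rw [K.run_eq hH ms r ht.le, show j + i - 1 - t = (j - 1 - t) + i by omega]
  generalize G'.run ms r t = h at *
  have key := fun m => K.abs_totMsg_sub_le hc.le (n := j - 1 - t) (h := h) (m := m)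
    (Good := fun _ => True) hμ (fun _ _ _ _ => trivial) (fun h h₁ _ => base h h₁)
    (by omega) fun _ => trivial
  refine ⟨K.mem _, fun m hm => ?_⟩
  obtain ⟨m', hm', rfl⟩ := hμ m hm
  -- Expected rewards are compared after multiplication by the number of compatible coins, which is
  -- positive because the run itself uses such coins.
  refine le_of_mul_le_mul_left ?_ (card_cons_pos hcons)
  refine gap _ h _ _ (by rw [K.length_η, hH, List.length_nil]; omega) hm ?_
  have h₁ := (abs_sub_le_iff.1 (key m')).2
  have h₂ := (abs_sub_le_iff.1 (key (ms t))).1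
  have h₃ : G'.totMsg (j - 1 - t) h m' ≤ G'.totMsg (j - 1 - t) h (ms t) :=
    mul_le_mul_of_nonneg_left (hbest.2 m' hm') (Nat.cast_nonneg _)
  -- Each of the two messages contributes one error, which is why `gap` allows for twice the error.
  linarith

/-- If the reward depends on a bit in Merlin's first message, then that bit is chosen such that the
optimal reward is larger. -/
theorem claim_eq {claim : S → Bool} {f : Bool → List (S × S) → G.C → ℚ} {c : ℚ} (hc : 0 < c)
    (hμ : ∀ b, ∀ m ∈ G.M, ∃ m' ∈ G'.M, claim m' = b ∧ K.μ m' = m)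
    (base : ∀ h m a h', h = (m, a) :: h' → h.length = j →
      G'.tot 0 h = c * (G.withRew (f (claim m))).tot 0 (K.η h))
    {b : Bool} {n : ℕ} (hn : n + 1 = j) (hH : (G.cons K.H).Nonempty)
    (hlt : (G.withRew (f !b)).opt j K.H < (G.withRew (f b)).opt j K.H)
    {m : S} (hm : G'.Best n [] m) : claim m = b := by
  subst hn
  have hη : K.η [] = K.H := by simp [η]
  have key : ∀ m, G'.totMsg n [] m =
      c * (G.withRew (f (claim m))).totMsg n K.H (K.μ m) := by
    intro m
    -- Once the claim is fixed, so is the reward of the covered game. On histories whose first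
    -- message makes this claim the comparison is exact, with ε = 0.
    let K' : Cover G' (G.withRew (f (claim m))) (n + 1) Θ :=
      ⟨K.H, K.μ, K.π, K.θ, K.c, K.c_pos, K.sum_eq, K.mem, K.reply_eq⟩
    have := K'.abs_totMsg_sub_le hc.le (ε := 0) (i := 0) (n := n) (h := []) (m := m)
      (Good := fun h => ∃ m' a h', claim m' = claim m ∧ h = (m', a) :: h')
      (fun m hm => (hμ true m hm).imp fun _ h => ⟨h.1, h.2.2⟩)
      (by
        rintro h m' a ⟨m₁, a₁, h', h₁, rfl⟩
        exact ⟨m₁, a₁, _, h₁, List.cons_append⟩)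
      (by
        rintro h hl ⟨m₁, a₁, h', h₁, h₂⟩
        have := base h m₁ a₁ h' h₂ hl
        rw [h₁] at this
        rw [this]
        exact (by simp : ∀ x y : ℚ, |c * x - c * x| ≤ 0 * y) _ _) (by simp; omega)
      (fun a => ⟨m, a, [], rfl, rfl⟩)
    rw [zero_mul, abs_nonpos_iff, sub_eq_zero] at this
    rw [this]
    change c * (G.withRew (f (claim m))).totMsg n (K.η []) (K.μ m) = _
    rw [hη]
  by_contra hne
  replace hne : claim m = !b := by cases b <;> simpa using hne
  obtain ⟨m₀, hm₀, e₀⟩ := (G.withRew (f b)).exists_best n K.H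
  obtain ⟨m', hm', e₁, e₂⟩ := hμ b m₀ hm₀.1
  obtain ⟨r, hr⟩ := hH
  have hpos := card_cons_pos hr
  have h₁ : G'.totMsg n [] m' ≤ G'.totMsg n [] m :=
    mul_le_mul_of_nonneg_left (hm.2 m' hm') (Nat.cast_nonneg _)
  rw [key, key, e₁, e₂, hne] at h₁
  have h₂ := le_of_mul_le_mul_left (le_of_mul_le_mul_left h₁ hc) hpos
  have h₃ := h₂.trans (msg_le_opt (G := G.withRew (f !b)) (n := n) (K.mem m))
  exact absurd hlt (not_lt.2 (e₀.ge.trans h₃))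

end Cover

end Game

/-- Restriction of functions along an injection has fibers of constant size. -/
theorem exists_sum_comp_eq {I J : Type} [Fintype I] [Fintype J] [DecidableEq I] [DecidableEq J]
    {e : I → J} (he : Function.Injective e) :
    ∃ c : ℚ, 0 < c ∧ ∀ F : (I → Bool) → ℚ, ∑ f : J → Bool, F (f ∘ e) = c * ∑ g, F g := by
  classical
  let R := ((Set.range e)ᶜ : Set J)
  let E : (J → Bool) ≃ (I → Bool) × (R → Bool) :=
    (((Equiv.ofInjective e he).sumCongr (Equiv.refl R)).trans
      (Equiv.Set.sumCompl (Set.range e))).symm.arrowCongr (Equiv.refl Bool) |>.trans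
      (Equiv.sumArrowEquivProdArrow I R Bool)
  have hE : ∀ f, (E f).1 = f ∘ e := fun f => rfl
  refine ⟨Fintype.card (R → Bool), by exact_mod_cast Fintype.card_pos, fun F => ?_⟩
  simp only [← hE]
  rw [E.sum_comp (fun p => F p.1), Fintype.sum_prod_type]
  simp [Finset.mul_sum]

end RationalProof

namespace RationalProof

open Machine Cod

/-! ### Simulating rounds of a protocol -/

section Tuples

variable {α : Type}

theorem History.length_flat (h : History α) : h.flat.length = 2 * h.length := by
  induction h with
  | nil => rfl
  | cons p h ih =>
    change (p.1 :: p.2 :: History.flat h).length = _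
    simp only [List.length_cons, ih]
    omega

theorem History.flat_getElem? (h : History α) (t : ℕ) :
    h.flat[2 * t]? = h[t]?.map Prod.fst ∧ h.flat[2 * t + 1]? = h[t]?.map Prod.snd := by
  induction h generalizing t with
  | nil => simp [History.flat]
  | cons p h ih =>
    change (p.1 :: p.2 :: History.flat h)[2 * t]? = _ ∧ (p.1 :: p.2 :: History.flat h)[2 * t + 1]? = _
    cases t with
    | zero => simp
    | succ t => simpa [Nat.mul_add] using ih t

/-- The pairs in a flat tuple. -/
def pairsOf (n : ℕ) (u : List (List α)) : History α :=
  (List.range n).map fun s => (u.getD (2 * s) [], u.getD (2 * s + 1) [])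

theorem pairsOf_flat (h : History α) (v : List (List α)) : pairsOf h.length (h.flat ++ v) = h := by
  refine List.ext_getElem (by simp [pairsOf]) fun t h₁ h₂ => ?_
  have := h.flat_getElem? t
  rw [List.getElem?_eq_getElem h₂] at this
  have hl := h.length_flat
  simp only [pairsOf, List.getElem_map, List.getElem_range, List.getD_eq_getElem?_getD]
  rw [List.getElem?_append_left (by omega), List.getElem?_append_left (by omega), this.1, this.2]
  rfl

variable [Finite α]

theorem PT.historyFlat : PT ((str α).prod (str α)).list (str α).list History.flat :=
  PT.flatMap (PT.cons PT.fst (PT.singleton.comp PT.snd))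

theorem PT.pairsOf (n : ℕ) : PT (str α).list ((str α).prod (str α)).list (pairsOf n) :=
  PT.mapRange n fun s => PT.pair (PT.getD (2 * s) []) (PT.getD (2 * s + 1) [])

/-- A function on inputs `(x; m₁, a₁, …, aₙ, m; r₁, …, rₙ₊₁)` with `n` bounded, given by functions of
the parts of the input. -/
def byRound {X : Type} (F : ℕ → List α × History α × List α × List (List α) → X) :
    ℕ → List (List α) → X
  | 0, u => F 0 (u.headD [], [], u.getD 1 [], u.drop 2)
  | n + 1, u => if (u.drop (3 * n + 3)).isEmpty then byRound F n u else
      F (n + 1) (u.headD [], pairsOf (n + 1) u.tail, u.getD (2 * n + 3) [], u.drop (2 * n + 4))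

-- Arthur is not told the number of the round, but after n rounds his input has exactly 3n + 3
-- entries, so the length reveals it.
omit [Finite α] in
theorem byRound_eq {X : Type} (F : ℕ → List α × History α × List α × List (List α) → X) {n : ℕ}
    {x m : List α} {h : History α} {rs : List (List α)} (hn : h.length ≤ n)
    (hrs : rs.length = h.length + 1) :
    byRound F n (x :: (h.flat ++ m :: rs)) = F h.length (x, h, m, rs) := by
  have hl := h.length_flat
  induction n with
  | zero =>
    obtain rfl : h = [] := List.length_eq_zero_iff.1 (by omega)
    rfl
  | succ n ih =>
    rw [byRound]
    rcases Nat.le_succ_iff.1 hn with hn | hn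
    · rw [if_pos, ih hn]
      rw [List.isEmpty_iff, List.drop_eq_nil_iff]
      simp
      omega
    · obtain rfl : n = h.length - 1 := by omega
      rw [if_neg, List.tail_cons, show h.length - 1 + 1 = h.length by omega, pairsOf_flat]
      · congr 4
        · rw [show 2 * (h.length - 1) + 3 = (h.flat.length + 0) + 1 by omega, List.getD_cons_succ,
            List.getD_append_right _ _ _ _ (by omega)]
          simp
        · rw [show 2 * (h.length - 1) + 4 = (h.flat.length + 1) + 1 by omega, List.drop_succ_cons,
            List.drop_append]
          simp
      · rw [List.isEmpty_iff, List.drop_eq_nil_iff]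
        simp
        omega

theorem PT.byRound {X : Type} {d : Cod X} {F : ℕ → List α × History α × List α × List (List α) → X}
    (hF : ∀ n, PT ((str α).prod (((str α).prod (str α)).list.prod ((str α).prod (str α).list))) d
      (F n)) (n : ℕ) : PT (str α).list d (byRound F n) := by
  induction n with
  | zero => exact (hF 0).comp ((PT.headD []).pair ((PT.const []).pair ((PT.getD 1 []).pair (PT.drop 2))))
  | succ n ih =>
    exact PT.ite (PT.isEmpty.comp (PT.drop _)) ih ((hF (n + 1)).comp ((PT.headD []).pair
      (((PT.pairsOf _).comp PT.tail).pair ((PT.getD _ []).pair (PT.drop _)))))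

end Tuples

namespace Protocol

section Game

variable {α : Type} [Finite α] (P : Protocol α) (bit : Bool ↪ α) (k : ℕ) (x : List α)

/-- The game played by Merlin on a given input. -/
@[reducible]
noncomputable def game : Game (List α) where
  C := P.Coins k x
  reply := P.reply bit k x
  M := P.messages x
  nonempty := P.messages_nonempty x
  rew h r := binFrac (P.R (P.rewardInput bit k x h r))

theorem consistentCoins_eq (h : History α) :
    P.consistentCoins bit k x h = (P.game bit k x).cons h := by
  ext r
  rw [Game.mem_cons]
  simp [consistentCoins]

theorem optReward_eq (n : ℕ) : ∀ h, P.optReward bit k x n h = (P.game bit k x).opt n h := by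
  induction n with
  | zero =>
    intro h
    rw [optReward, Game.opt, consistentCoins_eq]
  | succ n ih =>
    intro h
    simp only [optReward, Game.opt, ih, consistentCoins_eq]

theorem msgReward_eq (n : ℕ) (h : History α) (m : List α) :
    P.msgReward bit k x n h m = (P.game bit k x).msg n h m := by
  simp only [msgReward, Game.msg, optReward_eq, consistentCoins_eq]

theorem run_eq (ms : ℕ → List α) (r : P.Coins k x) (t : ℕ) :
    P.run bit k x ms r t = (P.game bit k x).run ms r t := by
  induction t with
  | zero => rfl
  | succ t ih => rw [run, Game.run, ih]

theorem rationalRun_iff {ms : ℕ → List α} {r : P.Coins k x} :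
    P.RationalRun bit k x ms r ↔ (P.game bit k x).RationalTo k k ms r := by
  simp only [RationalRun, Game.RationalTo, Game.Best, msgReward_eq, run_eq]

theorem computes_iff {f : List α → List α} : P.Computes bit k f ↔ (∀ u, binFrac (P.R u) ≤ 1) ∧
    ∀ x ms (r : P.Coins k x), (P.game bit k x).RationalTo k k ms r →
      f x = P.φ (valueInput x ((P.game bit k x).run ms r k)) := by
  simp only [Computes, rationalRun_iff, run_eq]

theorem mem_messages {m : List α} : m ∈ P.messages x ↔ m.length ≤ P.msgLen.eval x.length := by
  simp [messages]

variable {k x}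

end Game

section History

variable {α : Type} (P : Protocol α) (x : List α) (ms : ℕ → List α) (rs : List (List α))

/-- The history that results when Merlin sends `ms 0, ms 1, …` and Arthur has the random strings
`rs`. -/
def history : ℕ → History α
  | 0 => []
  | t + 1 => history t ++ [(ms t, P.V (x :: ((history t).flat ++ ms t :: rs.take (t + 1))))]

theorem length_history (t : ℕ) : (P.history x ms rs t).length = t := by
  induction t with
  | zero => rfl
  | succ t ih => simp [history, ih]

theorem history_eq_run [Finite α] {bit : Bool ↪ α} {k : ℕ} (r : P.Coins k x) (t : ℕ) :
    P.history x ms (P.coinStrings bit r) t = (P.game bit k x).run ms r t := by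
  induction t with
  | zero => rfl
  | succ t ih =>
    have := Game.length_run (G := P.game bit k x) ms r t
    rw [history, Game.run, ih]
    change _ = _ ++ [(ms t, P.V (P.arthurInput bit k x _ _ r))]
    rw [arthurInput, this]

theorem _root_.RationalProof.PT.history [Finite α] {W : Type} {w : Cod W}
    (hV : PT (str α).list (str α) P.V) {x : W → List α} {ms : W → ℕ → List α}
    {rs : W → List (List α)} (hx : PT w (str α) x) (hms : ∀ s, PT w (str α) fun u => ms u s)
    (hrs : PT w (str α).list rs) (t : ℕ) :
    PT w ((str α).prod (str α)).list fun u => P.history (x u) (ms u) (rs u) t := by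
  induction t with
  | zero => exact PT.nil
  | succ t ih =>
    refine PT.append ih (PT.singleton.comp (PT.pair (hms t) (hV.comp (PT.cons hx
      (PT.append (PT.historyFlat.comp ih) (PT.cons (hms t) ((PT.take _).comp hrs)))))))

end History

end Protocol

/-- The data of a protocol that simulates the rounds `i, i + 1, …` of the protocol `P` on an input
and with a history that are computed from the new input. Every message of the new protocol starts
with an additional symbol, and all of Arthur's coins are in his first random string. -/
structure Simulation (α : Type) [Finite α] where
  P : Protocol α
  X : List α → List α
  H : List α → History α
  i : ℕ
  length_H : ∀ ξ, (H ξ).length = i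
  polyTime_V : PT (str α).list (str α) P.V
  polyTime_X : PT (str α) (str α) X
  polyTime_H : PT (str α) ((str α).prod (str α)).list H

namespace Simulation

variable {α : Type} [Finite α] (S : Simulation α) (ξ : List α)

/-- The length of the random strings of `P`. -/
def coinLen : ℕ := S.P.coinLen.eval (S.X ξ).length

/-- The message of `P` in a message. -/
def μ (m : List α) : List α := m.tail.take (S.P.msgLen.eval (S.X ξ).length)

/-- The random strings of `P` in the first random string. -/
def coins (n : ℕ) (s : List α) : List (List α) :=
  (List.range n).map fun t => slice (S.coinLen ξ) t s

/-- The messages of `P` in the tuple `(ξ; m₁, r₁, …, mⱼ, rⱼ)`. -/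
def ms (u : List (List α)) (t : ℕ) : List α :=
  if t < S.i then ((S.H (u.headD [])).getD t ([], [])).1 else
    S.μ (u.headD []) (u.getD (2 * (t - S.i) + 1) [])

/-- The random strings of `P` in the tuple `(ξ; m₁, r₁, …, mⱼ, rⱼ)`. -/
def rs (k : ℕ) (u : List (List α)) : List (List α) := S.coins (u.headD []) k (u.getD 2 [])

/-- Arthur's answers. -/
def V (j : ℕ) : List (List α) → List α :=
  byRound (fun n p => S.P.V (S.X p.1 :: ((S.H p.1 ++ p.2.1.map fun q => (S.μ p.1 q.1, q.2)).flat ++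
    S.μ p.1 p.2.2.1 :: S.coins p.1 (S.i + n + 1) (p.2.2.2.headD [])))) j

/-- The input of the reward function of `P`. -/
def rewardInput (k n : ℕ) (u : List (List α)) : List (List α) :=
  S.X (u.headD []) :: ((List.range n).map fun t => [S.ms u t, (S.rs k u).getD t []]).flatten

/-- The history of `P`. -/
def history (k n : ℕ) (u : List (List α)) : History α :=
  S.P.history (S.X (u.headD [])) (S.ms u) (S.rs k u) n

section PolyTime

variable {W : Type} {w : Cod W}

theorem polyTime_unary_comp (p : Polynomial ℕ) {f : W → List α} (hf : PT w (str α) f) :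
    PT w (str Unit) fun u => PT.unary (p.eval (S.X (f u)).length) :=
  PT.unaryPoly p (PT.codeLength.comp (S.polyTime_X.comp hf))

theorem polyTime_μ {f g : W → List α} (hf : PT w (str α) f) (hg : PT w (str α) g) :
    PT w (str α) fun u => S.μ (f u) (g u) :=
  PT.takeStr (S.polyTime_unary_comp _ hf) (PT.tailStr.comp hg)

theorem polyTime_coins (n : ℕ) {f g : W → List α} (hf : PT w (str α) f) (hg : PT w (str α) g) :
    PT w (str α).list fun u => S.coins (f u) n (g u) :=
  PT.mapRange n fun t => PT.slice t (S.polyTime_unary_comp _ hf) hg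

theorem polyTime_ms (t : ℕ) : PT (str α).list (str α) fun u => S.ms u t := by
  unfold ms
  split
  · exact PT.fst.comp ((PT.getD t ([], [])).comp (S.polyTime_H.comp (PT.headD [])))
  · exact S.polyTime_μ (PT.headD []) (PT.getD _ [])

theorem polyTime_rs (k : ℕ) : PT (str α).list (str α).list (S.rs k) :=
  S.polyTime_coins k (PT.headD []) (PT.getD 2 [])

theorem polyTime_rewardInput (k n : ℕ) : PT (str α).list (str α).list (S.rewardInput k n) :=
  PT.cons (S.polyTime_X.comp (PT.headD [])) (PT.flatten.comp (PT.mapRange n fun t =>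
    PT.cons (S.polyTime_ms t) (PT.singleton.comp ((PT.getD t []).comp (S.polyTime_rs k)))))

theorem polyTime_history (k n : ℕ) :
    PT (str α).list ((str α).prod (str α)).list (S.history k n) :=
  PT.history S.P S.polyTime_V (S.polyTime_X.comp (PT.headD [])) S.polyTime_ms (S.polyTime_rs k) n

theorem polyTime_V' (j : ℕ) : PT (str α).list (str α) (S.V j) := by
  refine PT.byRound (F := fun n p => _) (fun n => S.polyTime_V.comp ?_) j
  have h₂ := PT.snd (c := str α) (d := ((str α).prod (str α)).list.prod ((str α).prod (str α).list))
  refine PT.cons (S.polyTime_X.comp PT.fst) (PT.append (PT.historyFlat.comp (PT.append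
    (S.polyTime_H.comp PT.fst) ?_)) (PT.cons ?_ ?_))
  · exact PT.map (v := str α) (c := (str α).prod (str α)) (d := (str α).prod (str α))
      (f := fun p => (S.μ p.1 p.2.1, p.2.2))
      (PT.pair (S.polyTime_μ PT.fst (PT.fst.comp PT.snd)) (PT.snd.comp PT.snd)) PT.fst
      (PT.fst.comp h₂)
  · exact S.polyTime_μ PT.fst (PT.fst.comp (PT.snd.comp h₂))
  · exact S.polyTime_coins _ PT.fst ((PT.headD []).comp (PT.snd.comp (PT.snd.comp h₂)))

end PolyTime

end Simulation

end RationalProof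

/-! ### Correctness of the simulation -/

namespace RationalProof

open Machine Cod

/-- The k blocks of length l and the g spare positions are disjoint places in the first random
string. Restriction to them is along an injection, so it has fibers of constant size; the later
random strings only enlarge the fibers. -/
theorem exists_sum_coins_eq {j k l l' g : ℕ} (hj : 0 < j) (h : k * l + g ≤ l')
    (h₁ : ∀ (t : Fin k) (q : Fin l), t * l + q < l') :
    ∃ c : ℚ, 0 < c ∧ ∀ F : (Fin k → Fin l → Bool) → (Fin g → Bool) → ℚ,
      ∑ r : Fin j → Fin l' → Bool, F (fun t q => r ⟨0, hj⟩ ⟨t * l + q, h₁ t q⟩)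
        (fun q => r ⟨0, hj⟩ ⟨k * l + q, by omega⟩) = c * ∑ r, ∑ t, F r t := by
  let e : (Fin k × Fin l) ⊕ Fin g → Fin j × Fin l' :=
    Sum.elim (fun p => (⟨0, hj⟩, ⟨p.1 * l + p.2, h₁ p.1 p.2⟩))
      fun q => (⟨0, hj⟩, ⟨k * l + q, by omega⟩)
  have hlt : ∀ (t : Fin k) (q : Fin l), (t * l + q : ℕ) < k * l := fun t q => by
    have : (t : ℕ) + 1 ≤ k := t.2
    nlinarith [q.2, Nat.mul_le_mul_right l this]
  have he : Function.Injective e := by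
    rintro (⟨t, q⟩ | q) (⟨t', q'⟩ | q') h <;>
      simp only [e, Sum.elim_inl, Sum.elim_inr, Prod.mk.injEq, Fin.mk.injEq, true_and] at h
    · have hl : 0 < l := by have := q.2; omega
      -- Division by `l` recovers the number of the block.
      have h₂ : (t : ℕ) = t' := by
        have := congrArg (· / l) h
        simpa [Nat.mul_comm _ l, Nat.mul_add_div hl, Nat.div_eq_of_lt q.2,
          Nat.div_eq_of_lt q'.2] using this
      rw [h₂] at h
      obtain rfl := Fin.ext h₂
      obtain rfl : q = q' := Fin.ext (by omega)
      rfl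
    · have := hlt t q
      omega
    · have := hlt t' q'
      omega
    · obtain rfl : q = q' := Fin.ext (by omega)
      rfl
  obtain ⟨c, hc, H⟩ := exists_sum_comp_eq he
  refine ⟨c, hc, fun F => ?_⟩
  have := H fun f => F (fun t q => f (.inl (t, q))) fun q => f (.inr q)
  rw [← (Equiv.curry (Fin j) (Fin l') Bool).sum_comp]
  refine this.trans (congrArg (c * ·) ?_)
  rw [← Fintype.sum_prod_type' (f := F), ← ((Equiv.sumArrowEquivProdArrow _ _ _).trans
    ((Equiv.curry (Fin k) (Fin l) Bool).prodCongr (Equiv.refl (Fin g → Bool)))).sum_comp]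
  rfl

namespace Protocol

variable {α : Type} (P : Protocol α) (bit : Bool ↪ α) {k : ℕ} {x : List α}

theorem rewardInput_getD {h : History α} (hh : h.length ≤ k) (r : P.Coins k x) {t : ℕ}
    (ht : t < h.length) :
    (P.rewardInput bit k x h r).getD (2 * t + 1) [] = h[t].1 ∧
      (P.rewardInput bit k x h r).getD (2 * t + 2) [] = (P.coinStrings bit r).getD t [] := by
  have hl : (P.coinStrings bit r).length = k := by simp [coinStrings]
  have key : ∀ (h : History α) (l : List (List α)) (t : ℕ), h.length ≤ l.length →
      (ht : t < h.length) →
      ((List.zipWith (fun p s => [p.1, s]) h l).flatten).getD (2 * t) [] = h[t].1 ∧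
      ((List.zipWith (fun p s => [p.1, s]) h l).flatten).getD (2 * t + 1) [] = l.getD t [] := by
    intro h
    induction h with
    | nil => intro l t _ ht; exact absurd ht (by simp)
    | cons p h ih =>
      rintro (_ | ⟨s, l⟩) t hl ht
      · simp at hl
      · cases t with
        | zero => simp
        | succ t => simpa [Nat.mul_add] using ih l t (by simpa using hl) (by simpa using ht)
  rw [rewardInput, List.getD_cons_succ, List.getD_cons_succ]
  exact key h _ t (by omega) ht

theorem rewardInput_eq {h : History α} (hh : h.length ≤ k) (r : P.Coins k x) :
    P.rewardInput bit k x h r = x :: ((List.range h.length).map fun t =>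
      [(h.getD t ([], [])).1, (P.coinStrings bit r).getD t []]).flatten := by
  have hl : (P.coinStrings bit r).length = k := by simp [coinStrings]
  rw [rewardInput]
  congr 2
  refine List.ext_getElem (by simp; omega) fun t h₁ h₂ => ?_
  simp only [List.length_map, List.length_range] at h₂
  simp [List.getD_eq_getElem?_getD, List.getElem?_eq_getElem h₂,
    List.getElem?_eq_getElem (show t < (P.coinStrings bit r).length by omega)]

end Protocol

namespace Simulation

variable {α : Type} [Finite α] (S : Simulation α) (Q : Protocol α) (bit : Bool ↪ α)

/-- The protocol `Q` of `j` rounds simulates `j` rounds of the `k`-round protocol of `S`, and it has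
`g` coins to spare. -/
structure Simulates (k j g : ℕ) (ξ : List α) : Prop where
  V_eq : Q.V = S.V j
  pos : 0 < j
  le : S.i + j ≤ k
  msgLen_le : S.P.msgLen.eval (S.X ξ).length + 1 ≤ Q.msgLen.eval ξ.length
  coinLen_le : k * S.coinLen ξ + g ≤ Q.coinLen.eval ξ.length

variable {S Q} {k j g : ℕ} {ξ : List α} (hS : S.Simulates Q k j g ξ)

namespace Simulates

include hS

theorem index_lt (t : Fin k) (q : Fin (S.coinLen ξ)) :
    t * S.coinLen ξ + q < Q.coinLen.eval ξ.length := by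
  have : (t : ℕ) + 1 ≤ k := t.2
  have := hS.coinLen_le
  nlinarith [q.2, Nat.mul_le_mul_right (S.coinLen ξ) ‹(t : ℕ) + 1 ≤ k›]

/-- The coins of the simulated protocol. -/
def π (r : Q.Coins j ξ) : S.P.Coins k (S.X ξ) :=
  fun t q => r ⟨0, hS.pos⟩ ⟨t * S.coinLen ξ + q, hS.index_lt t q⟩

/-- The spare coins. -/
def θ (r : Q.Coins j ξ) : Fin g → Bool := fun q => r ⟨0, hS.pos⟩ ⟨k * S.coinLen ξ + q, by
  have := hS.coinLen_le
  omega⟩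

theorem headD_coinStrings (r : Q.Coins j ξ) :
    (Q.coinStrings bit r).headD [] = List.ofFn fun s => bit (r ⟨0, hS.pos⟩ s) := by
  obtain ⟨j, rfl⟩ := Nat.exists_eq_succ_of_ne_zero hS.pos.ne'
  simp [Protocol.coinStrings, List.ofFn_succ]

theorem coinStrings_π (r : Q.Coins j ξ) :
    S.P.coinStrings bit (hS.π r) = S.coins ξ k ((Q.coinStrings bit r).headD []) := by
  rw [hS.headD_coinStrings bit, coins]
  refine List.ext_getElem (by simp [Protocol.coinStrings]) fun t h₁ h₂ => ?_
  simp only [List.length_map, List.length_range] at h₂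
  have : t * S.coinLen ξ + S.coinLen ξ ≤ Q.coinLen.eval ξ.length := by
    have := hS.coinLen_le
    nlinarith [Nat.mul_le_mul_right (S.coinLen ξ) (show t + 1 ≤ k from h₂)]
  rw [List.getElem_map, List.getElem_range, slice_ofFn _ this]
  simp only [Protocol.coinStrings, List.getElem_ofFn]
  rfl

theorem coins_θ (r : Q.Coins j ξ) : (List.ofFn fun q => bit (hS.θ r q)) =
    (((Q.coinStrings bit r).headD []).drop (k * S.coinLen ξ)).take g := by
  have := hS.coinLen_le
  rw [hS.headD_coinStrings bit]
  refine List.ext_getElem (by simp; omega) fun t h₁ h₂ => ?_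
  simp [θ]

/-- All simulated coins lie in the first random string, which is available in every round. Hence
Arthur can give the replies that the simulated protocol gives after the prefix `S.H ξ`. -/
theorem exists_cover : ∃ K : Game.Cover (Q.game bit j ξ) (S.P.game bit k (S.X ξ)) j (Fin g → Bool),
    K.H = S.H ξ ∧ K.μ = S.μ ξ ∧ K.π = hS.π ∧ K.θ = hS.θ := by
  obtain ⟨c, hc, hsum⟩ := exists_sum_coins_eq hS.pos hS.coinLen_le hS.index_lt
  refine ⟨⟨S.H ξ, S.μ ξ, hS.π, hS.θ, c, hc, hsum, fun m => ?_, fun h m r hh => ?_⟩,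
    rfl, rfl, rfl, rfl⟩
  · rw [Protocol.mem_messages, μ, List.length_take]
    exact min_le_left _ _
  · have hle := hS.le
    change Q.V (Q.arthurInput bit j ξ h m r) = S.P.V (S.P.arthurInput bit k (S.X ξ) _ _ _)
    have hlen : ((Q.coinStrings bit r).take (h.length + 1)).length = h.length + 1 := by
      simp [Protocol.coinStrings]
      omega
    rw [hS.V_eq, Protocol.arthurInput, V, byRound_eq _ hh.le hlen, Protocol.arthurInput,
      hS.coinStrings_π bit, List.length_append, List.length_map, S.length_H]
    congr 4
    rw [coins, coins, ← List.map_take, List.take_range, min_eq_left (by omega)]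
    congr 3
    cases Q.coinStrings bit r <;> rfl

/-- The first symbol is ignored by the simulated protocol, so a claim can be attached to a message
at will. -/
theorem exists_message (b : Bool) {m : List α} (hm : m ∈ S.P.messages (S.X ξ)) :
    ∃ m' ∈ Q.messages ξ, (m'.head? = some (bit b)) ∧ S.μ ξ m' = m := by
  rw [Protocol.mem_messages] at hm
  refine ⟨bit b :: m, ?_, rfl, ?_⟩
  · rw [Protocol.mem_messages, List.length_cons]
    have := hS.msgLen_le
    omega
  · rw [μ, List.tail_cons, List.take_of_length_le hm]

variable {h : History α} (hh : h.length = j) (r : Q.Coins j ξ)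

include hh

theorem rs_eq : S.rs k (Q.rewardInput bit j ξ h r) = S.P.coinStrings bit (hS.π r) := by
  have := (Q.rewardInput_getD bit hh.le r (t := 0) (by have := hS.pos; omega)).2
  rw [rs, this, hS.coinStrings_π bit]
  congr 1
  cases Q.coinStrings bit r <;> rfl

omit hS in
theorem ms_eq {t : ℕ} (ht : t < S.i + j) : S.ms (Q.rewardInput bit j ξ h r) t =
    ((S.H ξ ++ h.map fun p => (S.μ ξ p.1, p.2)).getD t ([], [])).1 := by
  have hH := S.length_H ξ
  rw [ms]
  change (if t < S.i then ((S.H ξ).getD t ([], [])).1 else S.μ ξ _) = _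
  split
  · rw [List.getD_append _ _ _ _ (by omega)]
  · rw [(Q.rewardInput_getD bit hh.le r (t := t - S.i) (by omega)).1,
      List.getD_append_right _ _ _ _ (by omega), hH, List.getD_eq_getElem _ _ (by simp; omega),
      List.getElem_map]

theorem rewardInput_eq : S.rewardInput k (S.i + j) (Q.rewardInput bit j ξ h r) =
    S.P.rewardInput bit k (S.X ξ) (S.H ξ ++ h.map fun p => (S.μ ξ p.1, p.2)) (hS.π r) := by
  have hH := S.length_H ξ
  have hle := hS.le
  rw [S.P.rewardInput_eq, Simulation.rewardInput, hS.rs_eq bit hh]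
  · simp only [List.length_append, List.length_map, hH, hh]
    change S.X ξ :: _ = _
    congr 2
    refine List.map_congr_left fun t ht => ?_
    rw [ms_eq bit hh r (List.mem_range.1 ht)]
  · simp
    omega

theorem history_eq (n : ℕ) : S.history k n (Q.rewardInput bit j ξ h r) =
    (S.P.game bit k (S.X ξ)).run (S.ms (Q.rewardInput bit j ξ h r)) (hS.π r) n := by
  rw [history, hS.rs_eq bit hh, ← Protocol.history_eq_run]
  rfl

/-- Arthur can test whether his coins fit the prefix by replaying its rounds; the reward uses this
test for rejection. -/
theorem history_eq_iff : S.history k S.i (Q.rewardInput bit j ξ h r) = S.H ξ ↔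
    hS.π r ∈ (S.P.game bit k (S.X ξ)).cons (S.H ξ) := by
  have hH := S.length_H ξ
  rw [hS.history_eq bit hh, ← hH]
  refine (Game.mem_cons_iff_run fun s hs => ?_).symm
  rw [ms_eq bit hh r (by omega), List.getD_append _ _ _ _ hs, List.getD_eq_getElem _ _ hs]

theorem history_eq_of_mem (hr : hS.π r ∈ (S.P.game bit k (S.X ξ)).cons
    (S.H ξ ++ h.map fun p => (S.μ ξ p.1, p.2))) :
    S.history k (S.i + j) (Q.rewardInput bit j ξ h r) =
      S.H ξ ++ h.map fun p => (S.μ ξ p.1, p.2) := by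
  have hH := S.length_H ξ
  have hl : (S.H ξ ++ h.map fun p => (S.μ ξ p.1, p.2)).length = S.i + j := by simp [hH, hh]
  rw [hS.history_eq bit hh, ← hl]
  refine (Game.mem_cons_iff_run fun s hs => ?_).1 hr
  rw [ms_eq bit hh r (by omega), List.getD_eq_getElem _ _ hs]

end Simulates

end Simulation

end RationalProof

/-! ### Protocols that open with a claim -/

namespace RationalProof

open Machine Cod

theorem binFrac_nonneg (w : List Bool) : 0 ≤ binFrac w := by
  induction w with
  | nil => exact le_rfl
  | cons b w ih =>
    rw [binFrac]
    split <;> positivity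

section

variable {α : Type} (bit : Bool ↪ α)

/-- The bit at the beginning of a message. -/
noncomputable def claim (m : List α) : Bool :=
  open Classical in decide (m.head? = some (bit true))

theorem claim_of_head? {m : List α} {b : Bool} (h : m.head? = some (bit b)) : claim bit m = b := by
  rw [claim, h]
  cases b <;> simp

theorem PT.claim [Finite α] {W : Type} {w : Cod W} {f : W → List α} (hf : PT w (str α) f) :
    PT w (Cod.letter Bool) fun u => claim bit (f u) :=
  (PT.letter (d := Cod.letter Bool) fun o : Option α =>
    open Classical in decide (o = some (bit true))).comp (PT.headStr.comp hf)

theorem PT.bitString [Finite α] {W : Type} {w : Cod W} {f : W → Bool} (hf : PT w (Cod.letter Bool) f) :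
    PT w (str α) fun u => [bit (f u)] :=
  (PT.letter (d := str α) fun b => [bit b]).comp hf

theorem History.flat_injective {h h' : History α} (e : h.flat = h'.flat) : h = h' := by
  have h₁ := h.length_flat
  have h₂ := h'.length_flat
  have hl : h.length = h'.length := by
    rw [e] at h₁
    omega
  rw [← pairsOf_flat h [], ← pairsOf_flat h' [], hl, e]

/-- The first message of a run. -/
theorem valueInput_run {G : Game (List α)} {ms : ℕ → List α} {r : G.C} {n : ℕ} (hn : 0 < n)
    {x : List α} : (Protocol.valueInput x (G.run ms r n)).getD 1 [] = ms 0 := by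
  have hrun : ∀ n, ∃ a h, G.run ms r (n + 1) = (ms 0, a) :: h := by
    intro n
    induction n with
    | zero => exact ⟨_, [], rfl⟩
    | succ n ih =>
      obtain ⟨a, h, e⟩ := ih
      exact ⟨a, _, by rw [Game.run, e]; rfl⟩
  obtain ⟨a, h, e⟩ := hrun (n - 1)
  rw [Nat.sub_add_cancel hn] at e
  rw [e]
  change (((ms 0 :: a :: History.flat h)).dropLast).getD 0 [] = _
  rfl

theorem tupleCode_injective {A : Type} : Function.Injective (tupleCode (α := A)) :=
  Function.LeftInverse.injective splitNone_tupleCode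

end

namespace Simulation

variable {α : Type} [Finite α] (S : Simulation α) (bit : Bool ↪ α)

/-- The random strings are consistent with the given history. -/
noncomputable def consistent (k : ℕ) (u : List (List α)) : Bool :=
  @decide ((S.history k S.i u).flat = (S.H (u.headD [])).flat) (Classical.propDecidable _)

theorem polyTime_consistent (k : ℕ) : PT (str α).list (Cod.letter Bool) (S.consistent k) :=
  PT.eq (c := (str α).list) (f := fun u => (S.history k S.i u).flat)
    (g := fun u => (S.H (u.headD [])).flat) tupleCode_injective (PT.historyFlat.comp (S.polyTime_history k S.i))
    (PT.historyFlat.comp (S.polyTime_H.comp (PT.headD [])))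

/-- The required lengths are polynomials in the length of the simulated input. Since `S.X` is
computable in polynomial time, they are bounded by polynomials in the length of the new input; `gp`
counts spare coins. -/
theorem exists_simulates (gp : Polynomial ℕ) {k j : ℕ} (hj : 0 < j) (hk : S.i + j ≤ k) :
    ∃ ml cl : Polynomial ℕ, ∀ Q : Protocol α, Q.msgLen = ml → Q.coinLen = cl → Q.V = S.V j →
      ∀ ξ, S.Simulates Q k j (gp.eval (S.X ξ).length) ξ := by
  obtain ⟨q, hq⟩ := S.polyTime_X.length_le
  refine ⟨S.P.msgLen.comp q + 1, .C k * S.P.coinLen.comp q + gp.comp q, ?_⟩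
  rintro Q h₁ h₂ h₃ ξ
  refine ⟨h₃, hj, hk, ?_, ?_⟩
  · rw [h₁, Polynomial.eval_add, Polynomial.eval_comp, Polynomial.eval_one]
    exact Nat.add_le_add_right (eval_mono _ (hq ξ)) 1
  · rw [h₂, Polynomial.eval_add, Polynomial.eval_mul, Polynomial.eval_comp, Polynomial.eval_comp,
      Polynomial.eval_C]
    exact Nat.add_le_add (Nat.mul_le_mul_left k (eval_mono _ (hq ξ))) (eval_mono _ (hq ξ))

/-- A protocol in which Merlin's first message starts with a claim, and the reward depends on
the claim such that the right one is worth more. -/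
theorem exists_claim_protocol {k j : ℕ} (hj : 0 < j) (hk : S.i + j = k)
    {ρ : Bool → List (List α) → List Bool} (hρ : ∀ b, PT (str α).list (str Bool) (ρ b))
    (hρ₁ : ∀ b u, binFrac (ρ b u) ≤ 1) {L : Language α}
    {f : ∀ ξ, Bool → History α → S.P.Coins k (S.X ξ) → ℚ}
    (base : ∀ ξ b (Q : Protocol α) (hS : S.Simulates Q k j 0 ξ) (h : History α) (r : Q.Coins j ξ),
      h.length = j → hS.π r ∈ (S.P.game bit k (S.X ξ)).cons
        (S.H ξ ++ h.map fun p => (S.μ ξ p.1, p.2)) →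
      binFrac (ρ b (Q.rewardInput bit j ξ h r)) =
        f ξ b (S.H ξ ++ h.map fun p => (S.μ ξ p.1, p.2)) (hS.π r))
    (hH : ∀ ξ, ((S.P.game bit k (S.X ξ)).cons (S.H ξ)).Nonempty)
    (hlt : ∀ ξ, ∃ b, (ξ ∈ L ↔ b = true) ∧
      ((S.P.game bit k (S.X ξ)).withRew (f ξ !b)).opt j (S.H ξ) <
      ((S.P.game bit k (S.X ξ)).withRew (f ξ b)).opt j (S.H ξ)) :
    ∃ Q : Protocol α, Q.IsPolyTime ∧ Q.Computes bit j (charFn bit L) ∧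
      Q.φ = fun u => [bit (claim bit (u.getD 1 []))] := by
  obtain ⟨ml, cl, hsim⟩ := S.exists_simulates 0 hj hk.le
  -- Coins that do not fit the prefix are paid 0 whatever the claim, so both claims are compared
  -- under the same conditional distribution.
  let R : List (List α) → List Bool := fun u => if S.consistent k u then
    (if claim bit (u.getD 1 []) then ρ true u else ρ false u) else []
  let Q : Protocol α := ⟨ml, cl, S.V j, R, fun u => [bit (claim bit (u.getD 1 []))]⟩
  have hR : ∀ u, R u = if S.consistent k u then ρ (claim bit (u.getD 1 [])) u else [] := by
    intro u
    change (if _ then (if _ then _ else _) else _) = _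
    cases claim bit (u.getD 1 []) <;> rfl
  refine ⟨Q, ⟨S.polyTime_V' j, ?_, PT.bitString bit (PT.claim bit (PT.getD 1 []))⟩,
    (Q.computes_iff bit j).2 ⟨fun u => ?_, fun ξ ms r hr => ?_⟩, rfl⟩
  · exact PT.ite (S.polyTime_consistent k) (PT.ite (PT.claim bit (PT.getD 1 [])) (hρ _) (hρ _))
      (PT.const [])
  · change binFrac (R u) ≤ 1
    rw [hR]
    split
    · exact hρ₁ _ _
    · exact zero_le_one
  · have hS : S.Simulates Q k j 0 ξ := by
      simpa using hsim Q rfl rfl rfl ξ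
    obtain ⟨K, hKH, hKμ, hKπ, -⟩ := hS.exists_cover bit
    have hη : ∀ h, K.η h = S.H ξ ++ h.map fun p => (S.μ ξ p.1, p.2) := fun h => by
      rw [Game.Cover.η, hKH, hKμ]
    obtain ⟨b, hb, hlt⟩ := hlt ξ
    -- Only rationality in the first round matters, since the value depends on the claim alone.
    have hbest : (Q.game bit j ξ).Best (j - 1) [] (ms 0) := hr 0 hj
    have hclaim : claim bit (ms 0) = b := by
      refine K.claim_eq (claim := claim bit) (f := f ξ) (c := K.c) K.c_pos (fun b m hm => ?_) ?_
        (b := b) (Nat.sub_add_cancel hj) (hKH ▸ hH ξ) (hKH ▸ hlt) hbest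
      · obtain ⟨m', h₁, h₂, h₃⟩ := hS.exists_message bit b hm
        exact ⟨m', h₁, claim_of_head? bit h₂, by rw [hKμ, h₃]⟩
      · intro h m a h' hh hl
        have hrew : ∀ r, (Q.game bit j ξ).rew h r =
            if hS.π r ∈ (S.P.game bit k (S.X ξ)).cons (S.H ξ) then
              binFrac (ρ (claim bit m) (Q.rewardInput bit j ξ h r)) else 0 := by
          intro r
          change binFrac (R (Q.rewardInput bit j ξ h r)) = _
          have h₁ : (Q.rewardInput bit j ξ h r).getD 1 [] = m := by
            rw [(Q.rewardInput_getD bit hl.le r (t := 0) (by omega)).1]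
            simp [hh]
          have h₂ : S.consistent k (Q.rewardInput bit j ξ h r) = true ↔
              hS.π r ∈ (S.P.game bit k (S.X ξ)).cons (S.H ξ) := by
            rw [← hS.history_eq_iff bit hl, consistent, @decide_eq_true_eq _ (Classical.propDecidable _)]
            exact ⟨fun e => History.flat_injective e, fun e => congrArg _ e⟩
          rw [hR, h₁]
          simp only [h₂]
          split <;> rfl
        rw [K.tot_zero hl.le (F := fun r _ => f ξ (claim bit m) (K.η h) r), Game.tot_zero]
        · simp only [Finset.sum_const, Finset.card_univ, Fintype.card_unique, one_smul]
          rfl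
        · intro r hr hr'
          have hr₂ := (K.mem_cons hl.le).2 ⟨hr, hr'⟩
          rw [hKH, hKπ] at hr'
          rw [hKπ, hη] at hr₂
          rw [hrew, if_pos hr', hη, hKπ]
          exact base ξ _ Q hS h r hl hr₂
        · intro r _ hr'
          rw [hKH, hKπ] at hr'
          rw [hrew, if_neg hr']
    change charFn bit L ξ =
      [bit (claim bit ((Protocol.valueInput ξ ((Q.game bit j ξ).run ms r j)).getD 1 []))]
    rw [valueInput_run hj, hclaim, charFn]
    congr 2
    cases b <;> simp [hb]

end Simulation

section Claim

variable {α : Type} [Finite α] {bit : Bool ↪ α}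

omit [Finite α] in
theorem valueInput_eq {x : List α} {h : History α} {n : ℕ} (hh : h.length = n) :
    Protocol.valueInput x h = x :: h.flat.take (2 * n - 1) := by
  rw [Protocol.valueInput, List.dropLast_eq_take, h.length_flat, hh]

/-- The identical simulation. -/
def Simulation.refl (P : Protocol α) (hP : P.IsPolyTime) : Simulation α where
  P := P
  X x := x
  H _ := []
  i := 0
  length_H _ := rfl
  polyTime_V := hP.1
  polyTime_X := PT.id
  polyTime_H := PT.nil

theorem Game.run_withRew {S : Type} (G : Game S) (f : List (S × S) → G.C → ℚ) (ms : ℕ → S)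
    (r : G.C) (t : ℕ) : (G.withRew f).run ms r t = G.run ms r t := by
  induction t with
  | zero => rfl
  | succ t ih => rw [Game.run, Game.run, ih]

theorem rationalTo_affine {S : Type} {G : Game S} {a b : ℚ} (hb : 0 < b) {k i : ℕ} {ms : ℕ → S}
    {r : G.C} (h : (G.withRew fun h r => a + b * G.rew h r).RationalTo k i ms r) :
    G.RationalTo k i ms r := fun t ht => by
  have := h t ht
  rw [Game.run_withRew] at this
  exact (Game.best_affine (a := a) hb ⟨r, Game.mem_cons_run ms r t⟩).1 this

/-- In a protocol for a language, Merlin may be asked to claim the value at once. -/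
theorem exists_claim_form {k : ℕ} (hk : 0 < k) {L : Language α} (hL : L ∈ DRMA bit k) :
    ∃ P : Protocol α, P.IsPolyTime ∧ P.Computes bit k (charFn bit L) ∧
      P.φ = fun u => [bit (claim bit (u.getD 1 []))] := by
  classical
  obtain ⟨P, hP, hc⟩ := hL
  obtain ⟨hR, hc⟩ := (P.computes_iff bit k).1 hc
  let S := Simulation.refl P hP
  -- The digits `[false, true]` in front of the reward give 1/2 + R/4: at least 1/2 for a claim
  -- borne out by the original value, and still at most 1.
  let ρ : Bool → List (List α) → List Bool := fun b u =>
    if (open Classical in decide (P.φ (u.headD [] :: ((S.history k k u).flat).take (2 * k - 1)) =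
      [bit b])) then [false, true] ++ P.R (S.rewardInput k k u) else []
  let f : ∀ ξ, Bool → History α → P.Coins k ξ → ℚ := fun ξ b h r =>
    if P.φ (ξ :: h.flat.take (2 * k - 1)) = [bit b] then
      1 / 2 + 1 / 4 * binFrac (P.R (P.rewardInput bit k ξ h r)) else 0
  have hfrac : ∀ w, binFrac ([false, true] ++ w) = 1 / 2 + 1 / 4 * binFrac w := by
    intro w
    simp only [List.cons_append, List.nil_append, binFrac]
    norm_num
    ring
  refine S.exists_claim_protocol bit hk (Nat.zero_add k) (ρ := ρ) (f := f) (fun b => ?_)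
    (fun b u => ?_) ?_ (fun ξ => ?_) fun ξ => ?_
  · refine PT.ite (PT.eqStr (PT.comp (d := (str α).list) hP.2.2 (PT.cons (PT.headD []) ((PT.take _).comp
      (PT.historyFlat.comp (S.polyTime_history k k))))) (PT.const _)) ?_ (PT.const [])
    exact PT.appendStr (PT.const [false, true]) (PT.comp (d := (str α).list) hP.2.1 (S.polyTime_rewardInput k k))
  · change binFrac (if _ then _ else _) ≤ 1
    split
    · rw [hfrac]
      linarith [hR (S.rewardInput k k u)]
    · exact zero_le_one
  · intro ξ b Q hS h r hh hr
    have h₁ := hS.rewardInput_eq bit hh r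
    have h₂ := hS.history_eq_of_mem bit hh r hr
    rw [show S.i + k = k from Nat.zero_add k] at h₁ h₂
    change binFrac (if _ then _ else _) = if _ then _ else _
    rw [h₁, h₂]
    simp only [decide_eq_true_eq]
    change binFrac (if P.φ (ξ :: _) = [bit b] then _ else _) = _
    split
    · exact hfrac _
    · rfl
  · exact ⟨fun _ _ => true, Game.mem_cons.2 fun t ht => absurd ht (Nat.not_lt_zero t)⟩
  · change ∃ b, _ ∧ ((P.game bit k ξ).withRew (f ξ !b)).opt k [] <
      ((P.game bit k ξ).withRew (f ξ b)).opt k []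
    refine ⟨decide (ξ ∈ L), decide_eq_true_iff.symm, ?_⟩
    set b := decide (ξ ∈ L) with hb
    set G₀ := (P.game bit k ξ).withRew fun h r => 1 / 2 + 1 / 4 * (P.game bit k ξ).rew h r with hG₀
    have hf : ∀ b h r, f ξ b h r ≤ G₀.rew h r := by
      intro b h r
      have := binFrac_nonneg (P.R (P.rewardInput bit k ξ h r))
      change (if _ then _ else _) ≤ 1 / 2 + 1 / 4 * binFrac (P.R (P.rewardInput bit k ξ h r))
      split
      · exact le_rfl
      · positivity
    have hval : ∀ ms (r : P.Coins k ξ), G₀.RationalTo k k ms r →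
        P.φ (ξ :: (History.flat (G₀.run ms r k)).take (2 * k - 1)) = [bit b] := by
      intro ms r hr
      have := hc ξ ms r (rationalTo_affine (by norm_num) hr)
      rw [valueInput_eq (Game.length_run (G := P.game bit k ξ) ms r k)] at this
      rw [Game.run_withRew (P.game bit k ξ)]
      exact this.symm
    let r₀ : P.Coins k ξ := fun _ _ => true
    -- The right claim loses nothing, since the value is right on every rational run.
    have h₁ : G₀.opt k [] ≤ (G₀.withRew (f ξ b)).opt k [] :=
      Game.opt_le_of_rational (G := G₀) (f := f ξ b) (k := k)
        (fun ms r hr => if_pos (hval ms r hr)) k (fun _ => []) r₀ 0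
        (Nat.zero_add k) fun t ht => absurd ht (Nat.not_lt_zero t)
    by_contra hlt
    have h₂ : G₀.opt k [] ≤ (G₀.withRew (f ξ !b)).opt k [] := h₁.trans (not_lt.1 hlt)
    -- If the wrong claim lost nothing either, some rational run would be paid in full. But it is
    -- paid 0 there, and the full reward is at least 1/2.
    obtain ⟨ms, hr, e⟩ := Game.exists_rational_of_opt_le (G := G₀) (f := f ξ !b)
      (hf !b) (k := k) (r := r₀) k (fun _ => [])
      0 (Nat.zero_add k) (fun t ht => absurd ht (Nat.not_lt_zero t)) h₂
    have hne : ¬ P.φ (ξ :: (History.flat (G₀.run ms r₀ k)).take (2 * k - 1)) = [bit !b] := by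
      rw [hval ms r₀ hr]
      simp
    have h₃ := (if_neg hne).symm.trans e
    have h₄ := binFrac_nonneg (P.R (P.rewardInput bit k ξ (G₀.run ms r₀ k) r₀))
    change (0 : ℚ) = 1 / 2 + 1 / 4 * binFrac (P.R (P.rewardInput bit k ξ (G₀.run ms r₀ k) r₀)) at h₃
    linarith

end Claim

end RationalProof

namespace RationalProof

open Machine Cod

/-! ### Binary fractions and the granularity of rewards -/

section Fractions

theorem exists_int_binFrac {w : List Bool} {n : ℕ} (h : w.length ≤ n) :
    ∃ z : ℤ, 2 ^ n * binFrac w = z := by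
  induction w generalizing n with
  | nil => exact ⟨0, by simp [binFrac]⟩
  | cons b w ih =>
    obtain ⟨n, rfl⟩ : ∃ m, n = m + 1 := ⟨n - 1, by simp at h; omega⟩
    obtain ⟨z, hz⟩ := ih (n := n) (by simpa using h)
    refine ⟨2 ^ (n + 1) * (if b then 1 else 0) + z, ?_⟩
    rw [binFrac, mul_add, pow_succ, show (2 : ℚ) ^ n * 2 * (binFrac w / 2) = 2 ^ n * binFrac w by ring,
      hz]
    split <;> push_cast <;> ring

/-- The fraction `0.w1`. -/
def oddFrac (w : List Bool) : ℚ := binFrac (false :: (w ++ [true]))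

theorem oddFrac_cons (b : Bool) (w : List Bool) :
    oddFrac (b :: w) = ((if b then 1 else 0) + oddFrac w) / 2 := by
  simp [oddFrac, binFrac]

theorem oddFrac_nil : oddFrac [] = 1 / 2 := by
  simp [oddFrac, binFrac]

/-- The final digit 1 makes the numerator odd, so the fraction is already in lowest terms. -/
theorem exists_int_oddFrac (w : List Bool) :
    ∃ z : ℤ, 2 ^ (w.length + 1) * oddFrac w = 2 * z + 1 := by
  induction w with
  | nil => exact ⟨0, by simp [oddFrac_nil]⟩
  | cons b w ih =>
    obtain ⟨z, hz⟩ := ih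
    refine ⟨(if b then 2 ^ w.length else 0) + z, ?_⟩
    rw [oddFrac_cons, List.length_cons, pow_succ, mul_div_assoc', mul_comm _ (2 : ℚ), mul_assoc,
      mul_div_cancel_left₀ _ two_ne_zero, mul_add, hz, pow_succ]
    split <;> push_cast <;> ring

theorem oddFrac_mem (w : List Bool) : 0 < oddFrac w ∧ oddFrac w < 1 := by
  induction w with
  | nil => norm_num [oddFrac_nil]
  | cons b w ih =>
    rw [oddFrac_cons]
    split <;> constructor <;> linarith [ih.1, ih.2]

/-- If equality held, the odd numerator would force 2^(|w| + 1 − K) to divide `c`. This power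
exceeds 2^N ≥ `c`. -/
theorem oddFrac_ne {K N : ℕ} {w : List Bool} {c : ℕ} {e : ℚ} (hc : 0 < c) (hcN : c ≤ 2 ^ N)
    (hw : K + N ≤ w.length) (he : ∃ z : ℤ, 2 ^ K * (c * e) = z) : e ≠ oddFrac w := by
  rintro rfl
  obtain ⟨z, hz⟩ := he
  obtain ⟨y, hy⟩ := exists_int_oddFrac w
  obtain ⟨d, hd⟩ : ∃ d, w.length + 1 = K + (d + 1) := ⟨w.length - K, by omega⟩
  have h₁ : (c : ℚ) * (2 * y + 1) = z * 2 ^ (d + 1) := by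
    rw [← hy, ← hz, hd, pow_add]
    ring
  have h₂ : (c : ℤ) * (2 * y + 1) = z * 2 ^ (d + 1) := by exact_mod_cast h₁
  have h₃ : IsCoprime ((2 : ℤ) ^ (d + 1)) (2 * y + 1) := IsCoprime.pow_left ⟨-y, 1, by ring⟩
  have h₄ : ((2 ^ (d + 1) : ℕ) : ℤ) ∣ (c : ℤ) := by
    push_cast
    exact h₃.dvd_of_dvd_mul_right ⟨z, by rw [h₂]; ring⟩
  have h₅ := Nat.le_of_dvd hc (Int.natCast_dvd_natCast.1 h₄)
  have h₆ : 2 ^ N < 2 ^ (d + 1) := Nat.pow_lt_pow_right (by norm_num) (by omega)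
  omega

/-- The number of fractions below a threshold. -/
theorem abs_sum_oddFrac_sub_le {g : ℕ} {e : ℚ} (h₀ : 0 ≤ e) (h₁ : e ≤ 1) :
    |∑ w : Fin g → Bool, (if oddFrac (List.ofFn w) < e then (1 : ℚ) else 0) - 2 ^ g * e| ≤ 1 := by
  induction g generalizing e with
  | zero =>
    rw [Fintype.sum_unique, abs_sub_le_iff]
    split <;> constructor <;> simp <;> linarith
  | succ g ih =>
    rw [← (Fin.consEquiv fun _ => Bool).sum_comp, Fintype.sum_prod_type, Fintype.sum_bool]
    have key : ∀ b (w : Fin g → Bool), oddFrac (List.ofFn ((Fin.consEquiv fun _ => Bool) (b, w))) =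
        ((if b then 1 else 0) + oddFrac (List.ofFn w)) / 2 := by
      intro b w
      rw [← oddFrac_cons]
      exact congrArg oddFrac (List.ofFn_cons b w)
    simp only [key, if_true, Bool.false_eq_true, if_false]
    -- The first digit splits the thresholds into a lower and an upper half. One half is decided
    -- entirely, and the other is the problem for g − 1 digits with `e` rescaled; so the error stays
    -- at most 1.
    rcases le_total e (1 / 2) with h | h
    · have := ih (e := 2 * e) (by linarith) (by linarith)
      rw [Finset.sum_eq_zero, zero_add]
      · convert this using 3
        · refine Finset.sum_congr rfl fun w _ => if_congr ?_ rfl rfl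
          constructor <;> intro h <;> linarith
        · rw [pow_succ]
          ring
      · intro w _
        have := (oddFrac_mem (List.ofFn w)).1
        rw [if_neg]
        linarith
    · have := ih (e := 2 * e - 1) (by linarith) (by linarith)
      have h₂ : ∑ w : Fin g → Bool, (if (0 + oddFrac (List.ofFn w)) / 2 < e then (1 : ℚ) else 0) =
          2 ^ g := by
        rw [Finset.sum_congr rfl fun w _ => if_pos _]
        · simp
        · intro w _
          have := (oddFrac_mem (List.ofFn w)).2
          linarith
      rw [h₂]
      have h₃ : ∑ w : Fin g → Bool, (if (1 + oddFrac (List.ofFn w)) / 2 < e then (1 : ℚ) else 0) =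
          ∑ w : Fin g → Bool, if oddFrac (List.ofFn w) < 2 * e - 1 then (1 : ℚ) else 0 := by
        refine Finset.sum_congr rfl fun w _ => if_congr ?_ rfl rfl
        constructor <;> intro h <;> linarith
      rw [h₃]
      convert this using 2
      rw [pow_succ]
      ring

end Fractions

section Values

variable {α : Type} [Finite α] (P : Protocol α) (bit : Bool ↪ α)

theorem opt_mem {S : Type} {G : Game S} (h₀ : ∀ h r, 0 ≤ G.rew h r) (h₁ : ∀ h r, G.rew h r ≤ 1)
    (n : ℕ) : ∀ h, 0 ≤ G.opt n h ∧ G.opt n h ≤ 1 := by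
  have key : ∀ (s : Finset G.C) (f : G.C → ℚ), (∀ r, 0 ≤ f r ∧ f r ≤ 1) →
      0 ≤ s.expect f ∧ s.expect f ≤ 1 := by
    intro s f hf
    refine ⟨Finset.expect_nonneg fun r _ => (hf r).1, ?_⟩
    rcases s.eq_empty_or_nonempty with rfl | hs
    · simp
    · exact Finset.expect_le hs fun r _ => (hf r).2
  induction n with
  | zero => exact fun h => key _ _ fun r => ⟨h₀ h r, h₁ h r⟩
  | succ n ih =>
    intro h
    obtain ⟨m, -, e⟩ := G.exists_best n h
    rw [← e]
    exact key _ _ fun r => ih _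

/-- The lengths of the rewards are bounded by a polynomial. -/
theorem exists_rewardLen (hP : P.IsPolyTime) (k : ℕ) : ∃ p : Polynomial ℕ, ∀ x (r : P.Coins k x)
    (h : History α), h.length = k → (∀ q ∈ h, q.1 ∈ P.messages x) →
      (P.R (P.rewardInput bit k x h r)).length ≤ p.eval x.length := by
  obtain ⟨p, hp⟩ := PT.length_le (c := (str α).list) (d := str Bool) hP.2.1
  refine ⟨p.comp (.X + 1 + .C k * (P.msgLen + P.coinLen + 2)), fun x r h hh hm => ?_⟩
  refine (hp _).trans ?_
  rw [Polynomial.eval_comp]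
  refine eval_mono p ?_
  simp only [Polynomial.eval_add, Polynomial.eval_mul, Polynomial.eval_X, Polynomial.eval_one,
    Polynomial.eval_C, Polynomial.eval_ofNat]
  change (listCode (fun s => s) (P.rewardInput bit k x h r)).length ≤ _
  rw [Protocol.rewardInput, length_list_cons]
  have key : ∀ (h : History α) (l : List (List α)), (∀ q ∈ h, q.1 ∈ P.messages x) →
      (∀ s ∈ l, s.length = P.coinLen.eval x.length) →
      (listCode (fun s => s) (List.zipWith (fun p s => [p.1, s]) h l).flatten).length ≤
        h.length * (P.msgLen.eval x.length + P.coinLen.eval x.length + 2) := by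
    intro h
    induction h with
    | nil => intro l _ _; simp [listCode]
    | cons q h ih =>
      rintro (_ | ⟨s, l⟩) h₁ h₂
      · simp [listCode]
      · have := ih l (fun q hq => h₁ q (List.mem_cons_of_mem _ hq))
          fun s hs => h₂ s (List.mem_cons_of_mem _ hs)
        have h₃ := (P.mem_messages x).1 (h₁ q List.mem_cons_self)
        have h₄ := h₂ s List.mem_cons_self
        simp only [List.zipWith_cons_cons, List.flatten_cons, List.cons_append, List.nil_append,
          length_list_cons, List.length_cons] at this ⊢
        rw [Nat.add_mul]
        omega
  have := key h (P.coinStrings bit r) hm fun s hs => by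
    obtain ⟨t, -, rfl⟩ := List.mem_ofFn.1 hs |>.imp fun t e => (⟨trivial, e⟩ : True ∧ _)
    simp
  rw [hh] at this
  omega

variable {P bit} {k : ℕ} {p : Polynomial ℕ}

/-- Messages must be admissible, since the bound on the number of reward digits holds only for
those. -/
theorem exists_int_tot_game (hp : ∀ x (r : P.Coins k x) (h : History α), h.length = k →
      (∀ q ∈ h, q.1 ∈ P.messages x) →
      (P.R (P.rewardInput bit k x h r)).length ≤ p.eval x.length) {x : List α} {n : ℕ}
    {h : History α} (hn : h.length + n = k) (hm : ∀ q ∈ h, q.1 ∈ P.messages x) :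
    (∃ z : ℤ, 2 ^ p.eval x.length * (P.game bit k x).tot n h = z) ∧
      ∀ n', n = n' + 1 → ∀ m ∈ P.messages x,
        ∃ z : ℤ, 2 ^ p.eval x.length * (P.game bit k x).totMsg n' h m = z := by
  have good : ∀ n (h : History α) m a, (h.length + (n + 1) = k ∧ ∀ q ∈ h, q.1 ∈ P.messages x) →
      m ∈ P.messages x → ((h ++ [(m, a)]).length + n = k ∧
        ∀ q ∈ h ++ [(m, a)], q.1 ∈ P.messages x) := by
    rintro n h m a ⟨h₁, h₂⟩ hm
    refine ⟨by rw [List.length_append, List.length_singleton]; omega, fun q hq => ?_⟩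
    rcases List.mem_append.1 hq with hq | hq
    · exact h₂ q hq
    · rw [List.mem_singleton.1 hq]
      exact hm
  have base : ∀ (h : History α) (r : P.Coins k x),
      (h.length + 0 = k ∧ ∀ q ∈ h, q.1 ∈ P.messages x) →
      ∃ z : ℤ, 2 ^ p.eval x.length * (P.game bit k x).rew h r = z := fun h r hh =>
    exists_int_binFrac (hp x r h hh.1 hh.2)
  constructor
  · exact Game.exists_int_tot (G := P.game bit k x) (Good := fun n h => h.length + n = k ∧
      ∀ q ∈ h, q.1 ∈ P.messages x) good base n h ⟨hn, hm⟩
  · rintro n' rfl m hm'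
    exact Game.exists_int_totMsg (G := P.game bit k x) (Good := fun n h => h.length + n = k ∧
      ∀ q ∈ h, q.1 ∈ P.messages x) good base n' h m ⟨hn, hm⟩ hm'

theorem card_cons_le {x : List α} (h : History α) :
    ((P.game bit k x).cons h).card ≤ 2 ^ (k * P.coinLen.eval x.length) := by
  refine (Finset.card_le_univ _).trans ?_
  change Fintype.card (Fin k → Fin _ → Bool) ≤ _
  simp [← pow_mul, mul_comm]

end Values

end RationalProof

namespace RationalProof

open Machine Cod

/-! ### The threshold language -/

section Threshold

variable {α : Type} [Finite α] (P : Protocol α) (bit : Bool ↪ α) (i : ℕ) (gp : Polynomial ℕ)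

/-- The input in a query. -/
noncomputable def queryX (ξ : List α) : List α := (dec bit ξ).getD 1 []

/-- The messages in a query. -/
noncomputable def queryMs (ξ : List α) (t : ℕ) : List α :=
  ((dec bit ξ).getD (2 * t + 2) []).take (P.msgLen.eval (queryX bit ξ).length)

/-- The random strings in a query. -/
noncomputable def queryRs (ξ : List α) : List (List α) := (List.range i).map fun t =>
  toBits bit (P.coinLen.eval (queryX bit ξ).length) ((dec bit ξ).getD (2 * t + 3) [])

/-- The history that is described by a query. -/
noncomputable def queryH (ξ : List α) : History α :=
  P.history (queryX bit ξ) (queryMs P bit ξ) (queryRs P bit i ξ) i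

/-- The digits of the threshold in a query. -/
noncomputable def queryBits (ξ : List α) : List Bool :=
  (toBits bit (gp.eval (queryX bit ξ).length) ((dec bit ξ).headD [])).map fun a =>
    open Classical in decide (a = bit true)

/-- The language of all queries whose threshold is smaller than the optimal reward in the last
`j` of `i + j` rounds after the given history. -/
def thresholdLanguage (j : ℕ) : Language α :=
  {ξ | oddFrac (queryBits bit gp ξ) <
    (P.game bit (i + j) (queryX bit ξ)).opt j (queryH P bit i ξ)}

variable {P bit i gp}

theorem polyTime_queryX : PT (str α) (str α) (queryX bit) := (PT.getD 1 []).comp (PT.dec bit)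

theorem polyTime_unary_queryX (p : Polynomial ℕ) :
    PT (str α) (str Unit) fun ξ => PT.unary (p.eval (queryX bit ξ).length) :=
  PT.unaryPoly p (PT.codeLength.comp polyTime_queryX)

theorem polyTime_queryH (hP : P.IsPolyTime) :
    PT (str α) ((str α).prod (str α)).list (queryH P bit i) :=
  PT.history P hP.1 polyTime_queryX (fun t => PT.takeStr (polyTime_unary_queryX _)
    ((PT.getD (2 * t + 2) []).comp (PT.dec bit)))
    (PT.mapRange i fun t => PT.toBits bit (polyTime_unary_queryX _)
      ((PT.getD (2 * t + 3) []).comp (PT.dec bit))) i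

theorem polyTime_queryBits : PT (str α) (str Bool) (queryBits bit gp) :=
  (PT.mapStr _).comp (PT.toBits bit (polyTime_unary_queryX _) ((PT.headD []).comp (PT.dec bit)))

omit [Finite α] in
theorem length_queryBits (ξ : List α) :
    (queryBits bit gp ξ).length = gp.eval (queryX bit ξ).length := by
  simp [queryBits, toBits]

omit [Finite α] in
theorem Protocol.history_take (x : List α) (ms : ℕ → List α) (rs : List (List α)) {t n : ℕ}
    (h : t ≤ n) : P.history x ms (rs.take n) t = P.history x ms rs t := by
  induction t with
  | zero => rfl
  | succ t ih => rw [history, history, ih (by omega), List.take_take, min_eq_left (by omega)]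

/-- The history in a query is recomputed from coins in the query, and those coins witness its
possibility. The language is thus meaningful on every input string. -/
theorem queryH_nonempty (j : ℕ) (ξ : List α) :
    ((P.game bit (i + j) (queryX bit ξ)).cons (queryH P bit i ξ)).Nonempty := by
  choose f hf using fun t : ℕ => exists_toBits bit (P.coinLen.eval (queryX bit ξ).length)
    ((dec bit ξ).getD (2 * t + 3) [])
  let r : P.Coins (i + j) (queryX bit ξ) := fun t => f t
  have h : queryRs P bit i ξ = (P.coinStrings bit r).take i := by
    refine List.ext_getElem (by simp [queryRs, Protocol.coinStrings]) fun t h₁ h₂ => ?_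
    simp only [queryRs, List.getElem_map, List.getElem_range, hf, Protocol.coinStrings,
      List.getElem_take, List.getElem_ofFn]
    rfl
  refine ⟨r, ?_⟩
  rw [queryH, h, Protocol.history_take _ _ _ le_rfl, Protocol.history_eq_run]
  exact Game.mem_cons_run _ _ _

theorem queryH_messages {ξ : List α} {q : List α × List α} (hq : q ∈ queryH P bit i ξ) :
    q.1 ∈ P.messages (queryX bit ξ) := by
  have : ∀ t, ∀ q ∈ P.history (queryX bit ξ) (queryMs P bit ξ) (queryRs P bit i ξ) t,
      q.1 ∈ P.messages (queryX bit ξ) := by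
    intro t
    induction t with
    | zero => intro q hq; simp [Protocol.history] at hq
    | succ t ih =>
      intro q hq
      rcases List.mem_append.1 hq with hq | hq
      · exact ih q hq
      · rw [List.mem_singleton.1 hq, Protocol.mem_messages]
        exact List.length_take_le _ _
  exact this i q hq

/-- Threshold languages are decided by protocols with `j` rounds. -/
theorem thresholdLanguage_mem {j : ℕ} (hj : 0 < j) (hP : P.IsPolyTime)
    (hR : ∀ u, binFrac (P.R u) ≤ 1) {p : Polynomial ℕ}
    (hp : ∀ x (r : P.Coins (i + j) x) (h : History α), h.length = i + j →
      (∀ q ∈ h, q.1 ∈ P.messages x) →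
      (P.R (P.rewardInput bit (i + j) x h r)).length ≤ p.eval x.length)
    (hgp : ∀ n, p.eval n + (i + j) * P.coinLen.eval n ≤ gp.eval n) :
    thresholdLanguage P bit i gp j ∈ DRMA bit j := by
  let S : Simulation α := ⟨P, queryX bit, queryH P bit i, i, fun ξ => P.length_history _ _ _ _,
    hP.1, polyTime_queryX, polyTime_queryH hP⟩
  -- Claiming yes earns the reward of `P`; claiming no earns the threshold itself, whatever happens
  -- later.
  let ρ : Bool → List (List α) → List Bool := fun b u =>
    cond b (P.R (S.rewardInput (i + j) (i + j) u))
      ([false] ++ (queryBits bit gp (u.headD []) ++ [true]))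
  let f : ∀ ξ, Bool → History α → P.Coins (i + j) (queryX bit ξ) → ℚ := fun ξ b h r =>
    cond b (binFrac (P.R (P.rewardInput bit (i + j) (queryX bit ξ) h r)))
      (oddFrac (queryBits bit gp ξ))
  refine (S.exists_claim_protocol bit hj (k := i + j) rfl (ρ := ρ) (f := f)
    (L := thresholdLanguage P bit i gp j) (fun b => ?_) (fun b u => ?_) ?_ (fun ξ => ?_)
    fun ξ => ?_).imp fun Q hQ => ⟨hQ.1, hQ.2.1⟩
  · cases b
    · exact PT.appendStr (PT.const [false]) (PT.appendStr
        (polyTime_queryBits.comp (PT.headD [])) (PT.const [true]))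
    · exact PT.comp (d := (str α).list) hP.2.1 (S.polyTime_rewardInput _ _)
  · cases b
    · exact (oddFrac_mem _).2.le
    · exact hR _
  · intro ξ b Q hS h r hh hr
    cases b
    · rfl
    · change binFrac (P.R (S.rewardInput (i + j) (S.i + j) _)) = _
      rw [hS.rewardInput_eq bit hh]
      rfl
  · exact queryH_nonempty j ξ
  · set G := P.game bit (i + j) (queryX bit ξ) with hG
    change ∃ b, (oddFrac (queryBits bit gp ξ) < G.opt j (queryH P bit i ξ) ↔ b = true) ∧
      (G.withRew (f ξ !b)).opt j (queryH P bit i ξ) < (G.withRew (f ξ b)).opt j (queryH P bit i ξ)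
    have hne : (G.cons (queryH P bit i ξ)).Nonempty := queryH_nonempty j ξ
    have h₁ : (G.withRew (f ξ true)).opt j (queryH P bit i ξ) = G.opt j (queryH P bit i ξ) := rfl
    -- A constant reward is an affine image with slope 0, and its optimum is that constant because
    -- compatible coins exist.
    have h₀ : (G.withRew (f ξ false)).opt j (queryH P bit i ξ) = oddFrac (queryBits bit gp ξ) := by
      have := Game.opt_affine (G := G) (oddFrac (queryBits bit gp ξ)) 0 le_rfl j _ hne
      simp only [zero_mul, add_zero] at this
      exact this
    have hlen : (queryH P bit i ξ).length = i := P.length_history _ _ _ _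
    have hpos := Finset.card_pos.2 hne
    -- The threshold is too fine to equal the optimum, so there is no tie between the claims.
    have hneq : G.opt j (queryH P bit i ξ) ≠ oddFrac (queryBits bit gp ξ) := by
      refine oddFrac_ne hpos (card_cons_le _) (K := p.eval (queryX bit ξ).length) ?_ ?_
      · rw [length_queryBits]
        exact hgp _
      · exact (exists_int_tot_game hp (by rw [hlen]) fun q hq => queryH_messages hq).1
    rcases lt_or_gt_of_ne hneq with h | h
    · refine ⟨false, iff_of_false (not_lt.2 h.le) (by simp), ?_⟩
      change (G.withRew (f ξ true)).opt j _ < _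
      rw [h₀, h₁]
      exact h
    · refine ⟨true, iff_of_true h rfl, ?_⟩
      change (G.withRew (f ξ false)).opt j _ < _
      rw [h₀, h₁]
      exact h

end Threshold

/-! ### Replacing the last rounds by one query -/

section OneQuery

variable {α : Type} [Finite α] {bit : Bool ↪ α}

/-- A query that is written down by a simulating protocol. -/
theorem query_eq {P : Protocol α} {i k : ℕ} {gp : Polynomial ℕ} (hk : i ≤ k) {x : List α}
    {h : History α} (hh : h.length = i) {r : P.Coins k x}
    (hr : r ∈ (P.game bit k x).cons h) (hm : ∀ q ∈ h, q.1 ∈ P.messages x)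
    (w : Fin (gp.eval x.length) → Bool) :
    queryX bit (enc bit ((List.ofFn fun s => bit (w s)) :: P.rewardInput bit k x h r)) = x ∧
    queryH P bit i (enc bit ((List.ofFn fun s => bit (w s)) :: P.rewardInput bit k x h r)) = h ∧
    queryBits bit gp (enc bit ((List.ofFn fun s => bit (w s)) :: P.rewardInput bit k x h r)) =
      List.ofFn w := by
  set q := enc bit ((List.ofFn fun s => bit (w s)) :: P.rewardInput bit k x h r)
  have hq : dec bit q = (List.ofFn fun s => bit (w s)) :: P.rewardInput bit k x h r := dec_enc bit _
  have h₁ : queryX bit q = x := by rw [queryX, hq]; rfl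
  have hms : ∀ t (ht : t < h.length), queryMs P bit q t = h[t].1 := by
    intro t ht
    rw [queryMs, hq, h₁, List.getD_cons_succ,
      (P.rewardInput_getD bit (by omega) r ht).1]
    exact List.take_of_length_le ((P.mem_messages x).1 (hm _ (List.getElem_mem ht)))
  have hrs : queryRs P bit i q = (P.coinStrings bit r).take i := by
    refine List.ext_getElem ?_ fun t h₂ h₃ => ?_
    · simp [queryRs, Protocol.coinStrings]
      omega
    · have ht : t < i := by simpa [queryRs] using h₂
      have := (P.rewardInput_getD bit (by omega) r (show t < h.length by omega)).2
      simp only [queryRs, List.getElem_map, List.getElem_range, hq, h₁, List.getElem_take]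
      rw [show 2 * t + 3 = (2 * t + 2) + 1 by omega, List.getD_cons_succ, this,
        List.getD_eq_getElem _ _ (by simp [Protocol.coinStrings]; omega)]
      simp only [Protocol.coinStrings, List.getElem_ofFn]
      exact toBits_ofFn bit _
  refine ⟨h₁, ?_, ?_⟩
  · rw [queryH, h₁, hrs, Protocol.history_take _ _ _ le_rfl, Protocol.history_eq_run, ← hh]
    exact (Game.mem_cons_iff_run hms).1 hr
  · rw [queryBits, h₁, hq, List.headD_cons, toBits_ofFn, List.map_ofFn]
    congr 1
    funext s
    simp

/-- Distinct multiples of 2^-K differ by at least 2^-K, which scales to at least 2^(N+2), more than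
the admitted 2 · 2^N. Of the two extra digits, one absorbs the factor 2 and the other makes the
inequality strict. -/
theorem two_mul_sub_le {K N g : ℕ} (hg : K + N + 2 ≤ g) {c : ℚ} {n : ℕ} (hc : 0 < c)
    (hn : n ≤ 2 ^ N) {a b : ℚ} (ha : ∃ z : ℤ, 2 ^ K * a = z) (hb : ∃ z : ℤ, 2 ^ K * b = z)
    (h : c * 2 ^ g * (a - b) ≤ 2 * (c * n)) : a ≤ b := by
  obtain ⟨y, hy⟩ := ha
  obtain ⟨z, hz⟩ := hb
  by_contra hlt
  rw [not_le] at hlt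
  have h₁ : (2 : ℚ) ^ g * (a - b) ≤ 2 * n := by
    refine le_of_mul_le_mul_left ?_ hc
    linarith
  have h₂ : (z : ℚ) < y := by
    rw [← hy, ← hz]
    exact mul_lt_mul_of_pos_left hlt (by positivity)
  have h₃ : (1 : ℚ) ≤ y - z := by
    have : z + 1 ≤ y := by exact_mod_cast h₂
    have : (z : ℚ) + 1 ≤ y := by exact_mod_cast this
    linarith
  obtain ⟨d, rfl⟩ := Nat.exists_eq_add_of_le hg
  have h₄ : (n : ℚ) ≤ 2 ^ N := by exact_mod_cast hn
  have h₅ : (2 : ℚ) ^ (K + N + 2 + d) * (a - b) = 2 ^ N * 2 ^ d * 4 * (y - z) := by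
    rw [← hy, ← hz]
    ring
  have h₆ : (1 : ℚ) ≤ 2 ^ d := one_le_pow₀ (by norm_num)
  have h₇ : (0 : ℚ) < 2 ^ N := by positivity
  rw [h₅] at h₁
  have h₈ : (2 : ℚ) ^ N * 4 ≤ 2 ^ N * 2 ^ d * 4 * (y - z) := by
    have : (1 : ℚ) ≤ 2 ^ d * (y - z) := by nlinarith
    nlinarith
  linarith

/-- The first `i` rounds with an oracle for the remaining `j` rounds. -/
theorem mem_DRMAOneQuery {i j : ℕ} (hi : 0 < i) (hj : 0 < j) {L : Language α}
    (hL : L ∈ DRMA bit (i + j)) : L ∈ DRMAOneQuery bit i (FRMA bit j) := by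
  classical
  obtain ⟨P, hP, hc, hφ⟩ := exists_claim_form (Nat.add_pos_left hi j) hL
  obtain ⟨hR, hc⟩ := (P.computes_iff bit _).1 hc
  obtain ⟨p, hp⟩ := exists_rewardLen P bit hP (i + j)
  -- The number of spare coins adds the digits of a reward, the total number of simulated coins, and
  -- the two digits required by `two_mul_sub_le`.
  let gp : Polynomial ℕ := p + .C (i + j) * P.coinLen + 2
  have hgp : ∀ n, gp.eval n = p.eval n + (i + j) * P.coinLen.eval n + 2 := fun n => by simp [gp]
  let B := thresholdLanguage P bit i gp j
  have hB : B ∈ DRMA bit j := thresholdLanguage_mem hj hP hR hp fun n => by rw [hgp]; omega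
  let S := Simulation.refl P hP
  obtain ⟨ml, cl, hsim⟩ := S.exists_simulates gp hi
    (show S.i + i ≤ i + j by change 0 + i ≤ i + j; omega)
  let spare : List (List α) → List α := fun u =>
    ((u.getD 2 []).drop ((i + j) * S.coinLen (u.headD []))).take (gp.eval (u.headD []).length)
  -- Only the reward consults the oracle. The messages are simulated directly and the value is the
  -- claim, so there is one query per run.
  let OP : OracleProtocol α := ⟨ml, cl, ⟨fun _ => [], fun q => S.V i q.1⟩,
    ⟨fun u => [enc bit (spare u :: S.rewardInput (i + j) (S.i + i) u)],
      fun q => [claim bit (q.2.headD [])]⟩,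
    ⟨fun _ => [], fun q => [bit (claim bit (S.μ (q.1.headD []) (q.1.getD 1 [])))]⟩⟩
  have hspare : PT (str α).list (str α) spare :=
    PT.takeStr (PT.unaryPoly gp (PT.codeLength.comp (PT.headD (c := str α) [])))
      (PT.dropStr (PT.unaryMul (PT.unaryConst (i + j)) (S.polyTime_unary_comp _ (PT.headD [])))
        (PT.getD 2 []))
  refine ⟨charFn bit B, hB, OP, ⟨⟨PT.const (c := (str α).list) (d := (str α).list) [], ?_⟩,
    ⟨?_, ?_⟩, ⟨PT.const (c := (str α).list) (d := (str α).list) [], ?_⟩⟩, ?_, ?_⟩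
  · exact PT.to_pairCode ((S.polyTime_V' i).comp PT.fst)
  · exact PT.singleton.comp ((PT.enc bit).comp (PT.cons hspare (S.polyTime_rewardInput _ _)))
  · refine PT.to_pairCode (d := str Bool) ?_
    exact (PT.letter (d := str Bool) fun b => [b]).comp
      (PT.claim bit ((PT.headD []).comp PT.snd))
  · exact PT.to_pairCode (d := str α) (PT.bitString bit (PT.claim bit (S.polyTime_μ
      ((PT.headD []).comp PT.fst) ((PT.getD 1 []).comp PT.fst))))
  · have key : ∀ x ms (r : (OP.withOracle (charFn bit B)).Coins i x),
        ∀ l ∈ OP.queryLists bit i (charFn bit B) x ms r, l = OP.R.ask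
          ((OP.withOracle (charFn bit B)).rewardInput bit i x
            ((OP.withOracle (charFn bit B)).run bit i x ms r i) r) := by
      rintro x ms r l ⟨hl, ⟨t, -, rfl⟩ | rfl | rfl⟩
      · exact absurd rfl hl
      · rfl
      · exact absurd rfl hl
    refine ⟨fun x ms r _ l hl l' hl' => (key x ms r l hl).trans (key x ms r l' hl').symm,
      fun x ms r _ l hl => ?_⟩
    rw [key x ms r l hl]
    exact le_rfl
  · set Q := OP.withOracle (charFn bit B)
    have hrew : ∀ u, Q.R u = [decide (enc bit (spare u :: S.rewardInput (i + j) (S.i + i) u) ∈ B)] := by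
      intro u
      change [claim bit (charFn bit B _)] = _
      rw [charFn, claim_of_head? bit rfl]
    refine (Q.computes_iff bit i).2 ⟨fun u => ?_, fun x ms r hr => ?_⟩
    · rw [hrew, binFrac, binFrac]
      split <;> norm_num
    · have hS : S.Simulates Q (i + j) i (gp.eval x.length) x := hsim Q rfl rfl rfl x
      obtain ⟨K, hKH, hKμ, hKπ, hKθ⟩ := hS.exists_cover bit
      have hη : ∀ h, K.η h = S.H x ++ h.map fun p => (S.μ x p.1, p.2) := fun h => by
        rw [Game.Cover.η, hKH, hKμ]
      have hηm : ∀ h, ∀ q ∈ K.η h, q.1 ∈ P.messages x := by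
        intro h q hq
        rw [Game.Cover.η, hKH] at hq
        obtain ⟨q', -, rfl⟩ := List.mem_map.1 hq
        exact K.mem _
      have hrat : (P.game bit (i + j) x).RationalTo (i + j) i (fun s => K.μ (ms s)) (K.π r) := by
        -- The 2^g thresholds multiply the scale but not the error: at most one threshold too many
        -- or too few is counted for each tuple of simulated coins.
        refine K.rationalTo hKH (c := K.c * 2 ^ gp.eval x.length) (ε := K.c) (i := j)
          (mul_pos K.c_pos (by positivity)) (fun m hm => ?_) (fun h hh => ?_)
          (fun n h m m' hn hm' hle => ?_) hr
        · obtain ⟨m', h₁, -, h₃⟩ := hS.exists_message bit true hm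
          exact ⟨m', h₁, by rw [hKμ, h₃]⟩
        · set e := (P.game bit (i + j) x).opt j (K.η h) with he
          have hlen : (K.η h).length = i := by
            rw [K.length_η, hKH, hh]
            exact Nat.zero_add i
          rw [K.tot_zero hh.le (F := fun _ w => if oddFrac (List.ofFn w) < e then 1 else 0)]
          · have h₁ := opt_mem (G := P.game bit (i + j) x) (fun h r => binFrac_nonneg _)
              (fun h r => hR _) j (K.η h)
            have h₂ := abs_sum_oddFrac_sub_le (g := gp.eval x.length) h₁.1 h₁.2
            rw [Finset.sum_const, nsmul_eq_mul, Game.tot]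
            rw [← he] at h₂
            have h₃ : ∀ c n s g : ℚ, 0 ≤ c → 0 ≤ n → |s - g * e| ≤ 1 →
                |c * (n * s) - c * g * (n * e)| ≤ c * n := by
              intro c n s g hc hn h
              rw [show c * (n * s) - c * g * (n * e) = (c * n) * (s - g * e) by ring, abs_mul,
                abs_of_nonneg (mul_nonneg hc hn)]
              exact mul_le_of_le_one_right (mul_nonneg hc hn) h
            exact h₃ _ _ _ _ K.c_pos.le (Nat.cast_nonneg _) h₂
          · intro r hr hr'
            have hr₂ := (K.mem_cons hh.le).2 ⟨hr, hr'⟩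
            -- The query decodes to the input, the history reached and the spare coins. Although it
            -- contains Arthur's strings, the answer depends on them only through the history and
            -- the threshold.
            obtain ⟨q₁, q₂, q₃⟩ := query_eq (gp := gp) (Nat.le_add_right i j) hlen hr₂ (hηm h) (K.θ r)
            change binFrac (Q.R (Q.rewardInput bit i x h r)) = _
            have hs : spare (Q.rewardInput bit i x h r) = List.ofFn fun s => bit (K.θ r s) := by
              rw [hKθ, hS.coins_θ bit]
              change ((List.getD _ 2 []).drop _).take _ = _
              rw [(Q.rewardInput_getD bit hh.le r (t := 0) (by omega)).2]
              cases Q.coinStrings bit r <;> rfl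
            rw [hrew, hs, hS.rewardInput_eq bit hh, ← hη, ← hKπ, binFrac, binFrac]
            rw [zero_div, add_zero]
            refine if_congr ?_ rfl rfl
            rw [decide_eq_true_eq]
            change oddFrac _ < Game.opt _ _ _ ↔ _
            rw [he]
            have : ∀ y g w, y = x → g = K.η h → w = List.ofFn (K.θ r) →
                (oddFrac w < (P.game bit (i + j) y).opt j g ↔
                  oddFrac (List.ofFn (K.θ r)) < (P.game bit (i + j) x).opt j (K.η h)) := by
              rintro _ _ _ rfl rfl rfl
              rfl
            exact this _ _ _ q₁ q₂ q₃
          · intro r hr hr'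
            refine absurd ?_ hr'
            rw [hKH]
            exact Game.mem_cons.2 fun t ht => absurd ht (Nat.not_lt_zero t)
        · have hint := exists_int_tot_game hp (x := x) (n := n + 1) (h := K.η h) (by omega) (hηm h)
          refine two_mul_sub_le (K := p.eval x.length) (N := (i + j) * P.coinLen.eval x.length) ?_
            K.c_pos (card_cons_le (P := P) (bit := bit) (k := i + j) (K.η h))
            (hint.2 n rfl m' hm') (hint.2 n rfl _ (K.mem m)) hle
          rw [hgp]
      -- Prolong to a rational run of all i + j rounds. Its first message, and with it the claim, is
      -- unchanged.
      obtain ⟨ms', h₁, h₂⟩ := hrat.extend (n := j)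
      rw [hc x ms' (K.π r) h₂, hφ]
      change [bit (claim bit _)] = [bit (claim bit (S.μ x ((Protocol.valueInput x _).getD 1 [])))]
      rw [valueInput_run hi, ← hKμ, ← h₁ 0 hi]
      exact congrArg (fun m => [bit (claim bit m)])
        (valueInput_run (G := P.game bit (i + j) x) (Nat.add_pos_left hi j))

end OneQuery

end RationalProof

namespace RationalProof

open Machine Cod

/-! ### Closure properties of FRMA -/

section Closure

variable {α : Type} [Finite α] {bit : Bool ↪ α}

theorem mem_FRMA_zero {f : List α → List α} : f ∈ FRMA bit 0 ↔ PT (str α) (str α) f := by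
  constructor
  · rintro ⟨P, hP, -, hc⟩
    have : f = fun x => P.φ [x] := funext fun x =>
      hc x (fun _ => []) (fun t => t.elim0) fun t ht => absurd ht (Nat.not_lt_zero t)
    rw [this]
    exact PT.comp (d := (str α).list) hP.2.2 PT.singleton
  · intro hf
    exact ⟨⟨0, 0, fun _ => [], fun _ => [], fun u => f (u.headD [])⟩,
      ⟨PT.const (c := (str α).list) (d := str α) [], PT.const (c := (str α).list) (d := str Bool) [],
        hf.comp (PT.headD [])⟩, fun _ => zero_le_one, fun _ _ _ _ => rfl⟩

-- The value input lacks Arthur's last answer. Reading it as pairs supplies `[]` in that place, and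
-- cutting to 2n − 1 entries removes the dummy again.
omit [Finite α] in
theorem pairsOf_dropLast (h : History α) {n : ℕ} (hn : h.length = n) (g : List α → List α) :
    (History.flat ((pairsOf n h.flat.dropLast).map fun q => (g q.1, q.2))).take (2 * n - 1) =
      (History.flat (h.map fun q => (g q.1, q.2))).take (2 * n - 1) := by
  induction h using List.reverseRecOn with
  | nil =>
    subst hn
    rfl
  | append_singleton h p _ =>
    obtain ⟨m, a⟩ := p
    have hf : ∀ (h : History α) m a, History.flat (h ++ [(m, a)]) = History.flat h ++ [m, a] := by
      simp [History.flat]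
    have h₁ : (History.flat (h ++ [(m, a)])).dropLast = History.flat h ++ [m] := by
      rw [hf]
      simp
    have h₂ : pairsOf n (History.flat h ++ [m]) = h ++ [(m, [])] := by
      have := pairsOf_flat (h ++ [(m, [])]) []
      rw [hf, show List.length (h ++ [(m, ([] : List α))]) = n by simpa using hn] at this
      rw [← this, pairsOf, pairsOf]
      have key : ∀ (l : List (List α)) t, l.getD t [] = (l ++ [[]] ++ []).getD t [] := by
        intro l t
        rw [List.append_nil]
        rcases lt_or_ge t l.length with ht | ht
        · rw [List.getD_append _ _ _ _ ht]
        · rw [List.getD_append_right _ _ _ _ ht, List.getD_eq_default _ _ ht]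
          cases t - l.length <;> rfl
      have key' := key (History.flat h ++ [m])
      simp only [List.append_assoc, List.cons_append, List.nil_append] at key' ⊢
      simp only [← key']
    rw [h₁, h₂, List.map_append, List.map_append]
    simp only [List.map_cons, List.map_nil]
    rw [hf, hf]
    have hl : 2 * n - 1 = (History.flat (h.map fun q => (g q.1, q.2))).length + 1 := by
      rw [History.length_flat, List.length_map, ← hn, List.length_append, List.length_singleton]
      omega
    rw [hl, List.take_length_add_append, List.take_length_add_append]
    rfl

/-- The functions computed by protocols are closed under changes of the input and the value. -/
theorem FRMA_comp {j : ℕ} {O X : List α → List α} (hO : O ∈ FRMA bit j)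
    (hX : PT (str α) (str α) X) {post : List α × List α → List α}
    (hpost : PT ((str α).prod (str α)) (str α) post) :
    (fun ξ => post (ξ, O (X ξ))) ∈ FRMA bit j := by
  rcases Nat.eq_zero_or_pos j with rfl | hj
  · exact mem_FRMA_zero.2 (hpost.comp (PT.pair PT.id ((mem_FRMA_zero.1 hO).comp hX)))
  obtain ⟨P, hP, hc⟩ := hO
  obtain ⟨hR, hc⟩ := (P.computes_iff bit j).1 hc
  let S : Simulation α := ⟨P, X, fun _ => [], 0, fun _ => rfl, hP.1, hX, PT.nil⟩
  obtain ⟨ml, cl, hsim⟩ := S.exists_simulates 0 hj (show S.i + j ≤ j from (Nat.zero_add j).le)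
  let Q : Protocol α := ⟨ml, cl, S.V j, fun u => P.R (S.rewardInput j (S.i + j) u), fun u =>
    post (u.headD [], P.φ (X (u.headD []) ::
      (History.flat ((pairsOf j u.tail).map fun q => (S.μ (u.headD []) q.1, q.2))).take (2 * j - 1)))⟩
  refine ⟨Q, ⟨S.polyTime_V' j, PT.comp (d := (str α).list) (e := str Bool) hP.2.1 (S.polyTime_rewardInput _ _),
    hpost.comp (PT.pair (PT.headD []) (PT.comp (d := (str α).list) hP.2.2 (PT.cons
      (hX.comp (PT.headD [])) ((PT.take _).comp (PT.historyFlat.comp ?_)))))⟩,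
    (Q.computes_iff bit j).2 ⟨fun u => hR _, fun ξ ms r hr => ?_⟩⟩
  · exact PT.map (v := str α) (c := (str α).prod (str α)) (d := (str α).prod (str α))
      (f := fun p => (S.μ p.1 p.2.1, p.2.2))
      (PT.pair (S.polyTime_μ PT.fst (PT.fst.comp PT.snd)) (PT.snd.comp PT.snd)) (PT.headD [])
      ((PT.pairsOf j).comp PT.tail)
  · have hS : S.Simulates Q j j 0 ξ := by
      simpa using hsim Q rfl rfl rfl ξ
    obtain ⟨K, hKH, hKμ, hKπ, -⟩ := hS.exists_cover bit
    have hη : ∀ h, K.η h = S.H ξ ++ h.map fun p => (S.μ ξ p.1, p.2) := fun h => by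
      rw [Game.Cover.η, hKH, hKμ]
    have hrat : (P.game bit j (X ξ)).RationalTo (j + 0) j (fun s => K.μ (ms s)) (K.π r) := by
      -- The reward is copied exactly, so ε = 0 and no gap between values is needed.
      refine K.rationalTo hKH (c := K.c) (ε := 0) (i := 0) K.c_pos (fun m hm => ?_) (fun h hh => ?_)
        (fun n h m m' _ _ hle => ?_) hr
      · obtain ⟨m', h₁, -, h₃⟩ := hS.exists_message bit true hm
        exact ⟨m', h₁, by rw [hKμ, h₃]⟩
      · rw [K.tot_zero hh.le (F := fun r _ => (P.game bit j (X ξ)).rew (K.η h) r)]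
        · simp only [Finset.sum_const, Finset.card_univ, Fintype.card_unique, one_smul]
          rw [Game.tot_zero]
          exact (by simp : ∀ x y : ℚ, |x - x| ≤ 0 * y) _ _
        · intro r _ _
          change binFrac (P.R (S.rewardInput j (S.i + j) (Q.rewardInput bit j ξ h r))) = _
          rw [hS.rewardInput_eq bit hh, ← hη, ← hKπ]
        · intro r _ hr'
          refine absurd ?_ hr'
          rw [hKH]
          exact Game.mem_cons.2 fun t ht => absurd ht (Nat.not_lt_zero t)
      · rw [zero_mul, mul_zero] at hle
        have := nonpos_of_mul_nonpos_right hle K.c_pos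
        linarith
    have hval := hc (X ξ) _ _ hrat
    have hlen := Game.length_run (G := Q.game bit j ξ) ms r j
    have hrun : (P.game bit j (X ξ)).run (fun s => K.μ (ms s)) (K.π r) j =
        List.map (fun p => (S.μ ξ p.1, p.2)) ((Q.game bit j ξ).run ms r j) :=
      (K.run_eq hKH ms r le_rfl).trans (hη _)
    rw [hrun, valueInput_eq (n := j) (by rw [List.length_map, hlen])] at hval
    change post (ξ, O (X ξ)) = post (ξ, P.φ (X ξ :: (History.flat (List.map _
      (pairsOf j (History.flat ((Q.game bit j ξ).run ms r j)).dropLast))).take _))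
    rw [hval]
    congr 4
    exact (pairsOf_dropLast _ hlen (S.μ ξ)).symm

/-- The values of the computed functions have polynomial length. -/
theorem exists_valueLen {j : ℕ} {O : List α → List α} (hO : O ∈ FRMA bit j) :
    ∃ p : Polynomial ℕ, ∀ y, (O y).length ≤ p.eval y.length := by
  obtain ⟨P, hP, hc⟩ := hO
  obtain ⟨-, hc⟩ := (P.computes_iff bit j).1 hc
  obtain ⟨pV, hV⟩ := PT.length_le (c := (str α).list) (d := str α) hP.1
  obtain ⟨pφ, hφ⟩ := PT.length_le (c := (str α).list) (d := str α) hP.2.2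
  -- The bounding polynomial may grow from round to round; it stays a polynomial because the number
  -- of rounds is fixed.
  have hrun : ∀ t, ∃ p : Polynomial ℕ, ∀ x ms (r : P.Coins j x), (∀ s < t, ms s ∈ P.messages x) →
      (listCode (fun s => s) (History.flat ((P.game bit j x).run ms r t))).length ≤
        p.eval x.length := by
    intro t
    induction t with
    | zero => exact ⟨0, fun x ms r _ => Nat.zero_le _⟩
    | succ t ih =>
      obtain ⟨p, hp⟩ := ih
      let b : Polynomial ℕ := .X + 1 + p + P.msgLen + 1 + .C j * (P.coinLen + 1)
      refine ⟨p + P.msgLen + 1 + pV.comp b + 1, fun x ms r hms => ?_⟩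
      have h₁ := hp x ms r fun s hs => hms s (by omega)
      have h₂ := (P.mem_messages x).1 (hms t (by omega))
      have hcoins : ∀ n, (listCode (fun s => s) ((P.coinStrings bit r).take n)).length ≤
          j * (P.coinLen.eval x.length + 1) := by
        intro n
        rw [length_str_list]
        have h₃ : ∀ s ∈ ((P.coinStrings bit r).take n).map List.length, s ≤ P.coinLen.eval x.length := by
          intro s hs
          obtain ⟨w, hw, rfl⟩ := List.mem_map.1 hs
          obtain ⟨t, rfl⟩ := (List.mem_ofFn' _ _).1 (List.mem_of_mem_take hw)
          simp
        have h₄ := List.sum_le_card_nsmul _ _ h₃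
        have h₅ : ((P.coinStrings bit r).take n).length ≤ j := by
          simp [Protocol.coinStrings]
        rw [List.length_map, smul_eq_mul] at h₄
        nlinarith
      have h₃ : (listCode (fun s => s)
          (P.arthurInput bit j x ((P.game bit j x).run ms r t) (ms t) r)).length ≤ b.eval x.length := by
        have := hcoins (List.length ((P.game bit j x).run ms r t) + 1)
        rw [Protocol.arthurInput, length_list_cons, list_append, List.length_append,
          length_list_cons]
        simp only [b, Polynomial.eval_add, Polynomial.eval_mul, Polynomial.eval_X,
          Polynomial.eval_one, Polynomial.eval_C]
        omega
      have h₄ := (hV (P.arthurInput bit j x ((P.game bit j x).run ms r t) (ms t) r)).trans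
        (eval_mono pV h₃)
      have h₅ : History.flat ((P.game bit j x).run ms r (t + 1)) =
          History.flat ((P.game bit j x).run ms r t) ++
            [ms t, P.V (P.arthurInput bit j x ((P.game bit j x).run ms r t) (ms t) r)] := by
        rw [Game.run]
        simp [History.flat, Protocol.reply]
      rw [h₅, list_append, List.length_append, length_list_cons, length_list_cons]
      simp only [Polynomial.eval_add, Polynomial.eval_comp, Polynomial.eval_one]
      change (P.V _).length ≤ pV.eval (b.eval x.length) at h₄
      rw [list_nil, List.length_nil]
      omega
  obtain ⟨p, hp⟩ := hrun j
  refine ⟨pφ.comp (.X + 1 + p), fun y => ?_⟩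
  -- A rational run exists for any coins, and its value is `O y`; so a bound for this one run bounds
  -- the function.
  obtain ⟨ms, hms⟩ := (P.game bit j y).exists_rational j fun _ _ => true
  have h₁ := hp y ms (fun _ _ => true) fun s hs => (hms s hs).1
  have h₂ : ∀ l : List (List α), (listCode (fun s => s) l.dropLast).length ≤
      (listCode (fun s => s) l).length := by
    intro l
    rw [List.dropLast_eq_take]
    conv_rhs => rw [← List.take_append_drop (l.length - 1) l, list_append, List.length_append]
    omega
  have h₃ : (listCode (fun s => s) (Protocol.valueInput y
      ((P.game bit j y).run ms (fun _ _ => true) j))).length ≤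
      Polynomial.eval y.length (.X + 1 + p) := by
    have := h₂ (History.flat ((P.game bit j y).run ms (fun _ _ => true) j))
    rw [Protocol.valueInput, length_list_cons]
    simp only [Polynomial.eval_add, Polynomial.eval_X, Polynomial.eval_one]
    omega
  rw [hc y ms _ hms, Polynomial.eval_comp]
  exact (hφ _).trans (eval_mono pφ h₃)

end Closure

end RationalProof

namespace RationalProof

open Machine Cod

/-! ### From a function oracle to a language oracle -/

section Decoding

variable {α S : Type} (bit : Bool ↪ α)

/-- Reads the answers to queries about the elements of the list `l`, over and over again, and
outputs the elements for which the answer is yes. -/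
@[reducible]
noncomputable def selector (l : List S) (hl : 0 < l.length) : Transducer α S where
  Q := Fin l.length
  start := ⟨0, hl⟩
  next n _ := if h : n + 1 < l.length then ⟨n + 1, h⟩ else ⟨0, hl⟩
  emit n c := open Classical in if c = bit true then [l[n]] else []
  last _ := []

variable {bit}

/-- After a full block of answers the counter is back at its start, so blocks are decoded
independently. -/
theorem selector_block {l : List S} (hl : 0 < l.length) (b : S → Bool) (v : List α) :
    (selector bit l hl).out ((l.map fun s => bit (b s)) ++ v) =
      l.filter b ++ (selector bit l hl).out v := by
  have key : ∀ (n : ℕ) (l₂ : List S), l.drop n = l₂ →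
      (selector bit l hl).outFrom (if h : n < l.length then ⟨n, h⟩ else ⟨0, hl⟩)
        ((l₂.map fun s => bit (b s)) ++ v) = l₂.filter b ++ (selector bit l hl).out v := by
    intro n l₂
    induction l₂ generalizing n with
    | nil =>
      intro h
      rw [dif_neg (not_lt.2 (List.drop_eq_nil_iff.1 h))]
      rfl
    | cons s l₂ ih =>
      intro h
      have hn : n < l.length := by
        by_contra hn
        rw [List.drop_eq_nil_of_le (not_lt.1 hn)] at h
        exact List.cons_ne_nil _ _ h.symm
      rw [List.drop_eq_getElem_cons hn] at h
      obtain ⟨h₁, h₂⟩ := List.cons.inj h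
      have ih := ih (n + 1) h₂
      rw [dif_pos hn, List.map_cons, List.cons_append, Transducer.outFrom]
      refine (congrArg _ ih).trans ?_
      rw [← List.append_assoc]
      congr 1
      have he : (selector bit l hl).emit ⟨n, hn⟩ (bit (b s)) = if b s then [l[n]] else [] := by
        simp
      rw [he, h₁]
      cases hb : b s <;> simp [hb]
  have := key 0 l rfl
  rwa [dif_pos hl] at this

theorem filter_getElem? {s : List S} [DecidableEq S] {l : List S} (hl : l.Nodup)
    (hm : ∀ a, a ∈ l) (n : ℕ) : l.filter (fun a => decide (s[n]? = some a)) = (s[n]?).toList := by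
  cases s[n]? with
  | none => simp
  | some a =>
    have h := hl.filter fun b => decide (some a = some b)
    refine (List.perm_of_nodup_nodup_toFinset_eq h (List.nodup_singleton a) ?_).eq_singleton
    ext b
    simp [hm, eq_comm]

theorem flatMap_getElem? (s : List S) {n : ℕ} (hn : s.length ≤ n) :
    (List.range n).flatMap (fun t => (s[t]?).toList) = s := by
  induction s generalizing n with
  | nil => simp
  | cons a s ih =>
    obtain ⟨n, rfl⟩ : ∃ m, n = m + 1 := ⟨n - 1, by simp at hn; omega⟩
    rw [List.range_succ_eq_map, List.flatMap_cons, List.flatMap_map]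
    simpa using ih (n := n) (by simpa using hn)

end Decoding

section Digits

variable {α : Type} [Finite α] (bit : Bool ↪ α) (O : List α → List α)

/-- The language that tells the symbols of the values of a function. -/
def digitLanguage : Language α :=
  {ξ | ((O ((dec bit ξ).headD [])).map some ++ [none])[((dec bit ξ).getD 1 []).length]? =
    some ((dec bit ξ).getD 2 []).head?}

/-- The query about one symbol of a value. -/
def digitQuery (y w : List α) (o : Option α) : List α := enc bit [y, w, o.toList]

variable {bit O}

/-- A symbol test is postprocessing of one value of `O` at a preprocessed input, so `FRMA_comp`
applies with the same number of rounds. -/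
theorem digitLanguage_mem {j : ℕ} (hO : O ∈ FRMA bit j) : digitLanguage bit O ∈ DRMA bit j := by
  classical
  let post : List α × List α → List α := fun p =>
    [bit (decide (((p.2.map some ++ [none]).drop ((dec bit p.1).getD 1 []).length).head? =
      some ((dec bit p.1).getD 2 []).head?))]
  have hpost : PT ((str α).prod (str α)) (str α) post := by
    refine PT.bitString bit (PT.letterOp (fun a b => decide (a = some b)) (PT.headStr.comp
      (PT.dropStr (PT.codeLength.comp ((PT.getD (c := str α) 1 []).comp ((PT.dec bit).comp PT.fst)))
        (PT.appendStr ((PT.mapStr some).comp PT.snd) (PT.const [none]))))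
      (PT.headStr.comp ((PT.getD 2 []).comp ((PT.dec bit).comp PT.fst))))
  have := FRMA_comp hO ((PT.headD []).comp (PT.dec bit)) hpost
  change charFn bit _ ∈ FRMA bit j
  convert this using 1
  funext ξ
  simp only [charFn, post, List.head?_drop]
  congr 3

omit [Finite α] in
theorem charFn_digitQuery (y w : List α) (o : Option α) : open Classical in
    charFn bit (digitLanguage bit O) (digitQuery bit y w o) =
      [bit (decide (((O y).map some ++ [none])[w.length]? = some o))] := by
  have : digitQuery bit y w o ∈ digitLanguage bit O ↔
      ((O y).map some ++ [none])[w.length]? = some o := by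
    change (_ = _) ↔ _
    rw [digitQuery, dec_enc]
    cases o <;> rfl
  rw [charFn]
  congr 2
  exact decide_eq_decide.2 this

variable (bit) (B : Polynomial ℕ) (l : List (Option α))

/-- The queries about all symbols of a value. -/
def digitQueries (y : List α) : List (List α) :=
  (List.range (B.eval y.length + 1)).flatMap fun n =>
    l.map (digitQuery bit y (List.replicate n (bit true)))

/-- The list of values that is described by the answers. -/
noncomputable def digitValues (hl : 0 < l.length) (ans : List (List α)) : List (List α) :=
  splitNone ((selector bit l hl).out ans.flatten)

variable {bit B l}

theorem polyTime_digitQueries : PT (str α) (str α).list (digitQueries bit B l) := by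
  let f : List α × List Unit → List (List α) := fun p =>
    l.map fun o => enc bit [p.1, p.2.map fun _ => bit true, o.toList]
  have hf : PT ((str α).prod (str Unit)) (str α).list f :=
    PT.mapList l fun o => (PT.enc bit).comp (PT.cons PT.fst (PT.cons ((PT.mapStr _).comp PT.snd)
      (PT.const _)))
  have := PT.flatten.comp (PT.map hf PT.id
    (PT.inits (PT.unaryPoly B (PT.codeLength (c := str α)))))
  convert this using 2 with y
  rw [digitQueries, List.flatMap_def, List.map_map]
  congr 1
  refine List.map_congr_left fun n _ => ?_
  simp [f, digitQuery, PT.unary]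

theorem polyTime_digitValues (hl : 0 < l.length) :
    PT (str α).list (str α).list (digitValues bit l hl) :=
  PT.splitNone.comp ((PT.of_transducer (c := str α) (d := str (Option α)) (selector bit l hl)
    fun _ => rfl).comp PT.flattenStr)

-- At each position of the value or of its terminator exactly one symbol is confirmed, and past the
-- terminator none. The confirmed symbols of all queries therefore spell the tuple code of the
-- values.
omit [Finite α] in
theorem digitValues_eq (hB : ∀ y, (O y).length ≤ B.eval y.length) (hl : 0 < l.length)
    (hd : l.Nodup) (hm : ∀ o, o ∈ l) (ys : List (List α)) :
    digitValues bit l hl ((ys.flatMap (digitQueries bit B l)).map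
      (charFn bit (digitLanguage bit O))) = ys.map O := by
  classical
  rw [digitValues, ← splitNone_tupleCode (ys.map O)]
  congr 1
  have h₁ : ∀ (y : List α) (N : List ℕ) (v : List α), (selector bit l hl).out
      (((N.flatMap fun n => l.map (digitQuery bit y (List.replicate n (bit true)))).map
        (charFn bit (digitLanguage bit O))).flatten ++ v) =
      N.flatMap (fun n => (((O y).map some ++ [none])[n]?).toList) ++
        (selector bit l hl).out v := by
    intro y N
    induction N with
    | nil => intro v; rfl
    | cons n N ih =>
      intro v
      rw [List.flatMap_cons, List.map_append, List.flatten_append, List.append_assoc,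
        List.flatMap_cons, List.append_assoc, ← ih, List.map_map]
      have : (l.map (charFn bit (digitLanguage bit O) ∘
          digitQuery bit y (List.replicate n (bit true)))).flatten =
          l.map fun o => bit (decide (((O y).map some ++ [none])[n]? = some o)) := by
        rw [← List.flatMap_def, List.map_eq_flatMap]
        congr 1
        funext o
        rw [Function.comp, charFn_digitQuery, List.length_replicate]
      rw [this, selector_block, filter_getElem? hd hm]
  have h₂ : ∀ (ys : List (List α)) (v : List α), (selector bit l hl).out
      (((ys.flatMap (digitQueries bit B l)).map (charFn bit (digitLanguage bit O))).flatten ++ v) =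
      tupleCode (ys.map O) ++ (selector bit l hl).out v := by
    intro ys
    induction ys with
    | nil => intro v; rfl
    | cons y ys ih =>
      intro v
      rw [List.flatMap_cons, List.map_append, List.flatten_append, List.append_assoc, digitQueries,
        h₁, ih, flatMap_getElem? _ (by simpa using hB y)]
      simp [tupleCode]
  have := h₂ ys []
  rw [List.append_nil] at this
  rw [this]
  exact List.append_nil _

end Digits

section Parallel

variable {α : Type} [Finite α] {bit : Bool ↪ α}

/-- Every query is expanded into the questions about all symbols of its answer. The decoded answers
are those of `O`, so the new protocol with its oracle equals the old one with `O`; rationality and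
the value need no new argument. -/
theorem DRMAOneQuery_subset (i j : ℕ) :
    DRMAOneQuery bit i (FRMA bit j) ⊆ DRMAParallel bit i (DRMA bit j) := by
  rintro L ⟨O, hO, P, hP, ⟨hone, -⟩, hc⟩
  have := Fintype.ofFinite α
  obtain ⟨B, hB⟩ := exists_valueLen hO
  let l : List (Option α) := Finset.univ.toList
  have hm : ∀ o, o ∈ l := fun o => Finset.mem_toList.2 (Finset.mem_univ o)
  have hl : 0 < l.length := List.length_pos_of_mem (hm none)
  let T : ∀ {β : Type}, OracleFn α β → OracleFn α β := fun F =>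
    ⟨fun u => (F.ask u).flatMap (digitQueries bit B l), fun q => F.out (q.1, digitValues bit l hl q.2)⟩
  have hT : ∀ {β : Type} (F : OracleFn α β),
      (T F).eval (charFn bit (digitLanguage bit O)) = F.eval O := by
    intro β F
    funext u
    change F.out (u, _) = F.out (u, _)
    rw [← digitValues_eq hB hl (Finset.nodup_toList _) hm (F.ask u)]
  have hTP : ∀ {β : Type} [Finite β] {F : OracleFn α β}, F.IsPolyTime → (T F).IsPolyTime := by
    intro β _ F hF
    have h : PT (str α).list (str α).list F.ask := hF.1
    refine ⟨(PT.flatMap polyTime_digitQueries).comp h, PT.to_pairCode (d := str β) ?_⟩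
    exact (PT.of_pairCode (d := str β) hF.2).comp
      (PT.pair PT.fst ((polyTime_digitValues hl).comp PT.snd))
  let P' : OracleProtocol α := ⟨P.msgLen, P.coinLen, T P.V, T P.R, T P.φ⟩
  have e : P'.withOracle (charFn bit (digitLanguage bit O)) = P.withOracle O := by
    rw [OracleProtocol.withOracle, OracleProtocol.withOracle, ← hT, ← hT, ← hT]
  refine ⟨digitLanguage bit O, digitLanguage_mem hO, P', ⟨hTP hP.1, hTP hP.2.1, hTP hP.2.2⟩,
    fun x ms r hms => ?_, e ▸ hc⟩
  have key : ∀ (Q : Protocol α), Q = P.withOracle O → ∀ r : Q.Coins i x,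
      (∀ t < i, ms t ∈ Q.messages x) → {l' : List (List α) | l' ≠ [] ∧
        ((∃ t < i, l' = (T P.V).ask (Q.arthurInput bit i x (Q.run bit i x ms r t) (ms t) r)) ∨
          l' = (T P.R).ask (Q.rewardInput bit i x (Q.run bit i x ms r i) r) ∨
          l' = (T P.φ).ask (Protocol.valueInput x (Q.run bit i x ms r i)))}.Subsingleton := by
    rintro Q rfl r hms
    -- Each new list of queries is the expansion of an old one, and the expansion of an empty list
    -- is empty. So two different nonempty lists in one run would come from two old ones.
    refine ((hone x ms r hms).image fun l' => l'.flatMap (digitQueries bit B l)).anti ?_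
    rintro l' ⟨hl', h⟩
    have hne : ∀ u : List (List α), l' = u.flatMap (digitQueries bit B l) → u ≠ [] := by
      rintro _ h rfl
      exact hl' h
    rcases h with ⟨t, ht, h⟩ | h | h
    · exact ⟨_, ⟨hne _ h, .inl ⟨t, ht, rfl⟩⟩, h.symm⟩
    · exact ⟨_, ⟨hne _ h, .inr (.inl rfl)⟩, h.symm⟩
    · exact ⟨_, ⟨hne _ h, .inr (.inr rfl)⟩, h.symm⟩
  exact key _ e r hms

/-- No oracle is needed if the protocol does not leave rounds to it. -/
theorem DRMA_subset_zero (i : ℕ) : DRMA bit i ⊆ DRMAOneQuery bit i (FRMA bit 0) := by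
  rintro L ⟨P, hP, hc⟩
  refine ⟨fun y => y, mem_FRMA_zero.2 PT.id, ⟨P.msgLen, P.coinLen, ⟨fun _ => [], fun q => P.V q.1⟩,
    ⟨fun _ => [], fun q => P.R q.1⟩, ⟨fun _ => [], fun q => P.φ q.1⟩⟩, ?_, ?_, hc⟩
  · have h := PT.const (c := (str α).list) (d := (str α).list) []
    exact ⟨⟨h, PT.to_pairCode (d := str α) (PT.comp (d := (str α).list) hP.1 PT.fst)⟩,
      ⟨h, PT.to_pairCode (d := str Bool) (PT.comp (d := (str α).list) (e := str Bool) hP.2.1 PT.fst)⟩,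
      ⟨h, PT.to_pairCode (d := str α) (PT.comp (d := (str α).list) hP.2.2 PT.fst)⟩⟩
  · have key : ∀ {x} {ms : ℕ → List α} {r} {l : List (List α)},
        l ∉ OracleProtocol.queryLists (⟨P.msgLen, P.coinLen, ⟨fun _ => [], fun q => P.V q.1⟩,
          ⟨fun _ => [], fun q => P.R q.1⟩, ⟨fun _ => [], fun q => P.φ q.1⟩⟩ : OracleProtocol α)
          bit i (fun y => y) x ms r := by
      rintro x ms r l ⟨hl, ⟨t, -, rfl⟩ | rfl | rfl⟩ <;> exact hl rfl
    exact ⟨fun x ms r _ l hl => absurd hl key, fun x ms r _ l hl => absurd hl key⟩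

/-- A protocol without rounds leaves everything to the oracle. -/
theorem DRMA_subset_oracle (j : ℕ) : DRMA bit j ⊆ DRMAOneQuery bit 0 (FRMA bit j) := by
  intro L hL
  refine ⟨charFn bit L, hL, ⟨0, 0, ⟨fun _ => [], fun _ => []⟩, ⟨fun _ => [], fun _ => []⟩,
    ⟨fun u => [u.headD []], fun q => q.2.headD []⟩⟩, ?_, ?_, ?_⟩
  · have h := PT.const (c := (str α).list) (d := (str α).list) []
    exact ⟨⟨h, PT.to_pairCode (d := str α) (PT.const [])⟩,
      ⟨h, PT.to_pairCode (d := str Bool) (PT.const [])⟩,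
      ⟨PT.comp (d := str α) (e := (str α).list) PT.singleton (PT.headD []), PT.to_pairCode ((PT.headD []).comp PT.snd)⟩⟩
  · have key : ∀ {x} {ms : ℕ → List α} {r} {l : List (List α)},
        l ∈ OracleProtocol.queryLists (⟨0, 0, ⟨fun _ => [], fun _ => []⟩, ⟨fun _ => [], fun _ => []⟩,
          ⟨fun u => [u.headD []], fun q => q.2.headD []⟩⟩ : OracleProtocol α)
          bit 0 (charFn bit L) x ms r → l = [x] := by
      rintro x ms r l ⟨hl, ⟨t, ht, -⟩ | rfl | rfl⟩
      · exact absurd ht (Nat.not_lt_zero t)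
      · exact absurd rfl hl
      · rfl
    exact ⟨fun x ms r _ l hl l' hl' => (key hl).trans (key hl').symm,
      fun x ms r _ l hl => by rw [key hl]; exact le_rfl⟩
  · exact ⟨fun _ => zero_le_one, fun x ms r _ => rfl⟩

end Parallel

end RationalProof

theorem mainTheorem9 {α : Type} [Finite α] (bit : Bool ↪ α) (i j : ℕ) :
    RationalProof.DRMA bit (i + j) ⊆
        RationalProof.DRMAOneQuery bit i (RationalProof.FRMA bit j) ∧
      RationalProof.DRMAOneQuery bit i (RationalProof.FRMA bit j) ⊆
        RationalProof.DRMAParallel bit i (RationalProof.DRMA bit j) := by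
  refine ⟨?_, RationalProof.DRMAOneQuery_subset i j⟩
  -- Both claims need a first message, so i = 0 and j = 0 are separate: one side then already does
  -- all the work.
  rcases Nat.eq_zero_or_pos j with rfl | hj
  · exact RationalProof.DRMA_subset_zero i
  rcases Nat.eq_zero_or_pos i with rfl | hi
  · rw [Nat.zero_add]
    exact RationalProof.DRMA_subset_oracle j
  · exact fun L hL => RationalProof.mem_DRMAOneQuery hi hj hL
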